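/- Let $W, W_1, W_2, \ldots$ be i.i.d. strictly positive random variables such that $\sup\{x\in\mathbb R:\mathbb P(W\le x)<1\}=1$ and $\mathbb P(W=1)>0$, and suppose that $\mathbb P(W\ge w^*)=1$ for some $w^*\in(0,1)$. Put $\theta:=1+\mathbb E[W]$. The weighted recursive tree with these weights is grown as follows: start with the single vertex $1$; for $n\ge 1$, given the weights and the tree on $\{1,\dots,n\}$, the new vertex $n+1$ is connected by one edge, directed towards the old vertex, to a vertex $i\in\{1,\ldots,n\}$ chosen with probability $W_i/(W_1+\cdots+W_n)$. Let $\mathcal Z_n(i)$ be the in-degree of vertex $i$ in the tree on $\{1,\dots,n\}$. Fix $k\in\mathbb N$ and $c\in(0,\theta/(\theta-1))$. For $i=1,\dots,k$ let $d_i=d_i(n)$ be integer sequences with $d_i(n)\to\infty$ as $n\to\infty$ and $d_i(n)\le c\log n$ for all $n$ sufficiently large. For each $n\ge k$ let $v_1,\ldots,v_k$ be vertices chosen uniformly at random without replacement from $\{1,\ldots,n\}$, independently of the weights and the tree. Then the event $\{\mathcal Z_n(v_i)\ge d_i\text{ for all }i\in\{1,\dots,k\}\}$ has positive probability for all $n$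 sufficiently large, and, conditionally on this event, the vector $$\left(\frac{\log v_i-\left(\log n-(1-\theta^{-1})d_i\right)}{\sqrt{(1-\theta^{-1})^2d_i}}\right)_{i=1,\dots,k}$$ converges in distribution, as $n\to\infty$, to $(M_i)_{i=1,\dots,k}$, where $M_1,\dots,M_k$ are independent standard normal random variables. -/

import Mathlib

open MeasureTheory ProbabilityTheory Filter Topology

/-- The σ-algebra generated by all vertex-weights `W 1, W 2, …` and by the edges created up to the
time at which the tree has `n` vertices, i.e. by `par 2, …, par n`. -/
@[reducible] def wrtHistory {Ω : Type*} (W : ℕ → Ω → ℝ) (par : ℕ → Ω → ℕ) (n : ℕ) : MeasurableSpace Ω :=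
  (⨆ i ∈ Set.Ici 1, MeasurableSpace.comap (W i) inferInstance) ⊔
    ⨆ j ∈ Set.Icc 2 n, MeasurableSpace.comap (par j) inferInstance

/-- The σ-algebra generated by all vertex-weights and all edges of the growing tree. -/
@[reducible] def wrtSigma {Ω : Type*} (W : ℕ → Ω → ℝ) (par : ℕ → Ω → ℕ) : MeasurableSpace Ω :=
  (⨆ i ∈ Set.Ici 1, MeasurableSpace.comap (W i) inferInstance) ⊔
    ⨆ j ∈ Set.Ici 2, MeasurableSpace.comap (par j) inferInstance

/-- The weighted recursive tree. Vertices carry the labels `1, 2, 3, …`; `W i` is the weight of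
vertex `i` (`i ≥ 1`) and `par j` is the vertex to which vertex `j` connects when it is introduced
(`j ≥ 2`). The values `W 0`, `par 0`, `par 1` play no role. The weights are i.i.d. and positive, and
vertex `n + 1` connects to `i ∈ {1, …, n}` with conditional probability
`W i / (W 1 + ⋯ + W n)`, given the weights and the tree on `{1, …, n}`. -/
structure IsWeightedRecursiveTree {Ω : Type*} [MeasurableSpace Ω] (P : Measure Ω)
    (W : ℕ → Ω → ℝ) (par : ℕ → Ω → ℕ) : Prop where
  measurable_weight : ∀ i, 1 ≤ i → Measurable (W i)
  measurable_par : ∀ j, 2 ≤ j → Measurable (par j)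
  indep_weight : iIndepFun (fun i : ℕ => W (i + 1)) P
  identDistrib_weight : ∀ i, 1 ≤ i → IdentDistrib (W i) (W 1) P P
  weight_pos : ∀ᵐ ω ∂P, 0 < W 1 ω
  connect : ∀ n, 1 ≤ n → ∀ i ∈ Finset.Icc 1 n,
    P[({ω | par (n + 1) ω = i}.indicator fun _ => (1 : ℝ)) | wrtHistory W par n]
      =ᵐ[P] fun ω => W i ω / ∑ l ∈ Finset.Icc 1 n, W l ω

/-- The law of the real random variable `X` has essential supremum one and an atom at one. -/
structure IsAtomWeight {Ω : Type*} [MeasurableSpace Ω] (P : Measure Ω) (X : Ω → ℝ) : Prop where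
  isLUB_one : IsLUB {x : ℝ | P {ω | X ω ≤ x} < 1} 1
  atom : 0 < P {ω | X ω = 1}

/-- In-degree of vertex `i` in the tree on `{1, …, n}`. -/
def inDegree {Ω : Type*} (par : ℕ → Ω → ℕ) (n i : ℕ) (ω : Ω) : ℕ :=
  ((Finset.Icc 2 n).filter fun j => par j ω = i).card

/-- `v 0, …, v (k - 1)` are sampled uniformly at random without replacement from `{1, …, n}`,
independently of the σ-algebra `m`. -/
structure IsUniformSample {Ω : Type*} (m : MeasurableSpace Ω) [MeasurableSpace Ω] (P : Measure Ω)
    (n k : ℕ) (v : Fin k → Ω → ℕ) : Prop where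
  measurable : ∀ i, Measurable (v i)
  map_eq : P.map (fun ω i => v i ω) =
    uniformOn {j : Fin k → ℕ | Function.Injective j ∧ ∀ i, j i ∈ Set.Icc 1 n}
  indep : Indep (⨆ i, MeasurableSpace.comap (v i) inferInstance) m P

/-- The event that each of the vertices `v i` has in-degree at least `d i` in the tree on
`{1, …, n}`. -/
def highDegreeEvent {Ω : Type*} {k : ℕ} (par : ℕ → Ω → ℕ) (n : ℕ) (v : Fin k → Ω → ℕ)
    (d : Fin k → ℤ) : Set Ω :=
  {ω | ∀ i, d i ≤ (inDegree par n (v i ω) ω : ℤ)}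

/-- The vector of rescaled log-labels of the vertices `v i`. -/
noncomputable def rescaledLabels {Ω : Type*} {k : ℕ} (θ : ℝ) (n : ℕ) (v : Fin k → Ω → ℕ)
    (d : Fin k → ℤ) (ω : Ω) : Fin k → ℝ := fun i =>
  (Real.log (v i ω) - (Real.log n - (1 - θ⁻¹) * d i)) / √((1 - θ⁻¹) ^ 2 * d i)

/-- The law of `X` under `P` conditioned on the event `E` (the zero measure if `P E = 0`). -/
noncomputable def condLaw {Ω S : Type*} [MeasurableSpace Ω] [MeasurableSpace S] (P : Measure Ω)
    (E : Set Ω) (X : Ω → S) : FiniteMeasure S :=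
  ⟨(P[|E]).map X, inferInstance⟩

/-- The law of `k` independent standard normal random variables. -/
noncomputable def stdNormalVector (k : ℕ) : FiniteMeasure (Fin k → ℝ) :=
  ⟨Measure.pi fun _ => gaussianReal 0 1, inferInstance⟩

/-! Put μ = θ - 1 = E[W] and p = P(W = 1). Given the weights, every new vertex picks its parent
independently of the earlier edges, so the in-degrees of k fixed vertices are counters of which each
round increments at most one (`jointTail`, `integral_mul_indicator_degreeEvent`). The first j
weights sum to about μ j, hence a vertex x of weight w has in-degree close to Poisson with mean
(w/μ) log(n/x). For a uniform label x, log(n/x) is nearly standard exponential, so reaching degree d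
has probability close to E[(W/(W+μ))^d]. Multiplied by θ^d this tends to p, because θw/(w+μ) ≤ 1 on
(0,1] with equality only at w = 1. Only vertices of weight one matter.

For weight one, θ^d e^{-t} P(Poisson(t/μ) ≥ d) is, as a function of t = log(n/x), the density of a
sum of d independent exponentials of mean μ/θ = 1 - θ⁻¹ and one standard exponential. This is read
off from the Laplace transform `integral_cexp_mul_poissonTail`. The central limit theorem for the
gamma law (`tendsto_gamma_charFun`) gives the normal limit with mean (1 - θ⁻¹)d and variance (1 -
θ⁻¹)²d.

The approximations have to be precise on the scale θ^{-d}, which may be polynomially small in n.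
From above, a product of one-counter supersolutions dominates the joint tail (`jointTail_le_prod`):
Poisson tails for labels beyond a threshold N = ⌈n^ε⌉, a Chernoff bound for earlier ones. The early
labels are negligible precisely because c < θ/(θ-1). From below, one restricts to weight-one
vertices beyond N and pays a second-order Taylor error in every round
(`prod_poissonTail_sub_le_jointTail`).

The two bounds are used asymmetrically. The lower bound is an explicit product measure on labels, of
mass tending to p^k and asymptotically normal. The upper bound is used only through its total mass,
which also tends to p^k. Hence the true measure is close to the explicit one in total variation
(`norm_sum_mul_sub_le`), and the limits of the characteristic functions agree
(`IsTuning.tendsto_sum_degreeMass`). Dividing by the total mass cancels p^k and yields the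
conditional law. -/

/-! ### Poisson tails as functions of the mean -/

/-- The probability that a Poisson random variable with mean `t` is at least `d`. -/
noncomputable def poissonTail (d : ℕ) (t : ℝ) : ℝ :=
  1 - Real.exp (-t) * ∑ r ∈ Finset.range d, t ^ r / r.factorial

theorem poissonTail_zero (t : ℝ) : poissonTail 0 t = 1 := by simp [poissonTail]

theorem poissonTail_at_zero (d : ℕ) : poissonTail d 0 = if d = 0 then 1 else 0 := by
  rcases d with _ | d
  · simp [poissonTail]
  · simp [poissonTail, Finset.sum_range_succ']

theorem poissonTail_succ (d : ℕ) (t : ℝ) :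
    poissonTail (d + 1) t = poissonTail d t - Real.exp (-t) * (t ^ d / d.factorial) := by
  simp only [poissonTail, Finset.sum_range_succ]; ring

theorem poissonTail_succ_le (d : ℕ) {t : ℝ} (ht : 0 ≤ t) :
    poissonTail (d + 1) t ≤ poissonTail d t := by
  rw [poissonTail_succ]
  have : 0 ≤ Real.exp (-t) * (t ^ d / d.factorial) := by positivity
  linarith

theorem poissonTail_antitone {t : ℝ} (ht : 0 ≤ t) : Antitone fun d => poissonTail d t :=
  antitone_nat_of_succ_le fun d => poissonTail_succ_le d ht

/-- The derivative of the tail in the mean is the Poisson mass at `d - 1`, written as a difference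
of tails. Truncated subtraction makes it 0 for `d = 0`, as it should be, so later arguments need no
case distinction. -/
theorem hasDerivAt_poissonTail (d : ℕ) (t : ℝ) :
    HasDerivAt (poissonTail d) (poissonTail (d - 1) t - poissonTail d t) t := by
  induction d with
  | zero =>
    have : poissonTail 0 = fun _ => (1 : ℝ) := funext poissonTail_zero
    simpa [this] using hasDerivAt_const t (1 : ℝ)
  | succ d ih =>
    have h1 : HasDerivAt (fun t : ℝ => Real.exp (-t) * (t ^ d / d.factorial))
        (-Real.exp (-t) * (t ^ d / d.factorial)
          + Real.exp (-t) * (d * t ^ (d - 1) / d.factorial)) t := by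
      have ha : HasDerivAt (fun t : ℝ => Real.exp (-t)) (-Real.exp (-t)) t := by
        simpa using (hasDerivAt_neg t).exp
      have hb := (hasDerivAt_pow d t).div_const (d.factorial : ℝ)
      exact ha.mul hb
    have h2 := ih.sub h1
    have h3 : poissonTail (d + 1) = poissonTail d - fun t => Real.exp (-t) * (t ^ d / d.factorial) :=
      funext fun t => poissonTail_succ d t
    rw [h3]
    refine h2.congr_deriv ?_
    simp only [Nat.add_sub_cancel, Pi.sub_apply]
    rcases d with _ | d
    · simp
    · rw [Nat.add_sub_cancel, poissonTail_succ d t, Nat.factorial_succ]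
      push_cast
      field_simp
      ring

theorem poissonTail_pred_sub_nonneg (d : ℕ) {t : ℝ} (ht : 0 ≤ t) :
    0 ≤ poissonTail (d - 1) t - poissonTail d t :=
  sub_nonneg.2 (poissonTail_antitone ht (Nat.sub_le d 1))

theorem continuous_poissonTail (d : ℕ) : Continuous (poissonTail d) := by
  unfold poissonTail; fun_prop

theorem poissonTail_monotoneOn (d : ℕ) : MonotoneOn (poissonTail d) (Set.Ici 0) := by
  refine monotoneOn_of_deriv_nonneg (convex_Ici 0) (continuous_poissonTail d).continuousOn
    (fun t _ => (hasDerivAt_poissonTail d t).differentiableAt.differentiableWithinAt) fun t ht => ?_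
  rw [(hasDerivAt_poissonTail d t).deriv]
  exact poissonTail_pred_sub_nonneg d (by simpa using (interior_subset ht))

theorem poissonTail_mono (d : ℕ) {s t : ℝ} (hs : 0 ≤ s) (hst : s ≤ t) :
    poissonTail d s ≤ poissonTail d t :=
  poissonTail_monotoneOn d hs (hs.trans hst) hst

theorem poissonTail_nonneg (d : ℕ) {t : ℝ} (ht : 0 ≤ t) : 0 ≤ poissonTail d t := by
  refine le_trans ?_ (poissonTail_mono d le_rfl ht)
  rw [poissonTail_at_zero]; split_ifs <;> norm_num

theorem poissonTail_le_one (d : ℕ) {t : ℝ} (ht : 0 ≤ t) : poissonTail d t ≤ 1 := by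
  rw [← poissonTail_zero t]; exact poissonTail_antitone ht (Nat.zero_le d)

/-- Thinning inequality: adding a Bernoulli variable with success probability at most
`1 - exp (-s)` is dominated by adding a Poisson variable with mean `s`. -/
theorem poissonTail_bernoulli_le (d : ℕ) {t s p : ℝ} (ht : 0 ≤ t) (hs : 0 ≤ s)
    (hp : p ≤ 1 - Real.exp (-s)) :
    (1 - p) * poissonTail d t + p * poissonTail (d - 1) t ≤ poissonTail d (t + s) := by
  -- The derivative in s is exp s times `poissonTail (d - 1) (t + s) - poissonTail (d - 1) t`, which
  -- is nonnegative. Comparison with s = 0 settles the extreme case p = 1 - exp (-s); a smaller p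
  -- only lowers the left side.
  have key : MonotoneOn (fun s => Real.exp s * (poissonTail d (t + s) - poissonTail (d - 1) t))
      (Set.Ici 0) := by
    have hder : ∀ s, HasDerivAt
        (fun s => Real.exp s * (poissonTail d (t + s) - poissonTail (d - 1) t))
        (Real.exp s * (poissonTail d (t + s) - poissonTail (d - 1) t)
          + Real.exp s * (poissonTail (d - 1) (t + s) - poissonTail d (t + s))) s := fun s =>
      (Real.hasDerivAt_exp s).mul
        (((hasDerivAt_poissonTail d (t + s)).comp_const_add t s).sub_const _)
    refine monotoneOn_of_deriv_nonneg (convex_Ici 0)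
      (fun s _ => (hder s).continuousAt.continuousWithinAt)
      (fun s _ => (hder s).differentiableAt.differentiableWithinAt) fun s hs => ?_
    rw [(hder s).deriv]
    have hs0 : 0 ≤ s := by simpa using interior_subset hs
    have := poissonTail_mono (d - 1) ht (show t ≤ t + s by linarith)
    have h2 := Real.exp_pos s
    nlinarith
  have h := key (Set.mem_Ici.2 le_rfl) (Set.mem_Ici.2 hs) hs
  simp only [Real.exp_zero, add_zero, one_mul] at h
  have h1 : Real.exp (-s) * (poissonTail d t - poissonTail (d - 1) t)
      ≤ poissonTail d (t + s) - poissonTail (d - 1) t := by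
    have := mul_le_mul_of_nonneg_left h (Real.exp_pos (-s)).le
    rwa [← mul_assoc, ← Real.exp_add, neg_add_cancel, Real.exp_zero, one_mul] at this
  have h2 := poissonTail_pred_sub_nonneg d ht
  nlinarith

theorem sub_le_mul_of_hasDerivAt_le {f f' : ℝ → ℝ} {x y C : ℝ} (hf : ∀ t, HasDerivAt f (f' t) t)
    (hyx : y ≤ x) (hC : ∀ t ∈ Set.Icc y x, f' t ≤ C) : f x - f y ≤ C * (x - y) :=
  (convex_Icc y x).image_sub_le_mul_sub_of_deriv_le
    (fun t _ => (hf t).continuousAt.continuousWithinAt)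
    (fun t _ => (hf t).differentiableAt.differentiableWithinAt)
    (fun t ht => by rw [(hf t).deriv]; exact hC t (interior_subset ht))
    y (Set.left_mem_Icc.2 hyx) x (Set.right_mem_Icc.2 hyx) hyx

theorem poissonTail_sub_le (d : ℕ) {x y : ℝ} (hy : 0 ≤ y) (hyx : y ≤ x) :
    poissonTail d x - poissonTail d y ≤ (x - y) * poissonTail (d - 1) x := by
  rw [mul_comm]
  refine sub_le_mul_of_hasDerivAt_le (hasDerivAt_poissonTail d) hyx fun t ht => ?_
  have ht0 := hy.trans ht.1
  have := poissonTail_nonneg d ht0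
  have := poissonTail_mono (d - 1) ht0 ht.2
  linarith

/-- Second-order Taylor bound: the second derivative in the mean is at most the tail at `d - 2`,
largest at the right end point. The linear term is exactly the effect of a Bernoulli increment of
probability s, so the quadratic term bounds the excess of a Poisson increment over a Bernoulli one.
-/
theorem poissonTail_add_le (d : ℕ) {t s : ℝ} (ht : 0 ≤ t) (hs : 0 ≤ s) :
    poissonTail d (t + s) ≤ poissonTail d t + s * (poissonTail (d - 1) t - poissonTail d t)
      + s ^ 2 * poissonTail (d - 2) (t + s) := by
  have h0 := poissonTail_nonneg (d - 2) (add_nonneg ht hs)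
  have h1 : ∀ r ∈ Set.Icc t (t + s), poissonTail (d - 1) r - poissonTail d r
      ≤ poissonTail (d - 1) t - poissonTail d t + s * poissonTail (d - 2) (t + s) := by
    intro r hr
    have := sub_le_mul_of_hasDerivAt_le (f := fun r => poissonTail (d - 1) r - poissonTail d r)
      (C := poissonTail (d - 2) (t + s))
      (fun r => (hasDerivAt_poissonTail (d - 1) r).sub (hasDerivAt_poissonTail d r)) hr.1 ?_
    · have h2 : poissonTail (d - 2) (t + s) * (r - t) ≤ s * poissonTail (d - 2) (t + s) := by
        rw [mul_comm]
        exact mul_le_mul_of_nonneg_right (by linarith [hr.2]) h0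
      linarith
    · intro x hx
      have hx0 := ht.trans hx.1
      have e1 := poissonTail_mono (d - 2) hx0 (hx.2.trans hr.2)
      have e2 := poissonTail_nonneg (d - 1) hx0
      have e3 := poissonTail_pred_sub_nonneg d hx0
      rw [Nat.sub_sub]
      linarith
  have h2 := sub_le_mul_of_hasDerivAt_le (hasDerivAt_poissonTail d) (show t ≤ t + s by linarith) h1
  nlinarith

/-- Markov's inequality for z^X, obtained analytically: after multiplication by exp t, the
derivative of the gap between the two sides at level `d + 1` is the gap at level `d`. -/
theorem poissonTail_le_chernoff (d : ℕ) {t z : ℝ} (ht : 0 ≤ t) (hz : 1 ≤ z) :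
    poissonTail d t ≤ (z ^ d)⁻¹ * Real.exp ((z - 1) * t) := by
  have hz0 : 0 < z := by linarith
  induction d generalizing t with
  | zero =>
    rw [poissonTail_zero, pow_zero, inv_one, one_mul]
    exact Real.one_le_exp (mul_nonneg (by linarith) ht)
  | succ d ih =>
    have hder : ∀ t, HasDerivAt
        (fun t => (z ^ (d + 1))⁻¹ * Real.exp (z * t) - Real.exp t * poissonTail (d + 1) t)
        ((z ^ d)⁻¹ * Real.exp (z * t) - Real.exp t * poissonTail d t) t := by
      intro t
      have h1 : HasDerivAt (fun t => Real.exp (z * t)) (Real.exp (z * t) * z) t := by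
        simpa using ((hasDerivAt_id t).const_mul z).exp
      refine ((h1.const_mul _).sub
        ((Real.hasDerivAt_exp t).mul (hasDerivAt_poissonTail (d + 1) t))).congr_deriv ?_
      simp only [Nat.add_sub_cancel, pow_succ]
      field_simp
      ring
    have key : MonotoneOn
        (fun t => (z ^ (d + 1))⁻¹ * Real.exp (z * t) - Real.exp t * poissonTail (d + 1) t)
        (Set.Ici 0) := by
      refine monotoneOn_of_deriv_nonneg (convex_Ici 0)
        (fun s _ => (hder s).continuousAt.continuousWithinAt)
        (fun s _ => (hder s).differentiableAt.differentiableWithinAt) fun s hs => ?_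
      rw [(hder s).deriv, sub_nonneg]
      have hs0 : 0 ≤ s := by simpa using interior_subset hs
      calc Real.exp s * poissonTail d s
          ≤ Real.exp s * ((z ^ d)⁻¹ * Real.exp ((z - 1) * s)) :=
            mul_le_mul_of_nonneg_left (ih hs0) (Real.exp_pos s).le
        _ = (z ^ d)⁻¹ * Real.exp (z * s) := by
            rw [mul_left_comm, ← Real.exp_add]; ring_nf
    have h := key (Set.mem_Ici.2 le_rfl) (Set.mem_Ici.2 ht) ht
    simp only [poissonTail_at_zero, mul_zero, Real.exp_zero, mul_one, Nat.add_eq_zero_iff,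
      one_ne_zero, and_false, if_false, sub_zero] at h
    have h0 : 0 ≤ (z ^ (d + 1))⁻¹ := by positivity
    have h3 : Real.exp t * poissonTail (d + 1) t
        ≤ Real.exp t * ((z ^ (d + 1))⁻¹ * Real.exp ((z - 1) * t)) := by
      have : Real.exp t * ((z ^ (d + 1))⁻¹ * Real.exp ((z - 1) * t))
          = (z ^ (d + 1))⁻¹ * Real.exp (z * t) := by
        rw [mul_left_comm, ← Real.exp_add]; ring_nf
      linarith
    exact le_of_mul_le_mul_left h3 (Real.exp_pos t)

/-! ### Laplace transforms of Poisson tails -/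

theorem integrableOn_cexp_mul_poissonTail (d : ℕ) {w : ℝ} (hw : 0 ≤ w) {s : ℂ} (hs : 0 < s.re) :
    IntegrableOn (fun t : ℝ => Complex.exp (-s * t) * (poissonTail d (w * t) : ℂ)) (Set.Ioi 0) := by
  refine Integrable.mono' (exp_neg_integrableOn_Ioi 0 hs) ?_ ?_
  · have := continuous_poissonTail d
    exact Continuous.aestronglyMeasurable (by fun_prop)
  · refine (ae_restrict_iff' measurableSet_Ioi).2 (.of_forall fun t ht => ?_)
    have ht0 : (0 : ℝ) ≤ w * t := mul_nonneg hw (le_of_lt ht)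
    rw [norm_mul, Complex.norm_exp, Complex.norm_real, Real.norm_eq_abs,
      abs_of_nonneg (poissonTail_nonneg d ht0)]
    have : (-s * (t : ℂ)).re = -s.re * t := by simp
    rw [this]
    exact mul_le_of_le_one_right (Real.exp_pos _).le (poissonTail_le_one d ht0)

/-- The Laplace transform of the Poisson tail as a function of the time. -/
theorem integral_cexp_mul_poissonTail (d : ℕ) {w : ℝ} (hw : 0 ≤ w) {s : ℂ} (hs : 0 < s.re) :
    ∫ t in Set.Ioi (0 : ℝ), Complex.exp (-s * t) * (poissonTail d (w * t) : ℂ)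
      = s⁻¹ * (w / (w + s)) ^ d := by
  have hs0 : s ≠ 0 := fun h => by simp [h] at hs
  have hws : (w : ℂ) + s ≠ 0 := fun h => by
    have := congrArg Complex.re h
    simp at this; linarith
  induction d with
  | zero =>
    have := integral_exp_mul_complex_Ioi (a := -s) (by simpa using hs) 0
    simp only [poissonTail_zero, Complex.ofReal_one, mul_one, pow_zero]
    rw [this]; simp
  | succ d ih =>
    -- Integrating this derivative over (0, ∞) gives 0, since the function vanishes at 0 (positive
    -- level) and at infinity. So the transform at level `d + 1` is w/(w+s) times the one at level
    -- `d`.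
    have hder : ∀ t ∈ Set.Ioi (0 : ℝ), HasDerivAt
        (fun t : ℝ => Complex.exp (-s * t) * (poissonTail (d + 1) (w * t) : ℂ))
        (w * (Complex.exp (-s * t) * (poissonTail d (w * t) : ℂ))
          - (w + s) * (Complex.exp (-s * t) * (poissonTail (d + 1) (w * t) : ℂ))) t := by
      intro t _
      have h1 : HasDerivAt (fun t : ℝ => Complex.exp (-s * t)) (Complex.exp (-s * t) * -s) t := by
        have := ((Complex.ofRealCLM.hasDerivAt (x := t)).const_mul (-s)).cexp
        simpa using this
      have h2 : HasDerivAt (fun t : ℝ => (poissonTail (d + 1) (w * t) : ℂ))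
          (((poissonTail d (w * t) - poissonTail (d + 1) (w * t)) * w : ℝ) : ℂ) t := by
        have := (hasDerivAt_poissonTail (d + 1) (w * t)).comp t ((hasDerivAt_id t).const_mul w)
        simpa using this.ofReal_comp
      refine (h1.mul h2).congr_deriv ?_
      push_cast; ring
    have hlim : Tendsto (fun t : ℝ => Complex.exp (-s * t) * (poissonTail (d + 1) (w * t) : ℂ))
        atTop (𝓝 0) := by
      have h1 : Tendsto (fun t : ℝ => Real.exp (-(s.re * t))) atTop (𝓝 0) :=
        Real.tendsto_exp_neg_atTop_nhds_zero.comp (tendsto_id.const_mul_atTop hs)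
      refine squeeze_zero_norm' ?_ h1
      filter_upwards [eventually_ge_atTop 0] with t ht
      have ht0 : (0 : ℝ) ≤ w * t := mul_nonneg hw ht
      rw [norm_mul, Complex.norm_exp, Complex.norm_real, Real.norm_eq_abs,
        abs_of_nonneg (poissonTail_nonneg _ ht0)]
      have : (-s * (t : ℂ)).re = -(s.re * t) := by simp
      rw [this]
      exact mul_le_of_le_one_right (Real.exp_pos _).le (poissonTail_le_one _ ht0)
    have i1 := integrableOn_cexp_mul_poissonTail d hw hs
    have i2 := integrableOn_cexp_mul_poissonTail (d + 1) hw hs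
    have h0 : ContinuousWithinAt
        (fun t : ℝ => Complex.exp (-s * t) * (poissonTail (d + 1) (w * t) : ℂ)) (Set.Ici 0) 0 := by
      have := continuous_poissonTail (d + 1)
      exact Continuous.continuousWithinAt (by fun_prop)
    have h := integral_Ioi_of_hasDerivAt_of_tendsto h0 hder
      ((i1.const_mul _).sub (i2.const_mul _)) hlim
    rw [integral_sub (i1.const_mul _) (i2.const_mul _), integral_const_mul, integral_const_mul,
      ih] at h
    simp only [Complex.ofReal_zero, mul_zero, poissonTail_at_zero, Nat.add_eq_zero_iff,
      one_ne_zero, and_false, if_false, sub_zero] at h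
    rw [sub_eq_zero] at h
    rw [pow_succ]
    field_simp at h ⊢
    rw [← h]

theorem integrableOn_exp_mul_poissonTail (d : ℕ) {w : ℝ} (hw : 0 ≤ w) :
    IntegrableOn (fun t : ℝ => Real.exp (-t) * poissonTail d (w * t)) (Set.Ioi 0) := by
  have := (integrableOn_cexp_mul_poissonTail d hw (s := 1) (by simp)).re
  refine this.congr (.of_forall fun t => ?_)
  simp [← Complex.ofReal_neg, ← Complex.ofReal_exp, ← Complex.ofReal_mul]

theorem integral_exp_mul_poissonTail (d : ℕ) {w : ℝ} (hw : 0 ≤ w) :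
    ∫ t in Set.Ioi (0 : ℝ), Real.exp (-t) * poissonTail d (w * t) = (w / (w + 1)) ^ d := by
  have := integral_cexp_mul_poissonTail d hw (s := 1) (by simp)
  apply Complex.ofReal_injective
  rw [← integral_complex_ofReal]
  simpa using this

/-! ### Expansions of finite products -/

/-- The left side consists of the terms of the expanded product with at most one factor `c`; all
others are nonnegative. This is the source of negative dependence: a round can increment one counter
only, while independent increments would also allow several at once. -/
theorem prod_add_sum_mul_prod_erase_le {ι : Type*} [DecidableEq ι] (s : Finset ι) {a c : ι → ℝ}
    (ha : ∀ i, 0 ≤ a i) (hc : ∀ i, 0 ≤ c i) :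
    ∏ i ∈ s, a i + ∑ i ∈ s, c i * ∏ r ∈ s.erase i, a r ≤ ∏ i ∈ s, (a i + c i) := by
  induction s using Finset.induction_on with
  | empty => simp
  | insert x s hx ih =>
    rw [Finset.prod_insert hx, Finset.sum_insert hx, Finset.prod_insert hx,
      Finset.erase_insert hx]
    have h1 : ∑ i ∈ s, c i * ∏ r ∈ (insert x s).erase i, a r
        = a x * ∑ i ∈ s, c i * ∏ r ∈ s.erase i, a r := by
      rw [Finset.mul_sum]
      refine Finset.sum_congr rfl fun i hi => ?_
      rw [Finset.erase_insert_of_ne (by rintro rfl; exact hx hi),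
        Finset.prod_insert (fun h => hx (Finset.mem_of_mem_erase h))]
      ring
    rw [h1]
    have h2 : ∏ i ∈ s, a i ≤ ∏ i ∈ s, (a i + c i) :=
      Finset.prod_le_prod (fun i _ => ha i) fun i _ => by linarith [hc i]
    have h3 := mul_le_mul_of_nonneg_left ih (ha x)
    have h4 := mul_le_mul_of_nonneg_left h2 (hc x)
    linarith

/-- Here `a` is a value, `c` its change of first order in `p` and `e` a remainder of second order.
All products of total order at least two are collected in the error, with `3 ^ s.card` counting the
terms of the expansion, each at most `∏ B`. The first-order estimate is carried along because the
induction for the second one multiplies it by `c x`. -/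
theorem prod_add_add_le {ι : Type*} [DecidableEq ι] (s : Finset ι) {a c e B p : ι → ℝ} {K : ℝ}
    (hK : 3 ^ s.card ≤ K)
    (hp : ∀ i, 0 ≤ p i) (hp1 : ∀ i, p i ≤ 1) (ha : ∀ i, 0 ≤ a i) (haB : ∀ i, a i ≤ B i)
    (hc : ∀ i, 0 ≤ c i) (hcB : ∀ i, c i ≤ p i * B i) (he : ∀ i, 0 ≤ e i)
    (heB : ∀ i, e i ≤ p i ^ 2 * B i) :
    ∏ i ∈ s, (a i + c i + e i) ≤ ∏ i ∈ s, a i + 2 * K * (∑ i ∈ s, p i) * ∏ i ∈ s, B i ∧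
    ∏ i ∈ s, (a i + c i + e i) ≤ ∏ i ∈ s, a i + ∑ i ∈ s, c i * ∏ r ∈ s.erase i, a r
      + K * (∑ i ∈ s, p i) ^ 2 * ∏ i ∈ s, B i := by
  have hB : ∀ i, 0 ≤ B i := fun i => (ha i).trans (haB i)
  have hpp : ∀ i, p i ^ 2 * B i ≤ p i * B i := fun i =>
    mul_le_mul_of_nonneg_right (by nlinarith [hp i, hp1 i]) (hB i)
  induction s using Finset.induction_on with
  | empty =>
    simp
  | insert x s hx ih =>
    rw [Finset.card_insert_of_notMem hx, pow_succ] at hK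
    have h3 : (1 : ℝ) ≤ 3 ^ s.card := one_le_pow₀ (by norm_num)
    obtain ⟨ih1, ih2⟩ := ih (by linarith)
    have hRB : ∏ i ∈ s, (a i + c i + e i) ≤ K * ∏ i ∈ s, B i := by
      calc ∏ i ∈ s, (a i + c i + e i) ≤ ∏ i ∈ s, 3 * B i := by
            refine Finset.prod_le_prod (fun i _ => by linarith [ha i, hc i, he i]) fun i _ => ?_
            have : p i * B i ≤ B i := mul_le_of_le_one_left (hB i) (hp1 i)
            linarith [haB i, hcB i, heB i, hpp i]
        _ = 3 ^ s.card * ∏ i ∈ s, B i := by rw [Finset.prod_mul_distrib, Finset.prod_const]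
        _ ≤ K * ∏ i ∈ s, B i :=
            mul_le_mul_of_nonneg_right (by linarith) (Finset.prod_nonneg fun i _ => hB i)
    have hPB : 0 ≤ ∏ i ∈ s, B i := Finset.prod_nonneg fun i _ => hB i
    have hPa : 0 ≤ ∏ i ∈ s, a i := Finset.prod_nonneg fun i _ => ha i
    have hR0 : 0 ≤ ∏ i ∈ s, (a i + c i + e i) :=
      Finset.prod_nonneg fun i _ => by linarith [ha i, hc i, he i]
    have hS : 0 ≤ ∑ i ∈ s, p i := Finset.sum_nonneg fun i _ => hp i
    have hK0 : 0 ≤ K := by linarith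
    rw [Finset.prod_insert hx, Finset.sum_insert hx, Finset.prod_insert hx,
      Finset.prod_insert hx, Finset.sum_insert hx, Finset.erase_insert hx]
    have h1 : ∑ i ∈ s, c i * ∏ r ∈ (insert x s).erase i, a r
        = a x * ∑ i ∈ s, c i * ∏ r ∈ s.erase i, a r := by
      rw [Finset.mul_sum]
      refine Finset.sum_congr rfl fun i hi => ?_
      rw [Finset.erase_insert_of_ne (by rintro rfl; exact hx hi),
        Finset.prod_insert (fun h => hx (Finset.mem_of_mem_erase h))]
      ring
    rw [h1]
    set R := ∏ i ∈ s, (a i + c i + e i)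
    set A := ∏ i ∈ s, a i
    set Q := ∏ i ∈ s, B i
    set S := ∑ i ∈ s, p i
    set T := ∑ i ∈ s, c i * ∏ r ∈ s.erase i, a r
    have ea1 : a x * R ≤ a x * A + B x * (2 * K * S * Q) := by
      have := mul_le_mul_of_nonneg_left ih1 (ha x)
      have h5 : a x * (2 * K * S * Q) ≤ B x * (2 * K * S * Q) :=
        mul_le_mul_of_nonneg_right (haB x) (by positivity)
      linarith
    have ea2 : a x * R ≤ a x * A + a x * T + B x * (K * S ^ 2 * Q) := by
      have := mul_le_mul_of_nonneg_left ih2 (ha x)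
      have h5 : a x * (K * S ^ 2 * Q) ≤ B x * (K * S ^ 2 * Q) :=
        mul_le_mul_of_nonneg_right (haB x) (by positivity)
      linarith
    have ec1 : c x * R ≤ p x * B x * (K * Q) :=
      mul_le_mul (hcB x) hRB hR0 (mul_nonneg (hp x) (hB x))
    have ec2 : c x * R ≤ c x * A + p x * B x * (2 * K * S * Q) := by
      have := mul_le_mul_of_nonneg_left ih1 (hc x)
      have h5 : c x * (2 * K * S * Q) ≤ p x * B x * (2 * K * S * Q) :=
        mul_le_mul_of_nonneg_right (hcB x) (by positivity)
      linarith
    have ee1 : e x * R ≤ p x * B x * (K * Q) :=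
      mul_le_mul ((heB x).trans (hpp x)) hRB hR0 (mul_nonneg (hp x) (hB x))
    have ee2 : e x * R ≤ p x ^ 2 * B x * (K * Q) :=
      mul_le_mul (heB x) hRB hR0 (mul_nonneg (sq_nonneg _) (hB x))
    constructor
    · calc (a x + c x + e x) * R = a x * R + c x * R + e x * R := by ring
        _ ≤ _ := add_le_add (add_le_add ea1 ec1) ee1
        _ = _ := by ring
    · calc (a x + c x + e x) * R = a x * R + c x * R + e x * R := by ring
        _ ≤ _ := add_le_add (add_le_add ea2 ec2) ee2
        _ = _ := by ring

/-! ### Counters incremented in independent rounds -/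

/-- The probability that, in `n` independent rounds in each of which at most one of the counters
`i : ι` is incremented, counter `i` being incremented in round `j` with probability `p j i`,
every counter `i` reaches at least `d i`. -/
noncomputable def jointTail {ι : Type*} [Fintype ι] [DecidableEq ι] (p : ℕ → ι → ℝ) :
    ℕ → (ι → ℕ) → ℝ
  | 0, d => if d = 0 then 1 else 0
  | n + 1, d => (1 - ∑ i, p n i) * jointTail p n d
      + ∑ i, p n i * jointTail p n (Function.update d i (d i - 1))

section jointTail

variable {ι : Type*} [Fintype ι] [DecidableEq ι]

theorem prod_update_eq (f : ι → ℕ → ℝ) (d : ι → ℕ) (i : ι) (x : ℕ) :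
    ∏ r, f r (Function.update d i x r) = f i x * ∏ r ∈ Finset.univ.erase i, f r (d r) := by
  rw [← Finset.mul_prod_erase _ _ (Finset.mem_univ i)]
  congr 1
  · simp
  · exact Finset.prod_congr rfl fun r hr => by
      rw [Function.update_of_ne (Finset.ne_of_mem_erase hr)]

/-- One round acting on a product function equals the product plus the first-order changes in single
factors, which is the shape the two product expansions apply to. -/
theorem one_sub_sum_mul_prod_add (f : ι → ℕ → ℝ) (d : ι → ℕ) (p : ι → ℝ) :
    (1 - ∑ i, p i) * ∏ i, f i (d i)
      + ∑ i, p i * ∏ r, f r (Function.update d i (d i - 1) r)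
    = ∏ i, f i (d i) + ∑ i, p i * (f i (d i - 1) - f i (d i))
        * ∏ r ∈ Finset.univ.erase i, f r (d r) := by
  rw [sub_mul, one_mul, Finset.sum_mul, sub_add, ← Finset.sum_sub_distrib, sub_eq_add_neg,
    ← Finset.sum_neg_distrib]
  congr 1
  refine Finset.sum_congr rfl fun i _ => ?_
  rw [prod_update_eq f d i, ← Finset.mul_prod_erase _ (fun i => f i (d i)) (Finset.mem_univ i)]
  ring

/-- Replacing the exclusive increments of one round by independent Bernoulli increments can only
enlarge the expectation of a product of functions that decrease in the threshold. -/
theorem one_sub_sum_mul_prod_add_le (f : ι → ℕ → ℝ) (hf0 : ∀ i d, 0 ≤ f i d)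
    (hf : ∀ i d, f i d ≤ f i (d - 1)) (d : ι → ℕ) {p : ι → ℝ} (hp : ∀ i, 0 ≤ p i) :
    (1 - ∑ i, p i) * ∏ i, f i (d i)
      + ∑ i, p i * ∏ r, f r (Function.update d i (d i - 1) r)
    ≤ ∏ i, ((1 - p i) * f i (d i) + p i * f i (d i - 1)) := by
  rw [one_sub_sum_mul_prod_add]
  refine (prod_add_sum_mul_prod_erase_le Finset.univ (fun i => hf0 i (d i)) (fun i =>
    mul_nonneg (hp i) (sub_nonneg.2 (hf i (d i))))).trans (le_of_eq ?_)
  exact Finset.prod_congr rfl fun i _ => by ring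

theorem jointTail_nonneg {p : ℕ → ι → ℝ} (hp : ∀ j i, 0 ≤ p j i) (hp1 : ∀ j, ∑ i, p j i ≤ 1)
    (n : ℕ) (d : ι → ℕ) : 0 ≤ jointTail p n d := by
  induction n generalizing d with
  | zero => rw [jointTail]; split_ifs <;> norm_num
  | succ n ih =>
    rw [jointTail]
    exact add_nonneg (mul_nonneg (sub_nonneg.2 (hp1 n)) (ih d))
      (Finset.sum_nonneg fun i _ => mul_nonneg (hp n i) (ih _))

theorem jointTail_le_one {p : ℕ → ι → ℝ} (hp : ∀ j i, 0 ≤ p j i) (hp1 : ∀ j, ∑ i, p j i ≤ 1)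
    (n : ℕ) (d : ι → ℕ) : jointTail p n d ≤ 1 := by
  induction n generalizing d with
  | zero => rw [jointTail]; split_ifs <;> norm_num
  | succ n ih =>
    rw [jointTail]
    calc _ ≤ (1 - ∑ i, p n i) * 1 + ∑ i, p n i * 1 :=
          add_le_add (mul_le_mul_of_nonneg_left (ih d) (sub_nonneg.2 (hp1 n)))
            (Finset.sum_le_sum fun i _ => mul_le_mul_of_nonneg_left (ih _) (hp n i))
      _ = 1 := by simp

/-- Negative dependence: the joint tail is at most the product of marginal supersolutions. -/
theorem jointTail_le_prod {p : ℕ → ι → ℝ} (hp : ∀ j i, 0 ≤ p j i) (hp1 : ∀ j, ∑ i, p j i ≤ 1)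
    {u : ι → ℕ → ℕ → ℝ} (hu0 : ∀ i n d, 0 ≤ u i n d) (hu : ∀ i n d, u i n d ≤ u i n (d - 1))
    (hinit : ∀ i, 1 ≤ u i 0 0) (n : ℕ)
    (hstep : ∀ j < n, ∀ i d, (1 - p j i) * u i j d + p j i * u i j (d - 1) ≤ u i (j + 1) d)
    (d : ι → ℕ) : jointTail p n d ≤ ∏ i, u i n (d i) := by
  induction n generalizing d with
  | zero =>
    rw [jointTail]
    split_ifs with h
    · subst h
      simpa using Finset.prod_le_prod (s := Finset.univ) (f := fun _ : ι => (1 : ℝ))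
        (fun _ _ => zero_le_one) fun i _ => hinit i
    · exact Finset.prod_nonneg fun i _ => hu0 i 0 _
  | succ n ih =>
    rw [jointTail]
    replace ih := ih fun j hj => hstep j (hj.trans n.lt_succ_self)
    have hpi : ∀ i, p n i ≤ 1 := fun i =>
      (Finset.single_le_sum (fun i _ => hp n i) (Finset.mem_univ i)).trans (hp1 n)
    calc _ ≤ (1 - ∑ i, p n i) * ∏ i, u i n (d i)
          + ∑ i, p n i * ∏ r, u r n (Function.update d i (d i - 1) r) :=
          add_le_add (mul_le_mul_of_nonneg_left (ih d) (sub_nonneg.2 (hp1 n)))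
            (Finset.sum_le_sum fun i _ => mul_le_mul_of_nonneg_left (ih _) (hp n i))
      _ ≤ ∏ i, ((1 - p n i) * u i n (d i) + p n i * u i n (d i - 1)) :=
          one_sub_sum_mul_prod_add_le (fun i d => u i n d) (fun i d => hu0 i n d)
            (fun i d => hu i n d) d (hp n)
      _ ≤ ∏ i, u i (n + 1) (d i) := by
          refine Finset.prod_le_prod (fun i _ => ?_) fun i _ => hstep n n.lt_succ_self i (d i)
          exact add_nonneg (mul_nonneg (sub_nonneg.2 (hpi i)) (hu0 i n _))
            (mul_nonneg (hp n i) (hu0 i n _))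

/-- Poisson lower bound for the joint tail. -/
theorem prod_poissonTail_sub_le_jointTail {p lam : ℕ → ι → ℝ} (hp : ∀ j i, 0 ≤ p j i)
    (hp1 : ∀ j, ∑ i, p j i ≤ 1) (n : ℕ) (hlam : ∀ j < n, ∀ i, p j i ≤ 1 - Real.exp (-lam j i))
    (d : ι → ℕ) :
    ∏ i, poissonTail (d i) (∑ j ∈ Finset.range n, p j i)
      - 3 ^ Fintype.card ι * (∑ j ∈ Finset.range n, (∑ i, p j i) ^ 2)
        * ∏ i, poissonTail (d i - 2) (∑ j ∈ Finset.range n, lam j i) ≤ jointTail p n d := by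
  induction n generalizing d with
  | zero =>
    rw [jointTail]
    simp only [Finset.range_zero, Finset.sum_empty, poissonTail_at_zero, mul_zero, zero_mul,
      sub_zero]
    split_ifs with h
    · exact Finset.prod_le_one (fun i _ => by split_ifs <;> norm_num)
        fun i _ => by split_ifs <;> norm_num
    · obtain ⟨i, hi⟩ := Function.ne_iff.1 h
      exact le_of_eq (Finset.prod_eq_zero (Finset.mem_univ i) (if_neg hi))
  | succ n ih =>
    rw [jointTail]
    have hplam : ∀ j < n + 1, ∀ i, p j i ≤ lam j i := fun j hj i => by
      have := Real.add_one_le_exp (-lam j i)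
      linarith [hlam j hj i]
    have hl0 : ∀ j < n + 1, ∀ i, 0 ≤ lam j i := fun j hj i => (hp j i).trans (hplam j hj i)
    replace ih := ih fun j hj => hlam j (hj.trans n.lt_succ_self)
    have hmem : ∀ {j}, j ∈ Finset.range n → j < n + 1 := fun hj =>
      (Finset.mem_range.1 hj).trans n.lt_succ_self
    -- Two means are needed. The main term uses the sum of the `p`, for which Bernoulli increments
    -- lose only at second order. The error term uses the larger sum of the `lam`, for which the
    -- Poisson tail is a supersolution of the recursion.
    set Λ : ι → ℝ := fun i => ∑ j ∈ Finset.range n, p j i with hΛ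
    set M : ι → ℝ := fun i => ∑ j ∈ Finset.range n, lam j i with hM
    set E : ℝ := ∑ j ∈ Finset.range n, (∑ i, p j i) ^ 2 with hE
    set K : ℝ := 3 ^ Fintype.card ι with hK
    have hΛ0 : ∀ i, 0 ≤ Λ i := fun i => Finset.sum_nonneg fun j _ => hp j i
    have hM0 : ∀ i, 0 ≤ M i := fun i => Finset.sum_nonneg fun j hj => hl0 j (hmem hj) i
    have hΛM : ∀ i, Λ i ≤ M i := fun i => Finset.sum_le_sum fun j hj => hplam j (hmem hj) i
    have hE0 : 0 ≤ E := Finset.sum_nonneg fun j _ => sq_nonneg _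
    have hK0 : 0 ≤ K := by positivity
    have hpi : ∀ i, p n i ≤ 1 := fun i =>
      (Finset.single_le_sum (fun i _ => hp n i) (Finset.mem_univ i)).trans (hp1 n)
    simp only [Finset.sum_range_succ]
    change ∏ i, poissonTail (d i) (Λ i + p n i) - K * (E + (∑ i, p n i) ^ 2)
      * ∏ i, poissonTail (d i - 2) (M i + lam n i) ≤ _
    clear_value E
    have hih : ∀ d : ι → ℕ, ∏ i, poissonTail (d i) (Λ i)
        - K * E * ∏ i, poissonTail (d i - 2) (M i) ≤ jointTail p n d := ih
    -- Truncated subtractions commute, so lowering a threshold and shifting it by two may be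
    -- exchanged.
    have hcomm : ∀ i, ∏ r, poissonTail (Function.update d i (d i - 1) r - 2) (M r)
        = ∏ r, poissonTail
          (Function.update (fun r => d r - 2) i ((fun r => d r - 2) i - 1) r) (M r) := fun i =>
      Finset.prod_congr rfl fun r _ => by
        rcases eq_or_ne r i with rfl | h
        · simp [Nat.sub_right_comm]
        · simp [Function.update_of_ne h]
    -- Taylor expansion in every factor: the new product exceeds one round applied to the old one by
    -- a term of second order in the probabilities of round `n`.
    have main : ∏ i, poissonTail (d i) (Λ i + p n i)
        ≤ (1 - ∑ i, p n i) * ∏ i, poissonTail (d i) (Λ i)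
          + ∑ i, p n i * ∏ r, poissonTail (Function.update d i (d i - 1) r) (Λ r)
          + K * (∑ i, p n i) ^ 2 * ∏ i, poissonTail (d i - 2) (M i + lam n i) := by
      rw [one_sub_sum_mul_prod_add (fun i d => poissonTail d (Λ i)) d (p n)]
      have hB : ∀ i (x : ℝ) (e : ℕ), 0 ≤ x → d i - 2 ≤ e → x ≤ M i + lam n i →
          poissonTail e x ≤ poissonTail (d i - 2) (M i + lam n i) := fun i x e hx he hxM =>
        (poissonTail_antitone hx he).trans (poissonTail_mono _ hx hxM)
      refine le_trans ?_ (prod_add_add_le Finset.univ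
        (e := fun i => p n i ^ 2 * poissonTail (d i - 2) (Λ i + p n i)) (p := p n)
        (B := fun i => poissonTail (d i - 2) (M i + lam n i)) (K := K)
        (by rw [hK, Finset.card_univ]) (hp n) hpi
        (fun i => poissonTail_nonneg (d i) (hΛ0 i)) (fun i => hB i _ _ (hΛ0 i) (by omega)
          (by linarith [hΛM i, hl0 n n.lt_succ_self i]))
        (fun i => mul_nonneg (hp n i) (poissonTail_pred_sub_nonneg _ (hΛ0 i)))
        (fun i => mul_le_mul_of_nonneg_left ?_ (hp n i))
        (fun i => mul_nonneg (sq_nonneg _)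
          (poissonTail_nonneg _ (add_nonneg (hΛ0 i) (hp n i))))
        (fun i => mul_le_mul_of_nonneg_left ?_ (sq_nonneg _))).2
      · refine Finset.prod_le_prod
          (fun i _ => poissonTail_nonneg _ (add_nonneg (hΛ0 i) (hp n i))) fun i _ =>
          poissonTail_add_le (d i) (hΛ0 i) (hp n i)
      · have := hB i (Λ i) (d i - 1) (hΛ0 i) (by omega) (by linarith [hΛM i, hl0 n n.lt_succ_self i])
        linarith [poissonTail_nonneg (d i) (hΛ0 i)]
      · exact hB i _ _ (add_nonneg (hΛ0 i) (hp n i)) le_rfl (by linarith [hΛM i, hplam n n.lt_succ_self i])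
    -- By the thinning inequality the product in the error term absorbs a round, so errors from
    -- earlier rounds are carried along without growing.
    have err : (1 - ∑ i, p n i) * ∏ i, poissonTail (d i - 2) (M i)
        + ∑ i, p n i * ∏ r, poissonTail (Function.update d i (d i - 1) r - 2) (M r)
        ≤ ∏ i, poissonTail (d i - 2) (M i + lam n i) := by
      simp only [hcomm]
      refine (one_sub_sum_mul_prod_add_le (fun i d => poissonTail d (M i))
        (fun i d => poissonTail_nonneg d (hM0 i))
        (fun i d => poissonTail_antitone (hM0 i) (Nat.sub_le d 1)) (fun r => d r - 2)
        (hp n)).trans ?_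
      refine Finset.prod_le_prod (fun i _ => ?_) fun i _ =>
        poissonTail_bernoulli_le (d i - 2) (hM0 i) (hl0 n n.lt_succ_self i) (hlam n n.lt_succ_self i)
      exact add_nonneg (mul_nonneg (sub_nonneg.2 (hpi i)) (poissonTail_nonneg _ (hM0 i)))
        (mul_nonneg (hp n i) (poissonTail_nonneg _ (hM0 i)))
    have rec1 : (1 - ∑ i, p n i) * (∏ i, poissonTail (d i) (Λ i)
          - K * E * ∏ i, poissonTail (d i - 2) (M i))
        + ∑ i, p n i * (∏ r, poissonTail (Function.update d i (d i - 1) r) (Λ r)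
          - K * E * ∏ r, poissonTail (Function.update d i (d i - 1) r - 2) (M r))
        ≤ (1 - ∑ i, p n i) * jointTail p n d
          + ∑ i, p n i * jointTail p n (Function.update d i (d i - 1)) :=
      add_le_add (mul_le_mul_of_nonneg_left (hih d) (sub_nonneg.2 (hp1 n)))
        (Finset.sum_le_sum fun i _ => mul_le_mul_of_nonneg_left (hih _) (hp n i))
    refine le_trans ?_ rec1
    have err2 := mul_le_mul_of_nonneg_left err (mul_nonneg hK0 hE0)
    have e3 : ∑ i, p n i * (∏ r, poissonTail (Function.update d i (d i - 1) r) (Λ r)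
          - K * E * ∏ r, poissonTail (Function.update d i (d i - 1) r - 2) (M r))
        = ∑ i, p n i * ∏ r, poissonTail (Function.update d i (d i - 1) r) (Λ r)
          - K * E * ∑ i, p n i * ∏ r, poissonTail (Function.update d i (d i - 1) r - 2) (M r) := by
      rw [Finset.mul_sum, ← Finset.sum_sub_distrib]
      exact Finset.sum_congr rfl fun i _ => by ring
    rw [e3]
    linarith

end jointTail

/-! ### In-degrees given the weights -/

/-- The probability that the vertex introduced when the tree has `j` vertices connects to the
vertex `ℓ i`, given the weight sequence `w`. -/
noncomputable def attachProb {ι : Type*} (w : ℕ → ℝ) (ℓ : ι → ℕ) (j : ℕ) (i : ι) : ℝ :=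
  if ℓ i ≤ j then w (ℓ i) / ∑ l ∈ Finset.Icc 1 j, w l else 0

theorem attachProb_nonneg {ι : Type*} {w : ℕ → ℝ} (hw : ∀ i, 1 ≤ i → 0 < w i) {ℓ : ι → ℕ}
    (hℓ : ∀ i, 1 ≤ ℓ i) (j : ℕ) (i : ι) : 0 ≤ attachProb w ℓ j i := by
  unfold attachProb
  split_ifs
  · exact div_nonneg (hw _ (hℓ i)).le
      (Finset.sum_nonneg fun l hl => (hw l (Finset.mem_Icc.1 hl).1).le)
  · exact le_rfl

theorem sum_attachProb_le_one {ι : Type*} [Fintype ι] {w : ℕ → ℝ} (hw : ∀ i, 1 ≤ i → 0 < w i)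
    {ℓ : ι → ℕ} (hℓ : ∀ i, 1 ≤ ℓ i) (hinj : Function.Injective ℓ) (j : ℕ) :
    ∑ i, attachProb w ℓ j i ≤ 1 := by
  classical
  have hS : 0 ≤ ∑ l ∈ Finset.Icc 1 j, w l :=
    Finset.sum_nonneg fun l hl => (hw l (Finset.mem_Icc.1 hl).1).le
  simp only [attachProb]
  rw [← Finset.sum_filter, ← Finset.sum_div]
  refine div_le_one_of_le₀ ?_ hS
  rw [← Finset.sum_image (f := w) (s := Finset.univ.filter fun i => ℓ i ≤ j) (g := ℓ)
    (fun a _ b _ h => hinj h)]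
  refine Finset.sum_le_sum_of_subset_of_nonneg ?_ fun l hl _ =>
    (hw l (Finset.mem_Icc.1 hl).1).le
  intro l hl
  obtain ⟨i, hi, rfl⟩ := Finset.mem_image.1 hl
  exact Finset.mem_Icc.2 ⟨hℓ i, (Finset.mem_filter.1 hi).2⟩

theorem inDegree_succ {Ω : Type*} (par : ℕ → Ω → ℕ) {n : ℕ} (hn : 1 ≤ n) (x : ℕ) (ω : Ω) :
    inDegree par (n + 1) x ω = inDegree par n x ω + if par (n + 1) ω = x then 1 else 0 := by
  unfold inDegree
  rw [← Finset.insert_Icc_right_eq_Icc_add_one (by omega : 2 ≤ n + 1), Finset.filter_insert]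
  split_ifs with h
  · rw [Finset.card_insert_of_notMem (by simp)]
  · simp

/-- The event that each of the vertices `ℓ i` has in-degree at least `d i`. -/
def degreeEvent {Ω ι : Type*} (par : ℕ → Ω → ℕ) (n : ℕ) (ℓ : ι → ℕ) (d : ι → ℕ) : Set Ω :=
  {ω | ∀ i, d i ≤ inDegree par n (ℓ i) ω}

/-- The σ-algebra generated by the vertex-weights. -/
@[reducible] def weightSigma {Ω : Type*} (W : ℕ → Ω → ℝ) : MeasurableSpace Ω :=
  ⨆ i ∈ Set.Ici 1, MeasurableSpace.comap (W i) inferInstance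

section

variable {Ω : Type*}

theorem measurable_weightSigma (W : ℕ → Ω → ℝ) {i : ℕ} (hi : 1 ≤ i) :
    Measurable[weightSigma W] (W i) := by
  rw [measurable_iff_comap_le]
  exact le_iSup₂_of_le (f := fun i (_ : i ∈ Set.Ici 1) =>
    MeasurableSpace.comap (W i) inferInstance) i hi le_rfl

theorem weightSigma_le_wrtHistory (W : ℕ → Ω → ℝ) (par : ℕ → Ω → ℕ) (n : ℕ) :
    weightSigma W ≤ wrtHistory W par n := le_sup_left

theorem measurable_par_wrtHistory (W : ℕ → Ω → ℝ) (par : ℕ → Ω → ℕ) {n j : ℕ}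
    (hj : j ∈ Set.Icc 2 n) : Measurable[wrtHistory W par n] (par j) := by
  rw [measurable_iff_comap_le]
  exact (le_iSup₂_of_le (f := fun j (_ : j ∈ Set.Icc 2 n) =>
    MeasurableSpace.comap (par j) inferInstance) j hj le_rfl).trans le_sup_right

theorem measurableSet_degreeEvent {m : MeasurableSpace Ω} {ι : Type*} [Finite ι]
    {par : ℕ → Ω → ℕ} {n : ℕ} (hpar : ∀ j ∈ Set.Icc 2 n, Measurable (par j)) (ℓ d : ι → ℕ) :
    MeasurableSet (degreeEvent par n ℓ d) := by
  have h : ∀ x, Measurable (inDegree par n x) := by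
    intro x
    have : inDegree par n x = fun ω => ∑ j ∈ Finset.Icc 2 n, if par j ω = x then 1 else 0 := by
      funext ω; simp [inDegree]
    rw [this]
    refine Finset.measurable_fun_sum _ fun j hj => ?_
    have h2 := hpar j (by simpa using hj)
    exact Measurable.ite (h2 (measurableSet_singleton x)) measurable_const measurable_const
  have : degreeEvent par n ℓ d = ⋂ i, {ω | d i ≤ inDegree par n (ℓ i) ω} := by
    ext ω; simp [degreeEvent]
  rw [this]
  exact MeasurableSet.iInter fun i => measurableSet_le measurable_const (h _)

/-- The new vertex has one parent and the labels are distinct, so at most one summand is nonzero.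
Conditioning on the history replaces the parent indicators by `attachProb` and turns this identity
into the recursion of `jointTail`. -/
theorem indicator_degreeEvent_succ {ι : Type*} [Fintype ι] [DecidableEq ι] (par : ℕ → Ω → ℕ)
    {n : ℕ} (hn : 1 ≤ n) {ℓ : ι → ℕ} (hinj : Function.Injective ℓ) (d : ι → ℕ) (ω : Ω) :
    (degreeEvent par (n + 1) ℓ d).indicator (fun _ => (1 : ℝ)) ω
      = (degreeEvent par n ℓ d).indicator (fun _ => (1 : ℝ)) ω
        + ∑ i, ((degreeEvent par n ℓ (Function.update d i (d i - 1))).indicator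
            (fun _ => (1 : ℝ)) ω - (degreeEvent par n ℓ d).indicator (fun _ => (1 : ℝ)) ω)
          * {ω | par (n + 1) ω = ℓ i}.indicator (fun _ => (1 : ℝ)) ω := by
  classical
  by_cases h : ∃ i, par (n + 1) ω = ℓ i
  · obtain ⟨i, hi⟩ := h
    rw [Finset.sum_eq_single i]
    · have h1 : ω ∈ {ω | par (n + 1) ω = ℓ i} := hi
      rw [Set.indicator_of_mem h1, mul_one, add_sub_cancel]
      have : ω ∈ degreeEvent par (n + 1) ℓ d
          ↔ ω ∈ degreeEvent par n ℓ (Function.update d i (d i - 1)) := by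
        simp only [degreeEvent, Set.mem_ofPred_eq, inDegree_succ par hn]
        refine forall_congr' fun r => ?_
        rcases eq_or_ne r i with rfl | hr
        · simp [hi]
        · rw [Function.update_of_ne hr, hi, if_neg (fun h => hr (hinj h).symm), add_zero]
      simp only [Set.indicator_apply, this]
    · intro r _ hr
      have h2 : ω ∉ {ω | par (n + 1) ω = ℓ r} := fun h2 => hr (hinj (hi ▸ h2 : ℓ i = ℓ r)).symm
      rw [Set.indicator_of_notMem h2, mul_zero]
    · intro h2; exact absurd (Finset.mem_univ i) h2
  · have h := not_exists.1 h
    rw [Finset.sum_eq_zero, add_zero]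
    · have : ω ∈ degreeEvent par (n + 1) ℓ d ↔ ω ∈ degreeEvent par n ℓ d := by
        simp only [degreeEvent, Set.mem_ofPred_eq, inDegree_succ par hn, if_neg (h _), add_zero]
      simp only [Set.indicator_apply, this]
    · intro i _
      have h2 : ω ∉ {ω | par (n + 1) ω = ℓ i} := h i
      rw [Set.indicator_of_notMem h2, mul_zero]

theorem measurable_attachProb (W : ℕ → Ω → ℝ) {ι : Type*} {ℓ : ι → ℕ}
    (hℓ : ∀ i, 1 ≤ ℓ i) (n : ℕ) (i : ι) :
    Measurable[weightSigma W] fun ω => attachProb (fun l => W l ω) ℓ n i := by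
  unfold attachProb
  split_ifs
  · exact (measurable_weightSigma W (hℓ i)).div (Finset.measurable_fun_sum _ fun l hl =>
      measurable_weightSigma W (Finset.mem_Icc.1 hl).1)
  · exact measurable_const

theorem measurable_jointTail (W : ℕ → Ω → ℝ) {ι : Type*} [Fintype ι]
    [DecidableEq ι] {ℓ : ι → ℕ} (hℓ : ∀ i, 1 ≤ ℓ i) (n : ℕ) (d : ι → ℕ) :
    Measurable[weightSigma W] fun ω => jointTail (attachProb (fun l => W l ω) ℓ) n d := by
  induction n generalizing d with
  | zero => simp only [jointTail]; exact measurable_const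
  | succ n ih =>
    simp only [jointTail]
    have h := fun i => measurable_attachProb W hℓ n i
    exact ((measurable_const.sub (Finset.measurable_fun_sum _ fun i _ => h i)).mul (ih d)).add
      (Finset.measurable_fun_sum _ fun i _ => (h i).mul (ih _))

end

namespace IsWeightedRecursiveTree

variable {Ω : Type*} [mΩ : MeasurableSpace Ω] {P : Measure Ω}
  {W : ℕ → Ω → ℝ} {par : ℕ → Ω → ℕ}

theorem ae_weight_pos (hT : IsWeightedRecursiveTree P W par) :
    ∀ᵐ ω ∂P, ∀ i, 1 ≤ i → 0 < W i ω := by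
  rw [ae_all_iff]; intro i
  by_cases hi : 1 ≤ i
  · have := (hT.identDistrib_weight i hi).symm.ae_snd (p := fun x => 0 < x) measurableSet_Ioi
      hT.weight_pos
    filter_upwards [this] with ω hω _ using hω
  · exact .of_forall fun ω h => absurd h hi

theorem weightSigma_le (hT : IsWeightedRecursiveTree P W par) : weightSigma W ≤ mΩ :=
  iSup₂_le fun i hi => (hT.measurable_weight i hi).comap_le

theorem wrtHistory_le (hT : IsWeightedRecursiveTree P W par) (n : ℕ) :
    wrtHistory W par n ≤ mΩ :=
  sup_le hT.weightSigma_le (iSup₂_le fun j hj => (hT.measurable_par j hj.1).comap_le)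

theorem measurableSet_par_eq (hT : IsWeightedRecursiveTree P W par) {n : ℕ} (hn : 1 ≤ n) (x : ℕ) :
    MeasurableSet {ω | par (n + 1) ω = x} :=
  hT.measurable_par (n + 1) (by omega) (measurableSet_singleton x)

/-- The model prescribes probabilities only for parents in {1, …, n}. They sum to one, so almost
surely there is no other parent. -/
theorem ae_par_mem [IsProbabilityMeasure P] (hT : IsWeightedRecursiveTree P W par) {n : ℕ}
    (hn : 1 ≤ n) :
    ∀ᵐ ω ∂P, par (n + 1) ω ∈ Finset.Icc 1 n := by
  have h1 : ∀ i ∈ Finset.Icc 1 n, P.real {ω | par (n + 1) ω = i}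
      = ∫ ω, W i ω / ∑ l ∈ Finset.Icc 1 n, W l ω ∂P := by
    intro i hi
    rw [← integral_congr_ae (hT.connect n hn i hi), integral_condExp (hT.wrtHistory_le n),
      integral_indicator_const _ (hT.measurableSet_par_eq hn i)]
    simp
  have hint : ∀ i ∈ Finset.Icc 1 n,
      Integrable (fun ω => W i ω / ∑ l ∈ Finset.Icc 1 n, W l ω) P := fun i hi =>
    integrable_condExp.congr (hT.connect n hn i hi)
  have h2 : P.real {ω | par (n + 1) ω ∈ Finset.Icc 1 n} = 1 := by
    have : {ω | par (n + 1) ω ∈ Finset.Icc 1 n}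
        = ⋃ i ∈ Finset.Icc 1 n, {ω | par (n + 1) ω = i} := by ext; simp
    rw [this, measureReal_biUnion_finset (fun i _ j _ hij => Set.disjoint_left.2
      fun ω hi hj => hij (hi.symm.trans hj)) (fun i _ => hT.measurableSet_par_eq hn i),
      Finset.sum_congr rfl h1, ← integral_finsetSum _ hint]
    have : ∀ᵐ ω ∂P, ∑ i ∈ Finset.Icc 1 n, W i ω / ∑ l ∈ Finset.Icc 1 n, W l ω = 1 := by
      filter_upwards [hT.ae_weight_pos] with ω hω
      rw [← Finset.sum_div]
      refine div_self (Finset.sum_pos (fun i hi => hω i (Finset.mem_Icc.1 hi).1) ?_).ne'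
      exact ⟨1, Finset.mem_Icc.2 ⟨le_rfl, hn⟩⟩
    rw [integral_congr_ae this]; simp
  have hm : MeasurableSet {ω | par (n + 1) ω ∈ Finset.Icc 1 n} :=
    hT.measurable_par (n + 1) (by omega) (Finset.measurableSet _)
  refine (mem_ae_iff_prob_eq_one hm).2 ?_
  rwa [measureReal_def, ENNReal.toReal_eq_one_iff] at h2

/-- Extends the prescribed connection probability to labels not yet present, for which both sides
vanish. -/
theorem condExp_par_eq [IsProbabilityMeasure P]
    (hT : IsWeightedRecursiveTree P W par) {ι : Type*} {ℓ : ι → ℕ}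
    (hℓ : ∀ i, 1 ≤ ℓ i) {n : ℕ} (hn : 1 ≤ n) (i : ι) :
    P[({ω | par (n + 1) ω = ℓ i}.indicator fun _ => (1 : ℝ)) | wrtHistory W par n]
      =ᵐ[P] fun ω => attachProb (fun l => W l ω) ℓ n i := by
  by_cases h : ℓ i ≤ n
  · simpa only [attachProb, if_pos h] using hT.connect n hn (ℓ i) (Finset.mem_Icc.2 ⟨hℓ i, h⟩)
  · simp only [attachProb, if_neg h]
    have h0 : ({ω | par (n + 1) ω = ℓ i}.indicator fun _ => (1 : ℝ)) =ᵐ[P] 0 := by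
      filter_upwards [hT.ae_par_mem hn] with ω hω
      refine Set.indicator_of_notMem (fun h2 => h ?_) _
      exact (h2 : par (n + 1) ω = ℓ i) ▸ (Finset.mem_Icc.1 hω).2
    refine (condExp_congr_ae h0).trans ?_
    rw [condExp_zero]; rfl

/-- Given the weights, the in-degrees of distinct vertices are the counters of independent
rounds. -/
theorem integral_mul_indicator_degreeEvent [IsProbabilityMeasure P]
    (hT : IsWeightedRecursiveTree P W par) {ι : Type*}
    [Fintype ι] [DecidableEq ι] {ℓ : ι → ℕ} (hℓ : ∀ i, 1 ≤ ℓ i) (hinj : Function.Injective ℓ)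
    (n : ℕ) (d : ι → ℕ) {g : Ω → ℝ} (hg : Measurable[weightSigma W] g) {C : ℝ}
    (hC : ∀ᵐ ω ∂P, ‖g ω‖ ≤ C) :
    ∫ ω, g ω * (degreeEvent par n ℓ d).indicator (fun _ => (1 : ℝ)) ω ∂P
      = ∫ ω, g ω * jointTail (attachProb (fun l => W l ω) ℓ) n d ∂P := by
  classical
  -- The test function must vary: in the induction step the conditional probability `p i`, a
  -- function of the weights, is absorbed into `g`.
  induction n generalizing d g C with
  | zero =>
    congr with ω
    congr 1
    have : ω ∈ degreeEvent par 0 ℓ d ↔ d = 0 := by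
      simp [degreeEvent, inDegree, funext_iff]
    simp [jointTail, Set.indicator_apply, this]
  | succ n ih =>
    -- Vertex 1 has no parent, so round 0 does nothing: no edge is counted, and `attachProb`
    -- vanishes at 0 because labels are at least 1.
    rcases Nat.eq_zero_or_pos n with rfl | hn
    · have h1 : degreeEvent par (0 + 1) ℓ d = degreeEvent par 0 ℓ d := by
        simp [degreeEvent, inDegree]
      have h2 : ∀ ω, jointTail (attachProb (fun l => W l ω) ℓ) (0 + 1) d
          = jointTail (attachProb (fun l => W l ω) ℓ) 0 d := by
        intro ω
        have : ∀ i, attachProb (fun l => W l ω) ℓ 0 i = 0 := fun i =>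
          if_neg (by have := hℓ i; omega)
        simp [jointTail, this]
      simp only [h1, h2]
      exact ih d hg hC
    · have hgm : Measurable g := hg.mono hT.weightSigma_le le_rfl
      have hE : ∀ d, MeasurableSet[wrtHistory W par n] (degreeEvent par n ℓ d) := fun d =>
        measurableSet_degreeEvent (fun j hj => measurable_par_wrtHistory W par hj) ℓ d
      have hE' : ∀ d, MeasurableSet (degreeEvent par n ℓ d) := fun d =>
        hT.wrtHistory_le n _ (hE d)
      set I : (ι → ℕ) → Ω → ℝ := fun d =>
        (degreeEvent par n ℓ d).indicator (fun _ => (1 : ℝ)) with hI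
      set p : ι → Ω → ℝ := fun i ω => attachProb (fun l => W l ω) ℓ n i with hp
      have hI1 : ∀ d ω, ‖I d ω‖ ≤ 1 := fun d ω => by
        simp only [hI, Set.indicator_apply]; split_ifs <;> simp
      have hpm : ∀ i, Measurable[weightSigma W] (p i) := fun i => measurable_attachProb W hℓ n i
      have hp1 : ∀ i, ∀ᵐ ω ∂P, ‖p i ω‖ ≤ 1 := fun i => by
        filter_upwards [hT.ae_weight_pos] with ω hω
        have h0 := attachProb_nonneg (ι := ι) hω hℓ n
        rw [Real.norm_eq_abs, abs_of_nonneg (h0 i)]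
        exact (Finset.single_le_sum (fun i _ => h0 i) (Finset.mem_univ i)).trans
          (sum_attachProb_le_one hω hℓ hinj n)
      have hgI : ∀ d, Integrable (fun ω => g ω * I d ω) P := fun d =>
        Integrable.of_bound (hgm.mul (measurable_const.indicator (hE' d))).aestronglyMeasurable C (by
          filter_upwards [hC] with ω hω
          rw [norm_mul]
          exact (mul_le_of_le_one_right (norm_nonneg _) (hI1 d ω)).trans hω)
      have hC0 : ∀ i, ∀ᵐ ω ∂P, ‖g ω * p i ω‖ ≤ C := fun i => by
        filter_upwards [hC, hp1 i] with ω h1 h2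
        rw [norm_mul]
        exact (mul_le_of_le_one_right (norm_nonneg _) h2).trans h1
      have hgpm : ∀ i, Measurable[weightSigma W] fun ω => g ω * p i ω := fun i => hg.mul (hpm i)
      have hgpI : ∀ i d, Integrable (fun ω => g ω * p i ω * I d ω) P := fun i d =>
        Integrable.of_bound (((hgpm i).mono hT.weightSigma_le le_rfl).mul
          (measurable_const.indicator (hE' d))).aestronglyMeasurable C (by
          filter_upwards [hC0 i] with ω hω
          rw [norm_mul]
          exact (mul_le_of_le_one_right (norm_nonneg _) (hI1 d ω)).trans hω)
      set A : ι → Ω → ℝ := fun i => {ω | par (n + 1) ω = ℓ i}.indicator (fun _ => (1 : ℝ)) with hA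
      have hA1 : ∀ i ω, ‖A i ω‖ ≤ 1 := fun d ω => by
        simp only [hA, Set.indicator_apply]; split_ifs <;> simp
      have hAm : ∀ i, Measurable (A i) := fun i =>
        measurable_const.indicator (hT.measurableSet_par_eq hn _)
      have hAi : ∀ i, Integrable (A i) P := fun i =>
        Integrable.of_bound (hAm i).aestronglyMeasurable 1 (.of_forall (hA1 i))
      have hgIA : ∀ i d, Integrable (fun ω => g ω * I d ω * A i ω) P := fun i d =>
        (hgI d).mul_bdd (c := 1) (hAm i).aestronglyMeasurable (.of_forall (hA1 i))
      -- `g` and `I d` are measurable with respect to the history, so they can be pulled out of the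
      -- conditional expectation of the parent indicator.
      have key : ∀ i d, ∫ ω, g ω * I d ω * A i ω ∂P = ∫ ω, g ω * p i ω * I d ω ∂P := by
        intro i d
        have hsm : StronglyMeasurable[wrtHistory W par n] fun ω => g ω * I d ω :=
          ((hg.mono (weightSigma_le_wrtHistory W par n) le_rfl).mul
            (measurable_const.indicator (hE d))).stronglyMeasurable
        rw [← integral_condExp (hT.wrtHistory_le n)]
        refine integral_congr_ae ?_
        filter_upwards [condExp_mul_of_stronglyMeasurable_left hsm (hgIA i d) (hAi i),
          hT.condExp_par_eq hℓ hn i] with ω h1 h2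
        refine h1.trans ?_
        simp only [Pi.mul_apply]
        rw [h2]
        simp only [hp]
        ring
      have hLHS : ∀ ω, g ω * (degreeEvent par (n + 1) ℓ d).indicator (fun _ => (1 : ℝ)) ω
          = g ω * I d ω + ∑ i, (g ω * I (Function.update d i (d i - 1)) ω * A i ω
            - g ω * I d ω * A i ω) := by
        intro ω
        rw [indicator_degreeEvent_succ par hn hinj d ω, mul_add, Finset.mul_sum]
        congr 1
        exact Finset.sum_congr rfl fun i _ => by simp only [hI, hA]; ring
      set J : (ι → ℕ) → Ω → ℝ := fun d ω => jointTail (attachProb (fun l => W l ω) ℓ) n d with hJ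
      have hJm : ∀ d, Measurable (J d) := fun d =>
        (measurable_jointTail W hℓ n d).mono hT.weightSigma_le le_rfl
      have hJ1 : ∀ d, ∀ᵐ ω ∂P, ‖J d ω‖ ≤ 1 := fun d => by
        filter_upwards [hT.ae_weight_pos] with ω hω
        rw [Real.norm_eq_abs, abs_of_nonneg (jointTail_nonneg (attachProb_nonneg hω hℓ)
          (sum_attachProb_le_one hω hℓ hinj) n d)]
        exact jointTail_le_one (attachProb_nonneg hω hℓ) (sum_attachProb_le_one hω hℓ hinj) n d
      have hgJ : ∀ d, Integrable (fun ω => g ω * J d ω) P := fun d =>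
        (Integrable.of_bound hgm.aestronglyMeasurable C hC).mul_bdd (c := 1)
          (hJm d).aestronglyMeasurable (hJ1 d)
      have hgpJ : ∀ i d, Integrable (fun ω => g ω * p i ω * J d ω) P := fun i d =>
        (Integrable.of_bound ((hgpm i).mono hT.weightSigma_le le_rfl).aestronglyMeasurable C
          (hC0 i)).mul_bdd (c := 1) (hJm d).aestronglyMeasurable (hJ1 d)
      have hRHS : ∀ ω, g ω * jointTail (attachProb (fun l => W l ω) ℓ) (n + 1) d
          = g ω * J d ω + ∑ i, (g ω * p i ω * J (Function.update d i (d i - 1)) ω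
            - g ω * p i ω * J d ω) := by
        intro ω
        rw [jointTail, Finset.sum_sub_distrib]
        simp only [hJ, hp, mul_assoc, ← Finset.mul_sum, ← Finset.sum_mul]
        ring
      simp only [hLHS, hRHS]
      have hd1 : ∀ i, Integrable (fun ω => g ω * I (Function.update d i (d i - 1)) ω * A i ω
          - g ω * I d ω * A i ω) P := fun i => (hgIA i _).sub (hgIA i _)
      have hd2 : ∀ i, Integrable (fun ω => g ω * p i ω * J (Function.update d i (d i - 1)) ω
          - g ω * p i ω * J d ω) P := fun i => (hgpJ i _).sub (hgpJ i _)
      rw [integral_add (hgI d) (integrable_finsetSum _ fun i _ => hd1 i),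
        integral_add (hgJ d) (integrable_finsetSum _ fun i _ => hd2 i),
        integral_finsetSum _ (fun i _ => hd1 i), integral_finsetSum _ (fun i _ => hd2 i)]
      congr 1
      · exact ih d hg hC
      · refine Finset.sum_congr rfl fun i _ => ?_
        rw [integral_sub (hgIA i _) (hgIA i _), integral_sub (hgpJ i _) (hgpJ i _), key, key]
        congr 1
        · exact ih _ (hgpm i) (hC0 i)
        · exact ih _ (hgpm i) (hC0 i)

end IsWeightedRecursiveTree

/-! ### Harmonic sums and logarithms -/

theorem log_div_le_sum_inv {l n : ℕ} (hl : 1 ≤ l) (hn : l ≤ n) :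
    Real.log (n / l) ≤ ∑ j ∈ Finset.range n, if l ≤ j then (j : ℝ)⁻¹ else 0 := by
  have hl0 : (0 : ℝ) < l := by exact_mod_cast hl
  induction n, hn using Nat.le_induction with
  | base =>
    rw [div_self hl0.ne', Real.log_one]
    exact Finset.sum_nonneg fun j _ => by split_ifs <;> positivity
  | succ n hn ih =>
    rw [Finset.sum_range_succ, if_pos hn]
    have hn0 : (0 : ℝ) < n := by exact_mod_cast hl.trans hn
    have h1 : Real.log ((n + 1 : ℝ) / n) ≤ (n : ℝ)⁻¹ := by
      refine (Real.log_le_sub_one_of_pos (by positivity)).trans (le_of_eq ?_)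
      field_simp; ring
    have h2 : Real.log (((n + 1 : ℕ) : ℝ) / l) = Real.log (n / l) + Real.log ((n + 1 : ℝ) / n) := by
      rw [← Real.log_mul (by positivity) (by positivity)]
      congr 1; push_cast; field_simp
    linarith

/-- The upper comparison with the logarithm costs a shift of the label to `l - 1`; this is where the
shifted labels in all later upper bounds come from. -/
theorem sum_inv_le_log_div {l n : ℕ} (hl : 2 ≤ l) (hn : l ≤ n) :
    ∑ j ∈ Finset.range n, (if l ≤ j then (j : ℝ)⁻¹ else 0) ≤ Real.log (n / ((l - 1 : ℕ) : ℝ)) := by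
  have hl0 : (0 : ℝ) < ((l - 1 : ℕ) : ℝ) := by exact_mod_cast (by omega : 0 < l - 1)
  have key : ∑ j ∈ Finset.range n, (if l ≤ j then (j : ℝ)⁻¹ else 0)
      ≤ Real.log (((n - 1 : ℕ) : ℝ) / ((l - 1 : ℕ) : ℝ)) := by
    induction n, hn using Nat.le_induction with
    | base =>
      rw [div_self hl0.ne', Real.log_one]
      refine le_of_eq (Finset.sum_eq_zero fun j hj => if_neg ?_)
      have := Finset.mem_range.1 hj; omega
    | succ n hn ih =>
      rw [Finset.sum_range_succ, if_pos hn, Nat.add_sub_cancel]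
      have hn0 : (0 : ℝ) < ((n - 1 : ℕ) : ℝ) := by exact_mod_cast (by omega : 0 < n - 1)
      have hn1 : (n : ℝ) = ((n - 1 : ℕ) : ℝ) + 1 := by exact_mod_cast (by omega : n = n - 1 + 1)
      have hn2 : (0 : ℝ) < n := by linarith
      have h1 : (n : ℝ)⁻¹ ≤ Real.log ((n : ℝ) / ((n - 1 : ℕ) : ℝ)) := by
        refine le_trans (le_of_eq ?_) (Real.one_sub_inv_le_log_of_pos (by positivity))
        rw [inv_div, inv_eq_one_div, ← div_self hn2.ne', ← sub_div]
        rw [div_self hn2.ne']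
        congr 1; linarith
      have h2 : Real.log ((n : ℝ) / ((l - 1 : ℕ) : ℝ))
          = Real.log (((n - 1 : ℕ) : ℝ) / ((l - 1 : ℕ) : ℝ))
            + Real.log ((n : ℝ) / ((n - 1 : ℕ) : ℝ)) := by
        rw [← Real.log_mul (by positivity) (by positivity)]
        congr 1; field_simp
      linarith
  refine key.trans (Real.log_le_log ?_ ?_)
  · have : (0 : ℝ) < ((n - 1 : ℕ) : ℝ) := by exact_mod_cast (by omega : 0 < n - 1)
    positivity
  · exact div_le_div_of_nonneg_right (by exact_mod_cast Nat.sub_le n 1) hl0.le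

theorem sum_range_inv_le {n : ℕ} (hn : 1 ≤ n) :
    ∑ j ∈ Finset.range n, (j : ℝ)⁻¹ ≤ 1 + Real.log n := by
  have hlog : 0 ≤ Real.log n := Real.log_nonneg (by exact_mod_cast hn)
  rcases hn.eq_or_lt with rfl | hn
  · simp
  · have h := sum_inv_le_log_div (l := 2) (n := n) le_rfl hn
    have h2 : ∑ j ∈ Finset.range n, (j : ℝ)⁻¹
        ≤ ∑ j ∈ Finset.range n, ((if 2 ≤ j then (j : ℝ)⁻¹ else 0) + if j = 1 then 1 else 0) := by
      refine Finset.sum_le_sum fun j _ => ?_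
      rcases j with _ | _ | j
      · simp
      · simp
      · simp
    rw [Finset.sum_add_distrib, Finset.sum_ite_eq'] at h2
    simp only [Finset.mem_range, hn, if_true] at h2
    norm_num at h
    linarith

/-! ### Joint tails for a fixed regular weight sequence -/

section weights

variable {ι : Type*} {w : ℕ → ℝ} {wstar α β : ℝ} {N n : ℕ}

theorem attachProb_eq_ite_mul (w : ℕ → ℝ) (ℓ : ι → ℕ) (j : ℕ) (i : ι) :
    attachProb w ℓ j i = w (ℓ i) * if ℓ i ≤ j then (∑ l ∈ Finset.Icc 1 j, w l)⁻¹ else 0 := by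
  unfold attachProb
  split_ifs
  · rw [div_eq_mul_inv]
  · simp

/-- With x the weight and S the total, 1 - x/S = (1 + x/(S - x))⁻¹, and the summand 1 in `hlow`
gives S - x ≥ j/β since x ≤ 1. Then 1 + y ≤ exp y shows that the rate x β / j satisfies the thinning
condition exactly. -/
theorem attachProb_le_one_sub_exp (hβ : 0 < β) (hw1 : ∀ i, 1 ≤ i → w i ≤ 1)
    (hw0 : ∀ i, 1 ≤ i → 0 < w i)
    (hlow : ∀ j, N ≤ j → j < n → (j : ℝ) / β + 1 ≤ ∑ l ∈ Finset.Icc 1 j, w l)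
    {ℓ : ι → ℕ} {i : ι} (hN : N < ℓ i) {j : ℕ} (hj : j < n) :
    attachProb w ℓ j i
      ≤ 1 - Real.exp (-(w (ℓ i) * β * if ℓ i ≤ j then (j : ℝ)⁻¹ else 0)) := by
  unfold attachProb
  split_ifs with h
  · have hj0 : (0 : ℝ) < j := by exact_mod_cast (by omega : 0 < j)
    have hS := hlow j (by omega) hj
    set S := ∑ l ∈ Finset.Icc 1 j, w l
    have hx := hw0 (ℓ i) (by omega)
    have hx1 := hw1 (ℓ i) (by omega)
    set x := w (ℓ i)
    have hjb : 0 < (j : ℝ) / β := by positivity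
    have hS0 : 0 < S := by linarith
    have hSx : (j : ℝ) / β ≤ S - x := by linarith
    have hSx0 : 0 < S - x := by linarith
    have h1 : Real.exp (-(x * β * (j : ℝ)⁻¹)) ≤ (1 + x * β * (j : ℝ)⁻¹)⁻¹ := by
      rw [Real.exp_neg]
      refine inv_anti₀ (by positivity) ?_
      linarith [Real.add_one_le_exp (x * β * (j : ℝ)⁻¹)]
    have h2 : (1 + x * β * (j : ℝ)⁻¹)⁻¹ ≤ 1 - x / S := by
      have h3 : x / (S - x) ≤ x * β * (j : ℝ)⁻¹ := by
        have : x * β * (j : ℝ)⁻¹ = x / (j / β) := by field_simp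
        rw [this]
        exact div_le_div_of_nonneg_left hx.le hjb hSx
      have h4 : 1 - x / S = (1 + x / (S - x))⁻¹ := by field_simp; ring
      rw [h4]
      have : 0 ≤ x / (S - x) := by positivity
      exact inv_anti₀ (by linarith) (by linarith)
    linarith
  · simp

/-- A bound valid for every label, to be used for early ones. Before `N` only the total weight
`wstar * j` is guaranteed, which is why the lower bound on the weights enters; it costs a multiple
of log N only. -/
theorem sum_attachProb_le_const (hws : 0 < wstar) (hβ : 0 < β)
    (hw1 : ∀ i, 1 ≤ i → w i ≤ 1) (hws' : ∀ i, 1 ≤ i → wstar ≤ w i)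
    (hlow : ∀ j, N ≤ j → j < n → (j : ℝ) / β + 1 ≤ ∑ l ∈ Finset.Icc 1 j, w l)
    (hN : 1 ≤ N) (hNn : N ≤ n) {ℓ : ι → ℕ} (hℓ : ∀ i, 1 ≤ ℓ i) (i : ι) :
    ∑ j ∈ Finset.range n, attachProb w ℓ j i
      ≤ (1 + Real.log N) / wstar + β * (1 + Real.log n) := by
  have hw0 : ∀ i, 1 ≤ i → 0 < w i := fun i hi => hws.trans_le (hws' i hi)
  have h1 : ∀ j ∈ Finset.range n, attachProb w ℓ j i
      ≤ (if j < N then wstar⁻¹ * (j : ℝ)⁻¹ else 0) + β * (j : ℝ)⁻¹ := by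
    intro j hj
    unfold attachProb
    split_ifs with h h2 h2
    · have hj0 : (0 : ℝ) < j := by exact_mod_cast (hℓ i).trans h
      have hS : wstar * j ≤ ∑ l ∈ Finset.Icc 1 j, w l := by
        have := Finset.card_nsmul_le_sum (Finset.Icc 1 j) w wstar
          fun l hl => hws' l (Finset.mem_Icc.1 hl).1
        simpa [mul_comm] using this
      have : w (ℓ i) / ∑ l ∈ Finset.Icc 1 j, w l ≤ 1 / (wstar * j) :=
        div_le_div₀ zero_le_one (hw1 _ (hℓ i)) (by positivity) hS
      have h3 : 1 / (wstar * (j : ℝ)) = wstar⁻¹ * (j : ℝ)⁻¹ := by field_simp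
      have h4 : 0 ≤ β * (j : ℝ)⁻¹ := by positivity
      linarith
    · have hj0 : (0 : ℝ) < j := by exact_mod_cast (hℓ i).trans h
      have hS := hlow j (not_lt.1 h2) (Finset.mem_range.1 hj)
      have : w (ℓ i) / ∑ l ∈ Finset.Icc 1 j, w l ≤ 1 / (j / β) :=
        div_le_div₀ zero_le_one (hw1 _ (hℓ i)) (by positivity) (by linarith)
      have h3 : 1 / ((j : ℝ) / β) = β * (j : ℝ)⁻¹ := by field_simp
      linarith
    · positivity
    · positivity
  refine (Finset.sum_le_sum h1).trans ?_
  rw [Finset.sum_add_distrib, ← Finset.mul_sum]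
  refine add_le_add ?_ (mul_le_mul_of_nonneg_left (sum_range_inv_le (hN.trans hNn)) hβ.le)
  rw [← Finset.sum_filter]
  have : (Finset.range n).filter (fun j => j < N) = Finset.range N := by
    ext j; simp only [Finset.mem_filter, Finset.mem_range]; omega
  rw [this, ← Finset.mul_sum, div_eq_inv_mul]
  exact mul_le_mul_of_nonneg_left (sum_range_inv_le hN) (by positivity)

/-- Upper bound for the joint tail of the in-degrees given regular weights: a Chernoff bound for
early vertices and a Poisson bound for the others. -/
theorem jointTail_attachProb_le [Fintype ι] [DecidableEq ι] (hws : 0 < wstar) (hβ : 0 < β)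
    (hw1 : ∀ i, 1 ≤ i → w i ≤ 1) (hws' : ∀ i, 1 ≤ i → wstar ≤ w i)
    (hlow : ∀ j, N ≤ j → j < n → (j : ℝ) / β + 1 ≤ ∑ l ∈ Finset.Icc 1 j, w l)
    (hN : 1 ≤ N) (hNn : N ≤ n) {z : ℝ} (hz : 1 ≤ z) {ℓ : ι → ℕ} (hℓ : ∀ i, 1 ≤ ℓ i)
    (hℓn : ∀ i, ℓ i ≤ n) (hinj : Function.Injective ℓ) (d : ι → ℕ) :
    jointTail (attachProb w ℓ) n d ≤ ∏ i, if ℓ i ≤ N then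
        (z ^ d i)⁻¹ * Real.exp ((z - 1) * ((1 + Real.log N) / wstar + β * (1 + Real.log n)))
      else poissonTail (d i) (w (ℓ i) * (β * Real.log (n / ((ℓ i - 1 : ℕ) : ℝ)))) := by
  have hw0 : ∀ i, 1 ≤ i → 0 < w i := fun i hi => hws.trans_le (hws' i hi)
  have hp0 := attachProb_nonneg (ι := ι) hw0 hℓ
  have hz0 : 0 < z := by linarith
  set lam : ι → ℕ → ℝ := fun i j => w (ℓ i) * β * if ℓ i ≤ j then (j : ℝ)⁻¹ else 0 with hlam
  have hlam0 : ∀ i j, 0 ≤ lam i j := fun i j =>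
    mul_nonneg (mul_nonneg (hw0 _ (hℓ i)).le hβ.le) (by split_ifs <;> positivity)
  have hlamS : ∀ i j, 0 ≤ ∑ j ∈ Finset.range j, lam i j := fun i j =>
    Finset.sum_nonneg fun j _ => hlam0 i j
  have hprod : ∀ i j, 0 ≤ ∏ j ∈ Finset.range j, (1 + (z - 1) * attachProb w ℓ j i) := fun i j =>
    Finset.prod_nonneg fun j _ => add_nonneg zero_le_one (mul_nonneg (by linarith) (hp0 j i))
  -- The supersolution depends on the label: z^{-d} times the exact generating function of the
  -- counter for early labels, a Poisson tail with the thinning rates for late ones.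
  have h := jointTail_le_prod hp0 (sum_attachProb_le_one hw0 hℓ hinj)
    (u := fun i j d => if ℓ i ≤ N then
        (z ^ d)⁻¹ * ∏ j ∈ Finset.range j, (1 + (z - 1) * attachProb w ℓ j i)
      else poissonTail d (∑ j ∈ Finset.range j, lam i j)) ?_ ?_ ?_ n ?_ d
  · refine h.trans (Finset.prod_le_prod (fun i _ => ?_) fun i _ => ?_)
    · split_ifs
      · exact mul_nonneg (by positivity) (hprod i n)
      · exact poissonTail_nonneg _ (hlamS i n)
    · split_ifs with hi
      · refine mul_le_mul_of_nonneg_left ?_ (by positivity)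
        calc _ ≤ ∏ j ∈ Finset.range n, Real.exp ((z - 1) * attachProb w ℓ j i) := by
              refine Finset.prod_le_prod (fun j _ => add_nonneg zero_le_one
                (mul_nonneg (by linarith) (hp0 j i))) fun j _ => ?_
              linarith [Real.add_one_le_exp ((z - 1) * attachProb w ℓ j i)]
          _ = Real.exp ((z - 1) * ∑ j ∈ Finset.range n, attachProb w ℓ j i) := by
              rw [← Real.exp_sum, Finset.mul_sum]
          _ ≤ _ := Real.exp_le_exp.2 (mul_le_mul_of_nonneg_left
              (sum_attachProb_le_const hws hβ hw1 hws' hlow hN hNn hℓ i) (by linarith))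
      · refine poissonTail_mono _ (hlamS i n) ?_
        simp only [hlam]
        rw [← Finset.mul_sum, mul_assoc]
        exact mul_le_mul_of_nonneg_left (mul_le_mul_of_nonneg_left
          (sum_inv_le_log_div (by omega) (hℓn i)) hβ.le) (hw0 _ (hℓ i)).le
  · intro i j d
    split_ifs
    · exact mul_nonneg (by positivity) (hprod i j)
    · exact poissonTail_nonneg _ (hlamS i j)
  · intro i j d
    split_ifs
    · exact mul_le_mul_of_nonneg_right
        (inv_anti₀ (by positivity) (pow_le_pow_right₀ hz (Nat.sub_le d 1))) (hprod i j)
    · exact poissonTail_antitone (hlamS i j) (Nat.sub_le d 1)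
  · intro i
    split_ifs
    · simp
    · simp [poissonTail_zero]
  · intro j hj i d
    split_ifs with hi
    · rw [Finset.prod_range_succ]
      have hq := hprod i j
      set Q := ∏ j ∈ Finset.range j, (1 + (z - 1) * attachProb w ℓ j i)
      have hpj := hp0 j i
      set q := attachProb w ℓ j i
      have h1 : (z ^ (d - 1))⁻¹ ≤ z * (z ^ d)⁻¹ := by
        rcases d with _ | d
        · simpa using hz
        · rw [Nat.add_sub_cancel, pow_succ]
          refine le_of_eq ?_
          field_simp
      have h2 : q * ((z ^ (d - 1))⁻¹ * Q) ≤ q * (z * (z ^ d)⁻¹ * Q) :=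
        mul_le_mul_of_nonneg_left (mul_le_mul_of_nonneg_right h1 hq) hpj
      calc _ ≤ (1 - q) * ((z ^ d)⁻¹ * Q) + q * (z * (z ^ d)⁻¹ * Q) := by linarith
        _ = _ := by ring
    · rw [Finset.sum_range_succ]
      exact poissonTail_bernoulli_le d (hlamS i j) (hlam0 i j)
        (attachProb_le_one_sub_exp hβ hw1 hw0 hlow (not_le.1 hi) hj)

/-- Lower bound for the joint tail of the in-degrees of late vertices with weight one. -/
theorem le_jointTail_attachProb [Fintype ι] [DecidableEq ι] (hα : 0 < α) (hβ : 0 < β)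
    (hw1 : ∀ i, 1 ≤ i → w i ≤ 1) (hw0 : ∀ i, 1 ≤ i → 0 < w i)
    (hlow : ∀ j, N ≤ j → j < n → (j : ℝ) / β + 1 ≤ ∑ l ∈ Finset.Icc 1 j, w l)
    (hup : ∀ j, N ≤ j → j < n → ∑ l ∈ Finset.Icc 1 j, w l ≤ (j : ℝ) / α)
    (hN : 1 ≤ N) {ℓ : ι → ℕ} (hℓ : ∀ i, N < ℓ i)
    (hℓn : ∀ i, ℓ i ≤ n) (hinj : Function.Injective ℓ) (hℓ1 : ∀ i, w (ℓ i) = 1) (d : ι → ℕ) :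
    ∏ i, poissonTail (d i) (α * Real.log (n / ℓ i))
      - 3 ^ Fintype.card ι * ((Fintype.card ι * β) ^ 2 * (2 / N))
        * ∏ i, poissonTail (d i - 2) (β * Real.log (n / ((ℓ i - 1 : ℕ) : ℝ)))
      ≤ jointTail (attachProb w ℓ) n d := by
  have hℓ' : ∀ i, 1 ≤ ℓ i := fun i => hN.trans (hℓ i).le
  have hp0 := attachProb_nonneg (ι := ι) hw0 hℓ'
  have hmain := prod_poissonTail_sub_le_jointTail hp0 (sum_attachProb_le_one hw0 hℓ' hinj)
    (lam := fun j i => w (ℓ i) * β * if ℓ i ≤ j then (j : ℝ)⁻¹ else 0) n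
    (fun j hj i => attachProb_le_one_sub_exp hβ hw1 hw0 hlow (hℓ i) hj) d
  refine le_trans ?_ hmain
  have hlog : ∀ i, 0 ≤ Real.log ((n : ℝ) / ℓ i) := fun i => by
    refine Real.log_nonneg ((one_le_div (by exact_mod_cast hℓ' i)).2 (by exact_mod_cast hℓn i))
  refine sub_le_sub ?_ (mul_le_mul (mul_le_mul_of_nonneg_left ?_ (by positivity)) ?_
    (Finset.prod_nonneg fun i _ => poissonTail_nonneg _ (Finset.sum_nonneg fun j _ => ?_))
    (by positivity))
  · refine Finset.prod_le_prod (fun i _ => poissonTail_nonneg _ (mul_nonneg hα.le (hlog i)))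
      fun i _ => poissonTail_mono _ (mul_nonneg hα.le (hlog i)) ?_
    refine (mul_le_mul_of_nonneg_left (log_div_le_sum_inv (hℓ' i) (hℓn i)) hα.le).trans ?_
    rw [Finset.mul_sum]
    refine Finset.sum_le_sum fun j hj => ?_
    rw [attachProb_eq_ite_mul, hℓ1, one_mul]
    split_ifs with h
    · have h1 := hup j ((hℓ i).le.trans h) (Finset.mem_range.1 hj)
      have h2 := hlow j ((hℓ i).le.trans h) (Finset.mem_range.1 hj)
      have hj0 : (0 : ℝ) < j := by exact_mod_cast (hℓ' i).trans h
      have h3 : 0 < ∑ l ∈ Finset.Icc 1 j, w l := by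
        have : 0 < (j : ℝ) / β := by positivity
        linarith
      have h4 : α * (j : ℝ)⁻¹ = (j / α)⁻¹ := by field_simp
      rw [h4]
      exact inv_anti₀ h3 h1
    · simp
  -- No labelled vertex exists before round `N + 1`, and from then on each attracts the edge with
  -- probability at most β/j. Summing the squares uses ∑ 1/j² ≤ 2/N, whence the error factor in the
  -- statement.
  · have hp : ∀ j ∈ Finset.range n, (∑ i, attachProb w ℓ j i) ^ 2
        ≤ if N < j then (Fintype.card ι * β) ^ 2 * ((j : ℝ) ^ 2)⁻¹ else 0 := by
      intro j hj
      split_ifs with h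
      · have hj0 : (0 : ℝ) < j := by exact_mod_cast (by omega : 0 < j)
        have h1 : ∑ i, attachProb w ℓ j i ≤ Fintype.card ι * β * (j : ℝ)⁻¹ := by
          have : ∀ i ∈ Finset.univ, attachProb w ℓ j i ≤ β * (j : ℝ)⁻¹ := by
            intro i _
            have h5 := attachProb_le_one_sub_exp hβ hw1 hw0 hlow (hℓ i) (Finset.mem_range.1 hj)
            rw [hℓ1, one_mul] at h5
            have h6 := Real.add_one_le_exp (-(β * if ℓ i ≤ j then (j : ℝ)⁻¹ else 0))
            have h7 : (β * if ℓ i ≤ j then (j : ℝ)⁻¹ else 0) ≤ β * (j : ℝ)⁻¹ := by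
              refine mul_le_mul_of_nonneg_left ?_ hβ.le
              split_ifs
              · exact le_rfl
              · positivity
            linarith
          refine (Finset.sum_le_sum this).trans (le_of_eq ?_)
          simp [mul_assoc]
        have h2 := pow_le_pow_left₀ (Finset.sum_nonneg fun i _ => hp0 j i) h1 2
        rwa [mul_pow, inv_pow] at h2
      · refine le_of_eq ?_
        have : ∀ i ∈ Finset.univ, attachProb w ℓ j i = 0 := fun i _ =>
          if_neg (by have := hℓ i; omega)
        rw [Finset.sum_eq_zero this]; simp
    refine (Finset.sum_le_sum hp).trans ?_
    rw [← Finset.sum_filter, ← Finset.mul_sum]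
    refine mul_le_mul_of_nonneg_left ?_ (sq_nonneg _)
    have : (Finset.range n).filter (fun j => N < j) = Finset.Ioo N n := by
      ext j; simp only [Finset.mem_filter, Finset.mem_range, Finset.mem_Ioo]; omega
    rw [this]
    refine (sum_Ioo_inv_sq_le N n).trans ?_
    have : (0 : ℝ) < N := by exact_mod_cast hN
    exact div_le_div_of_nonneg_left zero_le_two this (by linarith)
  · refine Finset.prod_le_prod (fun i _ => poissonTail_nonneg _ (Finset.sum_nonneg fun j _ => ?_))
      fun i _ => poissonTail_mono _ (Finset.sum_nonneg fun j _ => ?_) ?_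
    · exact mul_nonneg (mul_nonneg (hw0 _ (hℓ' i)).le hβ.le) (by split_ifs <;> positivity)
    · exact mul_nonneg (mul_nonneg (hw0 _ (hℓ' i)).le hβ.le) (by split_ifs <;> positivity)
    · rw [← Finset.mul_sum, hℓ1, one_mul]
      exact mul_le_mul_of_nonneg_left
        (sum_inv_le_log_div (by have := hℓ i; omega) (hℓn i)) hβ.le
  · exact mul_nonneg (mul_nonneg (hw0 _ (hℓ' _)).le hβ.le) (by split_ifs <;> positivity)

end weights

/-! ### Concentration of the weight sums and bounds averaged over the weights -/

theorem IsAtomWeight.ae_le_one {Ω : Type*} [MeasurableSpace Ω] {P : Measure Ω}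
    [IsProbabilityMeasure P] {X : Ω → ℝ} (h : IsAtomWeight P X) (hX : Measurable X) :
    ∀ᵐ ω ∂P, X ω ≤ 1 := by
  have h1 : ∀ n : ℕ, ∀ᵐ ω ∂P, X ω ≤ 1 + 1 / ((n : ℝ) + 1) := by
    intro n
    have hn : ¬ P {ω | X ω ≤ 1 + 1 / ((n : ℝ) + 1)} < 1 := by
      intro hlt
      have h2 : (1 : ℝ) + 1 / ((n : ℝ) + 1) ≤ 1 := h.isLUB_one.1 hlt
      have : 0 < 1 / ((n : ℝ) + 1) := by positivity
      linarith
    refine (mem_ae_iff_prob_eq_one (measurableSet_le hX measurable_const)).2 ?_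
    exact le_antisymm prob_le_one (not_lt.1 hn)
  rw [← ae_all_iff] at h1
  filter_upwards [h1] with ω hω
  have hl : Tendsto (fun n : ℕ => 1 + 1 / ((n : ℝ) + 1)) atTop (𝓝 (1 + 0)) :=
    tendsto_const_nhds.add tendsto_one_div_add_atTop_nhds_zero_nat
  rw [add_zero] at hl
  exact ge_of_tendsto' hl hω

/-- The event that the total weight of the first `j` vertices is close to `μ * j` for all
`j ∈ [N, n)`. -/
def regularEvent {Ω : Type*} (W : ℕ → Ω → ℝ) (μ r : ℝ) (N n : ℕ) : Set Ω :=
  {ω | ∀ j ∈ Finset.Ico N n, |∑ l ∈ Finset.Icc 1 j, W l ω - μ * j| < r * j}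

theorem measurableSet_regularEvent {Ω : Type*} (W : ℕ → Ω → ℝ) (μ r : ℝ) (N n : ℕ) :
    MeasurableSet[weightSigma W] (regularEvent W μ r N n) := by
  have : regularEvent W μ r N n = ⋂ j ∈ Finset.Ico N n,
      {ω | |∑ l ∈ Finset.Icc 1 j, W l ω - μ * j| < r * j} := by
    ext ω; simp [regularEvent]
  rw [this]
  refine Finset.measurableSet_biInter _ fun j _ => ?_
  have h : Measurable[weightSigma W] fun ω => ∑ l ∈ Finset.Icc 1 j, W l ω :=
    Finset.measurable_fun_sum _ fun l hl => measurable_weightSigma W (Finset.mem_Icc.1 hl).1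
  exact (continuous_abs.measurable.comp (h.sub_const (μ * j))) measurableSet_Iio

/-- The term `(N : ℝ)⁻¹` in `hβ`, multiplied by j ≥ N, pays for the additional 1 required by the
thinning estimate. -/
theorem sum_weight_ge_of_regular {w : ℕ → ℝ} {μ r β : ℝ} {N : ℕ} (hN : 1 ≤ N)
    (hβ : β⁻¹ + (N : ℝ)⁻¹ ≤ μ - r) {j : ℕ}
    (hj : N ≤ j) (h : |∑ l ∈ Finset.Icc 1 j, w l - μ * j| < r * j) :
    (j : ℝ) / β + 1 ≤ ∑ l ∈ Finset.Icc 1 j, w l := by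
  have hN0 : (0 : ℝ) < N := by exact_mod_cast hN
  have hNj : (N : ℝ) ≤ j := by exact_mod_cast hj
  have hj0 : (0 : ℝ) < j := by linarith
  have h1 := (abs_lt.1 h).1
  have h2 := mul_le_mul_of_nonneg_right hβ hj0.le
  have h3 : 1 ≤ (N : ℝ)⁻¹ * j := by
    rw [← div_eq_inv_mul, one_le_div hN0]; exact hNj
  rw [div_eq_inv_mul]
  linarith

theorem sum_weight_le_of_regular {w : ℕ → ℝ} {μ r α : ℝ} (hα : μ + r ≤ α⁻¹) {j : ℕ}
    (h : |∑ l ∈ Finset.Icc 1 j, w l - μ * j| < r * j) :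
    ∑ l ∈ Finset.Icc 1 j, w l ≤ (j : ℝ) / α := by
  have h1 := (abs_lt.1 h).2
  have h2 := mul_le_mul_of_nonneg_right hα (Nat.cast_nonneg (α := ℝ) j)
  rw [div_eq_inv_mul]
  linarith

theorem measureReal_le_inter_add_compl {Ω : Type*} [MeasurableSpace Ω] (P : Measure Ω)
    [IsFiniteMeasure P] (A G : Set Ω) : P.real A ≤ P.real (A ∩ G) + P.real Gᶜ := by
  have h : A ⊆ (A ∩ G) ∪ Gᶜ := fun ω hω => by
    by_cases h : ω ∈ G
    · exact Or.inl ⟨hω, h⟩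
    · exact Or.inr h
  exact (measureReal_mono h).trans (measureReal_union_le _ _)

namespace IsWeightedRecursiveTree

variable {Ω : Type*} [mΩ : MeasurableSpace Ω] {P : Measure Ω}
  {W : ℕ → Ω → ℝ} {par : ℕ → Ω → ℕ} {wstar : ℝ}

theorem ae_weight_mem [IsProbabilityMeasure P] (hT : IsWeightedRecursiveTree P W par)
    (hatom : IsAtomWeight P (W 1))
    (hlow : ∀ᵐ ω ∂P, wstar ≤ W 1 ω) :
    ∀ᵐ ω ∂P, ∀ i, 1 ≤ i → wstar ≤ W i ω ∧ W i ω ≤ 1 := by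
  rw [ae_all_iff]; intro i
  by_cases hi : 1 ≤ i
  · have := (hT.identDistrib_weight i hi).symm.ae_snd (p := fun x => x ∈ Set.Icc wstar 1)
      measurableSet_Icc
      (hlow.and (hatom.ae_le_one (hT.measurable_weight 1 le_rfl)))
    filter_upwards [this] with ω hω _ using hω
  · exact .of_forall fun ω h => absurd h hi

theorem iIndepFun_weight (hT : IsWeightedRecursiveTree P W par) {ι : Type*} {ℓ : ι → ℕ}
    (hℓ : ∀ i, 1 ≤ ℓ i) (hinj : Function.Injective ℓ) : iIndepFun (fun i => W (ℓ i)) P := by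
  have h := hT.indep_weight.precomp (g := fun i => ℓ i - 1) fun a b hab => hinj (by
    have := hℓ a; have := hℓ b; simp only at hab; omega)
  have he : (fun i => W (ℓ i)) = fun i => W (ℓ i - 1 + 1) := by
    funext i; rw [Nat.sub_add_cancel (hℓ i)]
  rw [he]; exact h

/-- Hoeffding's inequality for variables in [0, 1], variance proxy 1/4, applied to the centred
weights and to their negatives. -/
theorem measureReal_sum_ge_le [IsProbabilityMeasure P] (hT : IsWeightedRecursiveTree P W par)
    (hW : ∀ᵐ ω ∂P, ∀ i, 1 ≤ i → 0 ≤ W i ω ∧ W i ω ≤ 1) (j : ℕ) {r : ℝ} (hr : 0 ≤ r) :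
    P.real {ω | r * j ≤ |∑ l ∈ Finset.Icc 1 j, W l ω - (∫ ω, W 1 ω ∂P) * j|}
      ≤ 2 * Real.exp (-2 * r ^ 2 * j) := by
  set μ := ∫ ω, W 1 ω ∂P with hμ
  have hsub : ∀ i, HasSubgaussianMGF (fun ω => W (i + 1) ω - μ) ((1 / 2) ^ 2) P := by
    intro i
    have h := hasSubgaussianMGF_of_mem_Icc (X := W (i + 1)) (μ := P) (a := 0) (b := 1)
      (hT.measurable_weight (i + 1) (by omega)).aemeasurable
      (by filter_upwards [hW] with ω hω using hω (i + 1) (by omega))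
    rw [(hT.identDistrib_weight (i + 1) (by omega)).integral_eq] at h
    simpa using h
  have hind : iIndepFun (fun i ω => W (i + 1) ω - μ) P :=
    hT.indep_weight.comp (fun _ x => x - μ) fun _ => measurable_id.sub_const μ
  have hind' : iIndepFun (fun i ω => -(W (i + 1) ω - μ)) P :=
    hT.indep_weight.comp (fun _ x => -(x - μ)) fun _ => (measurable_id.sub_const μ).neg
  have hrj : 0 ≤ r * j := by positivity
  have hexp : Real.exp (-(r * j) ^ 2 / (2 * j * (((1 / 2) ^ 2 : NNReal) : ℝ)))
      = Real.exp (-2 * r ^ 2 * j) := by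
    congr 1
    rcases Nat.eq_zero_or_pos j with rfl | hj
    · simp
    · have : (0 : ℝ) < j := by exact_mod_cast hj
      push_cast; field_simp
  have h1 := HasSubgaussianMGF.measure_sum_range_ge_le_of_iIndepFun hind (n := j)
    (fun i _ => hsub i) hrj
  have h2 := HasSubgaussianMGF.measure_sum_range_ge_le_of_iIndepFun hind' (n := j)
    (fun i _ => (hsub i).neg) hrj
  rw [hexp] at h1 h2
  have hsum : ∀ ω, ∑ l ∈ Finset.Icc 1 j, W l ω - μ * j
      = ∑ i ∈ Finset.range j, (W (i + 1) ω - μ) := by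
    intro ω
    rw [Finset.sum_sub_distrib, Finset.sum_const, Finset.card_range, nsmul_eq_mul, mul_comm,
      Finset.range_eq_Ico, Finset.sum_Ico_add' (fun l => W l ω) 0 j 1]
    rfl
  have hsubset : {ω | r * j ≤ |∑ l ∈ Finset.Icc 1 j, W l ω - μ * j|}
      ⊆ {ω | r * j ≤ ∑ i ∈ Finset.range j, (W (i + 1) ω - μ)}
        ∪ {ω | r * j ≤ ∑ i ∈ Finset.range j, -(W (i + 1) ω - μ)} := by
    intro ω hω
    have hω' : r * j ≤ |∑ l ∈ Finset.Icc 1 j, W l ω - μ * j| := hω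
    rw [hsum, le_abs] at hω'
    rcases hω' with h | h
    · exact Or.inl h
    · refine Or.inr ?_
      change r * j ≤ ∑ i ∈ Finset.range j, -(W (i + 1) ω - μ)
      rwa [Finset.sum_neg_distrib]
  refine (measureReal_mono hsubset).trans ((measureReal_union_le _ _).trans ?_)
  linarith

/-- Union bound over at most `n` values of j, each term being largest at j = N. -/
theorem measureReal_compl_regularEvent_le [IsProbabilityMeasure P]
    (hT : IsWeightedRecursiveTree P W par)
    (hW : ∀ᵐ ω ∂P, ∀ i, 1 ≤ i → 0 ≤ W i ω ∧ W i ω ≤ 1) (N n : ℕ) {r : ℝ} (hr : 0 ≤ r) :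
    P.real (regularEvent W (∫ ω, W 1 ω ∂P) r N n)ᶜ
      ≤ n * (2 * Real.exp (-2 * r ^ 2 * N)) := by
  have hsub : (regularEvent W (∫ ω, W 1 ω ∂P) r N n)ᶜ ⊆ ⋃ j ∈ Finset.Ico N n,
      {ω | r * j ≤ |∑ l ∈ Finset.Icc 1 j, W l ω - (∫ ω, W 1 ω ∂P) * j|} := by
    intro ω hω
    simpa [regularEvent, and_assoc] using hω
  refine (measureReal_mono hsub (measure_ne_top _ _)).trans ((measureReal_biUnion_finset_le _ _).trans ?_)
  have h1 : ∀ j ∈ Finset.Ico N n,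
      P.real {ω | r * j ≤ |∑ l ∈ Finset.Icc 1 j, W l ω - (∫ ω, W 1 ω ∂P) * j|}
        ≤ 2 * Real.exp (-2 * r ^ 2 * N) := by
    intro j hj
    refine (hT.measureReal_sum_ge_le hW j hr).trans ?_
    have : (N : ℝ) ≤ j := by exact_mod_cast (Finset.mem_Ico.1 hj).1
    have h2 := mul_le_mul_of_nonneg_left this (sq_nonneg r)
    have : Real.exp (-2 * r ^ 2 * j) ≤ Real.exp (-2 * r ^ 2 * N) :=
      Real.exp_le_exp.2 (by linarith)
    linarith
  refine (Finset.sum_le_card_nsmul _ _ _ h1).trans ?_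
  rw [nsmul_eq_mul]
  refine mul_le_mul_of_nonneg_right ?_ (by positivity)
  rw [Nat.card_Ico]
  exact_mod_cast Nat.sub_le n N

variable {μ r α β : ℝ} {N n : ℕ}

/-- Upper bound for the probability that given distinct vertices have large in-degrees. -/
theorem measureReal_degreeEvent_le [IsProbabilityMeasure P] (hT : IsWeightedRecursiveTree P W par)
    (hws : 0 < wstar)
    (hW : ∀ᵐ ω ∂P, ∀ i, 1 ≤ i → wstar ≤ W i ω ∧ W i ω ≤ 1)
    (hβ0 : 0 < β) (hN : 1 ≤ N) (hNn : N ≤ n) (hβ : β⁻¹ + (N : ℝ)⁻¹ ≤ μ - r) {z : ℝ} (hz : 1 ≤ z)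
    {ι : Type*} [Fintype ι] [DecidableEq ι] {ℓ : ι → ℕ} (hℓ : ∀ i, 1 ≤ ℓ i) (hℓn : ∀ i, ℓ i ≤ n)
    (hinj : Function.Injective ℓ) (d : ι → ℕ) :
    P.real (degreeEvent par n ℓ d) ≤ ∏ i, (if ℓ i ≤ N then
        (z ^ d i)⁻¹ * Real.exp ((z - 1) * ((1 + Real.log N) / wstar + β * (1 + Real.log n)))
      else ∫ ω, poissonTail (d i) (W 1 ω * (β * Real.log (n / ((ℓ i - 1 : ℕ) : ℝ)))) ∂P)
      + P.real (regularEvent W μ r N n)ᶜ := by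
  classical
  set G := regularEvent W μ r N n with hG
  have hGm' := measurableSet_regularEvent W μ r N n
  have hGm : MeasurableSet G := hT.weightSigma_le _ hGm'
  have hEm : MeasurableSet (degreeEvent par n ℓ d) :=
    measurableSet_degreeEvent (fun j hj => hT.measurable_par j hj.1) ℓ d
  have h1 : P.real (degreeEvent par n ℓ d) ≤ P.real (G ∩ degreeEvent par n ℓ d) + P.real Gᶜ := by
    rw [Set.inter_comm]
    exact measureReal_le_inter_add_compl P _ G
  refine h1.trans (add_le_add ?_ le_rfl)
  set F : ι → ℝ → ℝ := fun i x => if ℓ i ≤ N then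
        (z ^ d i)⁻¹ * Real.exp ((z - 1) * ((1 + Real.log N) / wstar + β * (1 + Real.log n)))
      else poissonTail (d i) (x * (β * Real.log (n / ((ℓ i - 1 : ℕ) : ℝ)))) with hF
  have hFm : ∀ i, Measurable (F i) := fun i => by
    simp only [hF]
    split_ifs
    · exact measurable_const
    · exact ((continuous_poissonTail _).comp (continuous_id.mul continuous_const)).measurable
  -- The regular event depends on the weights only, so its indicator is an admissible test function.
  set Gi : Ω → ℝ := G.indicator fun _ => 1 with hGi
  have hGi_meas : Measurable[weightSigma W] Gi := measurable_const.indicator hGm'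
  have hGi01 : ∀ ω, 0 ≤ Gi ω ∧ Gi ω ≤ 1 := fun ω => by
    simp only [hGi, Set.indicator_apply]; split_ifs <;> norm_num
  have h2 : P.real (G ∩ degreeEvent par n ℓ d)
      = ∫ ω, Gi ω * jointTail (attachProb (fun l => W l ω) ℓ) n d ∂P := by
    rw [← hT.integral_mul_indicator_degreeEvent hℓ hinj n d hGi_meas (C := 1)
      (.of_forall fun ω => by
        rw [Real.norm_eq_abs, abs_of_nonneg (hGi01 ω).1]; exact (hGi01 ω).2)]
    have : ∀ ω, Gi ω * (degreeEvent par n ℓ d).indicator (fun _ => (1 : ℝ)) ω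
        = (G ∩ degreeEvent par n ℓ d).indicator (fun _ => (1 : ℝ)) ω := fun ω => by
      simp only [hGi, Set.indicator_apply, Set.mem_inter_iff]; split_ifs <;> simp_all
    simp only [this]
    rw [integral_indicator_const _ (hGm.inter hEm)]; simp
  -- Each factor of the conditional bound involves the weight of its own label only, so the
  -- expectation factorises by independence.
  have hprod : ∫ ω, ∏ i, F i (W (ℓ i) ω) ∂P = ∏ i, ∫ ω, F i (W 1 ω) ∂P := by
    rw [iIndepFun.integral_fun_prod_comp (hT.iIndepFun_weight hℓ hinj)
      (fun i => (hT.measurable_weight _ (hℓ i)).aemeasurable)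
      (fun i => (hFm i).aestronglyMeasurable)]
    exact Finset.prod_congr rfl fun i _ =>
      ((hT.identDistrib_weight _ (hℓ i)).comp (hFm i)).integral_eq
  have hfin : ∏ i, ∫ ω, F i (W 1 ω) ∂P = ∏ i, (if ℓ i ≤ N then
        (z ^ d i)⁻¹ * Real.exp ((z - 1) * ((1 + Real.log N) / wstar + β * (1 + Real.log n)))
      else ∫ ω, poissonTail (d i) (W 1 ω * (β * Real.log (n / ((ℓ i - 1 : ℕ) : ℝ)))) ∂P) := by
    refine Finset.prod_congr rfl fun i _ => ?_
    simp only [hF]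
    split_ifs <;> simp
  rw [← hfin, ← hprod, h2]
  have hlog : ∀ i, ¬ ℓ i ≤ N → 0 ≤ Real.log (n / ((ℓ i - 1 : ℕ) : ℝ)) := fun i hi => by
    refine Real.log_nonneg ((one_le_div (by exact_mod_cast (by omega : 0 < ℓ i - 1))).2 ?_)
    exact_mod_cast (by have := hℓn i; omega : ℓ i - 1 ≤ n)
  have hFnn : ∀ᵐ ω ∂P, ∀ i, 0 ≤ F i (W (ℓ i) ω) := by
    filter_upwards [hW] with ω hω i
    simp only [hF]
    split_ifs with h
    · positivity
    · exact poissonTail_nonneg _ (mul_nonneg (hws.le.trans (hω _ (hℓ i)).1)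
        (mul_nonneg hβ0.le (hlog i h)))
  have hFbd : ∀ i, ∃ B, ∀ᵐ ω ∂P, ‖F i (W (ℓ i) ω)‖ ≤ B := by
    intro i
    refine ⟨max ((z ^ d i)⁻¹ * Real.exp ((z - 1) *
      ((1 + Real.log N) / wstar + β * (1 + Real.log n)))) 1, ?_⟩
    filter_upwards [hW, hFnn] with ω hω h0
    rw [Real.norm_eq_abs, abs_of_nonneg (h0 i)]
    simp only [hF]
    split_ifs with h
    · exact le_max_left _ _
    · exact (poissonTail_le_one _ (mul_nonneg (hws.le.trans (hω _ (hℓ i)).1)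
        (mul_nonneg hβ0.le (hlog i h)))).trans (le_max_right _ _)
  choose B hB using hFbd
  have hint : Integrable (fun ω => ∏ i, F i (W (ℓ i) ω)) P := by
    refine Integrable.of_bound (C := ∏ i, B i) (Finset.measurable_fun_prod _ fun i _ =>
      (hFm i).comp (hT.measurable_weight _ (hℓ i))).aestronglyMeasurable ?_
    have := (ae_all_iff (ι := ι)).2 hB
    filter_upwards [this] with ω hω
    rw [norm_prod]
    exact Finset.prod_le_prod (fun i _ => norm_nonneg _) fun i _ => hω i
  refine integral_mono_of_nonneg ?_ hint ?_
  · filter_upwards [hT.ae_weight_pos] with ω hω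
    exact mul_nonneg (hGi01 ω).1 (jointTail_nonneg (attachProb_nonneg hω hℓ)
      (sum_attachProb_le_one hω hℓ hinj) n d)
  · filter_upwards [hW, hFnn] with ω hω h0
    by_cases h : ω ∈ G
    · simp only [hGi, Set.indicator_of_mem h, one_mul]
      exact jointTail_attachProb_le hws hβ0 (fun i hi => (hω i hi).2) (fun i hi => (hω i hi).1)
        (fun j hj hjn => sum_weight_ge_of_regular hN hβ hj (h j (Finset.mem_Ico.2 ⟨hj, hjn⟩)))
        hN hNn hz hℓ hℓn hinj d
    · simp only [hGi, Set.indicator_of_notMem h, zero_mul]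
      exact Finset.prod_nonneg fun i _ => h0 i

/-- Lower bound for the probability that given distinct late vertices have large in-degrees. -/
theorem le_measureReal_degreeEvent [IsProbabilityMeasure P] (hT : IsWeightedRecursiveTree P W par)
    (hW1 : ∀ᵐ ω ∂P, ∀ i, 1 ≤ i → W i ω ≤ 1) (hα0 : 0 < α)
    (hβ0 : 0 < β) (hN : 1 ≤ N) (hα : μ + r ≤ α⁻¹) (hβ : β⁻¹ + (N : ℝ)⁻¹ ≤ μ - r)
    {ι : Type*} [Fintype ι] [DecidableEq ι] {ℓ : ι → ℕ} (hℓ : ∀ i, N < ℓ i) (hℓn : ∀ i, ℓ i ≤ n)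
    (hinj : Function.Injective ℓ) (d : ι → ℕ) :
    (P.real {ω | W 1 ω = 1} ^ Fintype.card ι - P.real (regularEvent W μ r N n)ᶜ)
        * ∏ i, poissonTail (d i) (α * Real.log (n / ℓ i))
      - 3 ^ Fintype.card ι * ((Fintype.card ι * β) ^ 2 * (2 / N))
        * ∏ i, poissonTail (d i - 2) (β * Real.log (n / ((ℓ i - 1 : ℕ) : ℝ)))
      ≤ P.real (degreeEvent par n ℓ d) := by
  classical
  have hℓ' : ∀ i, 1 ≤ ℓ i := fun i => hN.trans (hℓ i).le
  set G := regularEvent W μ r N n with hG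
  have hGm' := measurableSet_regularEvent W μ r N n
  have hGm : MeasurableSet G := hT.weightSigma_le _ hGm'
  have hEm : MeasurableSet (degreeEvent par n ℓ d) :=
    measurableSet_degreeEvent (fun j hj => hT.measurable_par j hj.1) ℓ d
  -- All labelled vertices have weight one: by independence an event of probability P(W 1 = 1) to
  -- the number of labels.
  set O : Set Ω := ⋂ i ∈ Finset.univ, W (ℓ i) ⁻¹' {1} with hO
  have hOm' : MeasurableSet[weightSigma W] O := Finset.measurableSet_biInter _ fun i _ =>
    measurable_weightSigma W (hℓ' i) (measurableSet_singleton 1)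
  have hOm : MeasurableSet O := hT.weightSigma_le _ hOm'
  have hPO : P.real O = P.real {ω | W 1 ω = 1} ^ Fintype.card ι := by
    have h := (hT.iIndepFun_weight hℓ' hinj).measure_inter_preimage_eq_mul Finset.univ
      (sets := fun _ => {1}) fun i _ => measurableSet_singleton 1
    have h3 : ∀ i, P (W (ℓ i) ⁻¹' {1}) = P {ω | W 1 ω = 1} := fun i =>
      (hT.identDistrib_weight _ (hℓ' i)).measure_mem_eq (measurableSet_singleton 1)
    simp only [h3, Finset.prod_const, Finset.card_univ] at h
    rw [measureReal_def, measureReal_def, h, ENNReal.toReal_pow]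
  set H := ∏ i, poissonTail (d i) (α * Real.log (n / ℓ i)) with hH
  set R := 3 ^ Fintype.card ι * ((Fintype.card ι * β) ^ 2 * (2 / N))
        * ∏ i, poissonTail (d i - 2) (β * Real.log (n / ((ℓ i - 1 : ℕ) : ℝ))) with hR
  have hlog : ∀ i, 0 ≤ Real.log ((n : ℝ) / ℓ i) := fun i =>
    Real.log_nonneg ((one_le_div (by exact_mod_cast hℓ' i)).2 (by exact_mod_cast hℓn i))
  have hlog' : ∀ i, 0 ≤ Real.log (n / ((ℓ i - 1 : ℕ) : ℝ)) := fun i => by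
    have := hℓ i
    refine Real.log_nonneg ((one_le_div (by exact_mod_cast (by omega : 0 < ℓ i - 1))).2 ?_)
    exact_mod_cast (by have := hℓn i; omega : ℓ i - 1 ≤ n)
  have hH0 : 0 ≤ H := Finset.prod_nonneg fun i _ =>
    poissonTail_nonneg _ (mul_nonneg hα0.le (hlog i))
  have hR0 : 0 ≤ R := mul_nonneg (by positivity) (Finset.prod_nonneg fun i _ =>
    poissonTail_nonneg _ (mul_nonneg hβ0.le (hlog' i)))
  -- `O` and `G` are not independent; subtracting the small probability of irregular weights
  -- suffices.
  have hPOG : P.real O - P.real Gᶜ ≤ P.real (O ∩ G) := by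
    have := measureReal_le_inter_add_compl P O G
    linarith
  set Gi : Ω → ℝ := (O ∩ G).indicator fun _ => 1 with hGi
  have hGi_meas : Measurable[weightSigma W] Gi := measurable_const.indicator (hOm'.inter hGm')
  have hGi01 : ∀ ω, 0 ≤ Gi ω ∧ Gi ω ≤ 1 := fun ω => by
    simp only [hGi, Set.indicator_apply]; split_ifs <;> norm_num
  have h2 : P.real (O ∩ G ∩ degreeEvent par n ℓ d)
      = ∫ ω, Gi ω * jointTail (attachProb (fun l => W l ω) ℓ) n d ∂P := by
    rw [← hT.integral_mul_indicator_degreeEvent hℓ' hinj n d hGi_meas (C := 1)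
      (.of_forall fun ω => by
        rw [Real.norm_eq_abs, abs_of_nonneg (hGi01 ω).1]; exact (hGi01 ω).2)]
    have : ∀ ω, Gi ω * (degreeEvent par n ℓ d).indicator (fun _ => (1 : ℝ)) ω
        = (O ∩ G ∩ degreeEvent par n ℓ d).indicator (fun _ => (1 : ℝ)) ω := fun ω => by
      simp only [hGi, Set.indicator_apply, Set.mem_inter_iff]; split_ifs <;> simp_all
    simp only [this]
    rw [integral_indicator_const _ ((hOm.inter hGm).inter hEm)]; simp
  have hJint : Integrable (fun ω => Gi ω * jointTail (attachProb (fun l => W l ω) ℓ) n d) P := by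
    refine Integrable.of_bound (C := 1) ((hGi_meas.mul (measurable_jointTail W hℓ' n d)).mono
      hT.weightSigma_le le_rfl).aestronglyMeasurable ?_
    filter_upwards [hT.ae_weight_pos] with ω hω
    have h0 := jointTail_nonneg (attachProb_nonneg hω hℓ') (sum_attachProb_le_one hω hℓ' hinj) n d
    have h1 := jointTail_le_one (attachProb_nonneg hω hℓ') (sum_attachProb_le_one hω hℓ' hinj) n d
    rw [Real.norm_eq_abs, abs_of_nonneg (mul_nonneg (hGi01 ω).1 h0)]
    exact mul_le_one₀ (hGi01 ω).2 h0 h1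
  calc _ ≤ P.real (O ∩ G) * H - R := by
        rw [← hPO]
        exact sub_le_sub_right (mul_le_mul_of_nonneg_right hPOG hH0) _
    _ ≤ P.real (O ∩ G) * (H - R) := by
        have : P.real (O ∩ G) * R ≤ 1 * R := mul_le_mul_of_nonneg_right measureReal_le_one hR0
        linarith
    _ = ∫ ω, Gi ω * (H - R) ∂P := by
        rw [integral_mul_const, hGi, integral_indicator_const _ (hOm.inter hGm)]; simp
    _ ≤ ∫ ω, Gi ω * jointTail (attachProb (fun l => W l ω) ℓ) n d ∂P := by
        refine integral_mono_ae ?_ hJint ?_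
        · exact ((integrable_const 1).indicator (hOm.inter hGm)).mul_const _
        · filter_upwards [hW1, hT.ae_weight_pos] with ω hω1 hω0
          by_cases h : ω ∈ O ∩ G
          · refine mul_le_mul_of_nonneg_left ?_ (hGi01 ω).1
            refine le_jointTail_attachProb hα0 hβ0 hω1 hω0
              (fun j hj hjn => sum_weight_ge_of_regular hN hβ hj
                (h.2 j (Finset.mem_Ico.2 ⟨hj, hjn⟩)))
              (fun j hj hjn => sum_weight_le_of_regular hα (h.2 j (Finset.mem_Ico.2 ⟨hj, hjn⟩)))
              hN hℓ hℓn hinj (fun i => ?_) d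
            have := h.1
            simp only [hO, Set.mem_iInter] at this
            exact this i (Finset.mem_univ i)
          · simp only [hGi, Set.indicator_of_notMem h, zero_mul, le_refl]
    _ = P.real (O ∩ G ∩ degreeEvent par n ℓ d) := h2.symm
    _ ≤ _ := measureReal_mono Set.inter_subset_right

end IsWeightedRecursiveTree

/-! ### Central limit theorem for the gamma law -/

/-- The gamma central limit theorem in terms of characteristic functions. -/
theorem tendsto_gamma_charFun (u : ℝ) :
    Tendsto (fun d : ℕ => Complex.exp (Complex.I * (u * √d))
      * (1 + Complex.I * (u / √d)) ^ (-(d : ℤ))) atTop (𝓝 (Complex.exp (-(u ^ 2 / 2)))) := by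
  have hsq : Tendsto (fun d : ℕ => √(d : ℝ)) atTop atTop :=
    Real.tendsto_sqrt_atTop.comp tendsto_natCast_atTop_atTop
  have hy : Tendsto (fun d : ℕ => u / √(d : ℝ)) atTop (𝓝 0) :=
    tendsto_const_nhds.div_atTop hsq
  have hyc : Tendsto (fun d : ℕ => Complex.I * ((u / √(d : ℝ) : ℝ) : ℂ)) atTop (𝓝 0) := by
    have := ((Complex.continuous_ofReal.tendsto 0).comp hy).const_mul Complex.I
    simpa using this
  have hne : ∀ y : ℝ, (1 : ℂ) + Complex.I * (y : ℂ) ≠ 0 := fun y h => by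
    have := congrArg Complex.re h
    simp at this
  -- With y = u/√d the expression is the d-th power of exp(iy)/(1 + iy) = 1 + g d. By third-order
  -- Taylor expansion d · g d → -u²/2, so the powers converge to the exponential.
  set g : ℕ → ℂ := fun d => (Complex.exp (Complex.I * ((u / √(d : ℝ) : ℝ) : ℂ)) - 1
    - Complex.I * ((u / √(d : ℝ) : ℝ) : ℂ)) / (1 + Complex.I * ((u / √(d : ℝ) : ℝ) : ℂ)) with hg
  have key : Tendsto (fun d : ℕ => (d : ℂ) * (Complex.exp (Complex.I * ((u / √(d : ℝ) : ℝ) : ℂ)) - 1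
      - Complex.I * ((u / √(d : ℝ) : ℝ) : ℂ))) atTop (𝓝 (-(u ^ 2 / 2))) := by
    have herr : Tendsto (fun d : ℕ => |u| ^ 2 * (|u / √(d : ℝ)| * Real.exp |u / √(d : ℝ)|)) atTop
        (𝓝 (|u| ^ 2 * (|(0 : ℝ)| * Real.exp |(0 : ℝ)|))) :=
      (hy.abs.mul (Real.continuous_exp.tendsto _ |>.comp hy.abs)).const_mul _
    simp only [abs_zero, zero_mul, mul_zero] at herr
    rw [tendsto_iff_norm_sub_tendsto_zero]
    refine squeeze_zero' (.of_forall fun _ => norm_nonneg _) ?_ herr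
    filter_upwards [eventually_gt_atTop 0] with d hd
    have hd0 : (0 : ℝ) < d := by exact_mod_cast hd
    set y : ℝ := u / √(d : ℝ) with hy'
    have hdy : (d : ℝ) * y ^ 2 = u ^ 2 := by
      rw [hy', div_pow, Real.sq_sqrt hd0.le]; field_simp
    have h := Complex.norm_exp_sub_sum_le_norm_mul_exp (Complex.I * (y : ℂ)) 3
    have hsum : ∑ m ∈ Finset.range 3, (Complex.I * (y : ℂ)) ^ m / (m.factorial : ℂ)
        = 1 + Complex.I * y - y ^ 2 / 2 := by
      simp only [Finset.sum_range_succ, Finset.sum_range_zero, Nat.factorial]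
      push_cast
      rw [pow_zero, pow_one, mul_pow Complex.I _ 2, Complex.I_sq]; ring
    rw [hsum] at h
    have hn : ‖Complex.I * (y : ℂ)‖ = |y| := by simp
    rw [hn] at h
    have hdyc : (d : ℂ) * (y : ℂ) ^ 2 = (u : ℂ) ^ 2 := by exact_mod_cast hdy
    have e1 : (d : ℂ) * (Complex.exp (Complex.I * (y : ℂ)) - 1 - Complex.I * (y : ℂ))
        - -((u : ℂ) ^ 2 / 2)
        = d * (Complex.exp (Complex.I * (y : ℂ)) - (1 + Complex.I * y - y ^ 2 / 2)) := by
      rw [← hdyc]; ring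
    rw [e1, norm_mul, Complex.norm_natCast]
    calc (d : ℝ) * ‖Complex.exp (Complex.I * (y : ℂ)) - (1 + Complex.I * y - y ^ 2 / 2)‖
        ≤ d * (|y| ^ 3 * Real.exp |y|) := mul_le_mul_of_nonneg_left h hd0.le
      _ = (d * |y| ^ 2) * (|y| * Real.exp |y|) := by ring
      _ = |u| ^ 2 * (|y| * Real.exp |y|) := by rw [sq_abs, hdy, sq_abs]
  have hdg : Tendsto (fun d : ℕ => (d : ℂ) * g d) atTop (𝓝 (-(u ^ 2 / 2))) := by
    have h1 : Tendsto (fun d : ℕ => (1 : ℂ) + Complex.I * ((u / √(d : ℝ) : ℝ) : ℂ)) atTop (𝓝 1) := by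
      simpa using hyc.const_add 1
    have := key.div h1 one_ne_zero
    simp only [div_one] at this
    refine this.congr fun d => ?_
    simp only [hg, Pi.div_apply]; ring
  have hlim := Complex.tendsto_one_add_pow_exp_of_tendsto hdg
  refine hlim.congr' ?_
  filter_upwards [eventually_gt_atTop 0] with d hd
  have hd0 : (0 : ℝ) < d := by exact_mod_cast hd
  have h1 : 1 + g d = Complex.exp (Complex.I * ((u / √(d : ℝ) : ℝ) : ℂ))
      / (1 + Complex.I * ((u / √(d : ℝ) : ℝ) : ℂ)) := by
    simp only [hg]
    have := hne (u / √(d : ℝ))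
    field_simp
    ring
  rw [h1, div_pow, ← Complex.exp_nat_mul, zpow_neg, zpow_natCast, div_eq_mul_inv]
  congr 2
  · have : (d : ℝ) * (u / √(d : ℝ)) = u * √(d : ℝ) := by
      have hs : √(d : ℝ) ≠ 0 := (Real.sqrt_pos.2 hd0).ne'
      field_simp
      rw [Real.sq_sqrt hd0.le, mul_comm]
    have h3 : (d : ℂ) * ((u / √(d : ℝ) : ℝ) : ℂ) = u * √(d : ℝ) := by exact_mod_cast this
    rw [mul_left_comm, h3]
  · push_cast; rfl

/-! ### Uniform labels as rounded exponential variables -/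

/-- For x > 0, ⌈n e^{-t}⌉ ≤ x means t ≥ log(n/x). Hence if T is standard exponential, ⌈n e^{-T}⌉ is
uniform on {1, …, n}. -/
theorem integral_exp_mul_indicator_ceil_le {n x : ℕ} (hn : 1 ≤ n) (hx : x ≤ n) :
    IntegrableOn (fun t : ℝ => if ⌈(n : ℝ) * Real.exp (-t)⌉₊ ≤ x then Real.exp (-t) else 0)
      (Set.Ioi 0) ∧
    ∫ t in Set.Ioi (0 : ℝ), (if ⌈(n : ℝ) * Real.exp (-t)⌉₊ ≤ x then Real.exp (-t) else 0)
      = (x : ℝ) / n := by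
  have hn0 : (0 : ℝ) < n := by exact_mod_cast hn
  rcases Nat.eq_zero_or_pos x with rfl | hx0
  · have h : ∀ t : ℝ, (if ⌈(n : ℝ) * Real.exp (-t)⌉₊ ≤ 0 then Real.exp (-t) else 0) = 0 := by
      intro t
      refine if_neg ?_
      rw [Nat.ceil_le]
      have := mul_pos hn0 (Real.exp_pos (-t))
      push_cast; linarith
    simp only [h]
    simp
  · have hx1 : (0 : ℝ) < x := by exact_mod_cast hx0
    have hlog : 0 ≤ Real.log ((n : ℝ) / x) :=
      Real.log_nonneg ((one_le_div hx1).2 (by exact_mod_cast hx))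
    have hiff : ∀ t : ℝ, ⌈(n : ℝ) * Real.exp (-t)⌉₊ ≤ x ↔ Real.log ((n : ℝ) / x) ≤ t := by
      intro t
      rw [Nat.ceil_le, Real.log_le_iff_le_exp (by positivity), div_le_iff₀ hx1, Real.exp_neg,
        ← div_eq_mul_inv, div_le_iff₀ (Real.exp_pos t), mul_comm]
    have h1 : ∀ t : ℝ, (if ⌈(n : ℝ) * Real.exp (-t)⌉₊ ≤ x then Real.exp (-t) else 0)
        = (Set.Ici (Real.log ((n : ℝ) / x))).indicator (fun t => Real.exp (-t)) t := by
      intro t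
      simp only [hiff, Set.indicator_apply, Set.mem_Ici]
    have hI : IntegrableOn (fun t : ℝ => Real.exp (-t)) (Set.Ioi 0) := by
      simpa using exp_neg_integrableOn_Ioi 0 one_pos
    simp only [h1]
    refine ⟨hI.indicator measurableSet_Ici, ?_⟩
    rw [setIntegral_indicator measurableSet_Ici]
    have h2 : (Set.Ioi 0 ∩ Set.Ici (Real.log ((n : ℝ) / x)) : Set ℝ)
        =ᵐ[volume] Set.Ioi (Real.log ((n : ℝ) / x)) := by
      have h3 : (Set.Ioi (0 : ℝ) ∩ Set.Ici (Real.log ((n : ℝ) / x)) : Set ℝ)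
          =ᵐ[volume] (Set.Ioi (0 : ℝ) ∩ Set.Ioi (Real.log ((n : ℝ) / x)) : Set ℝ) :=
        (ae_eq_refl _).inter Ioi_ae_eq_Ici.symm
      rwa [Set.Ioi_inter_Ioi, sup_eq_right.2 hlog] at h3
    rw [setIntegral_congr_set h2, integral_exp_neg_Ioi, Real.exp_neg, Real.exp_log (by positivity),
      inv_div]

/-- Averages over `{1, …, n}` as integrals against the standard exponential distribution. -/
theorem integral_exp_smul_ceil {E : Type*} [NormedAddCommGroup E] [NormedSpace ℝ E]
    [CompleteSpace E] {n : ℕ} (hn : 1 ≤ n) (F : ℕ → E) :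
    IntegrableOn (fun t : ℝ => Real.exp (-t) • F ⌈(n : ℝ) * Real.exp (-t)⌉₊) (Set.Ioi 0) ∧
    ∫ t in Set.Ioi (0 : ℝ), Real.exp (-t) • F ⌈(n : ℝ) * Real.exp (-t)⌉₊
      = (n : ℝ)⁻¹ • ∑ x ∈ Finset.Icc 1 n, F x := by
  have hn0 : (0 : ℝ) < n := by exact_mod_cast hn
  set I : ℕ → ℝ → ℝ := fun x t =>
    if ⌈(n : ℝ) * Real.exp (-t)⌉₊ ≤ x then Real.exp (-t) else 0 with hI
  have hIx := fun x hx => integral_exp_mul_indicator_ceil_le (x := x) hn hx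
  have hpt : Set.EqOn (fun t : ℝ => Real.exp (-t) • F ⌈(n : ℝ) * Real.exp (-t)⌉₊)
      (fun t => ∑ x ∈ Finset.Icc 1 n, (I x t - I (x - 1) t) • F x) (Set.Ioi 0) := by
    intro t ht
    have ht0 : (0 : ℝ) < t := ht
    have hL1 : 1 ≤ ⌈(n : ℝ) * Real.exp (-t)⌉₊ :=
      Nat.one_le_ceil_iff.2 (mul_pos hn0 (Real.exp_pos _))
    have hLn : ⌈(n : ℝ) * Real.exp (-t)⌉₊ ≤ n := by
      rw [Nat.ceil_le]
      exact mul_le_of_le_one_right hn0.le (Real.exp_le_one_iff.2 (by linarith))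
    simp only [hI]
    set L := ⌈(n : ℝ) * Real.exp (-t)⌉₊
    rw [Finset.sum_eq_single L]
    · rw [if_pos le_rfl, if_neg (by omega), sub_zero]
    · intro x hx hxL
      have := (Finset.mem_Icc.1 hx).1
      rcases lt_or_gt_of_ne hxL with h | h
      · rw [if_neg (by omega), if_neg (by omega), sub_zero, zero_smul]
      · rw [if_pos (by omega), if_pos (by omega), sub_self, zero_smul]
    · intro h; exact absurd (Finset.mem_Icc.2 ⟨hL1, hLn⟩) h
  have hint : ∀ x ∈ Finset.Icc 1 n,
      IntegrableOn (fun t => (I x t - I (x - 1) t) • F x) (Set.Ioi 0) := by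
    intro x hx
    have hx2 := (Finset.mem_Icc.1 hx).2
    exact ((hIx x hx2).1.sub (hIx (x - 1) (by omega)).1).smul_const (F x)
  refine ⟨(integrableOn_congr_fun hpt measurableSet_Ioi).2
    (integrable_finsetSum _ fun x hx => hint x hx), ?_⟩
  rw [setIntegral_congr_fun measurableSet_Ioi hpt, integral_finsetSum _ fun x hx => hint x hx,
    Finset.smul_sum]
  refine Finset.sum_congr rfl fun x hx => ?_
  obtain ⟨hx1, hx2⟩ := Finset.mem_Icc.1 hx
  rw [integral_smul_const, integral_sub (hIx x hx2).1 (hIx (x - 1) (by omega)).1,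
    (hIx x hx2).2, (hIx (x - 1) (by omega)).2, ← sub_div]
  congr 1
  rw [Nat.cast_sub hx1]
  field_simp
  push_cast; ring

/-- Rounding up moves log(n/x) below t. As Poisson tails increase in the mean, averages over labels
are then bounded by the exact integral without any error term. -/
theorem log_div_ceil_le {n : ℕ} (hn : 1 ≤ n) (t : ℝ) :
    Real.log (n / (⌈(n : ℝ) * Real.exp (-t)⌉₊ : ℝ)) ≤ t := by
  have hn0 : (0 : ℝ) < n := by exact_mod_cast hn
  have hpos := mul_pos hn0 (Real.exp_pos (-t))
  have h := Nat.le_ceil ((n : ℝ) * Real.exp (-t))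
  rw [Real.log_le_iff_le_exp (div_pos hn0 (hpos.trans_le h)), div_le_iff₀ (hpos.trans_le h)]
  calc (n : ℝ) = Real.exp t * (n * Real.exp (-t)) := by
        rw [mul_left_comm, ← Real.exp_add, add_neg_cancel, Real.exp_zero, mul_one]
    _ ≤ _ := mul_le_mul_of_nonneg_left h (Real.exp_pos t).le

theorem log_div_nonneg_of_mem {n x : ℕ} (hx : x ∈ Finset.Icc 1 n) : 0 ≤ Real.log ((n : ℝ) / x) := by
  obtain ⟨h1, h2⟩ := Finset.mem_Icc.1 hx
  exact Real.log_nonneg ((one_le_div (by exact_mod_cast h1)).2 (by exact_mod_cast h2))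

theorem ceil_mul_exp_mem {n : ℕ} (hn : 1 ≤ n) {t : ℝ} (ht : 0 < t) :
    ⌈(n : ℝ) * Real.exp (-t)⌉₊ ∈ Finset.Icc 1 n := by
  have hn0 : (0 : ℝ) < n := by exact_mod_cast hn
  refine Finset.mem_Icc.2 ⟨Nat.one_le_ceil_iff.2 (mul_pos hn0 (Real.exp_pos _)), ?_⟩
  rw [Nat.ceil_le]
  exact mul_le_of_le_one_right hn0.le (Real.exp_le_one_iff.2 (by linarith))

/-- The average of the Poisson tails is at most the corresponding Laplace transform. -/
theorem sum_poissonTail_le (d : ℕ) {w : ℝ} (hw : 0 ≤ w) {n : ℕ} (hn : 1 ≤ n) :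
    (n : ℝ)⁻¹ * ∑ x ∈ Finset.Icc 1 n, poissonTail d (w * Real.log (n / x)) ≤ (w / (w + 1)) ^ d := by
  obtain ⟨h1, h2⟩ := integral_exp_smul_ceil hn fun x => poissonTail d (w * Real.log (n / x))
  rw [smul_eq_mul] at h2
  rw [← h2, ← integral_exp_mul_poissonTail d hw]
  refine setIntegral_mono_on h1 (integrableOn_exp_mul_poissonTail d hw) measurableSet_Ioi
    fun t ht => ?_
  refine mul_le_mul_of_nonneg_left ?_ (Real.exp_pos _).le
  exact poissonTail_mono d (mul_nonneg hw (log_div_nonneg_of_mem (ceil_mul_exp_mem hn ht)))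
    (mul_le_mul_of_nonneg_left (log_div_ceil_le hn t) hw)

/-- The average of the Poisson tails over the labels exceeding `N ≥ 1`, shifted by one. -/
theorem sum_poissonTail_pred_le (d : ℕ) {w : ℝ} (hw : 0 ≤ w) {N n : ℕ} (hN : 1 ≤ N) (hn : 1 ≤ n) :
    (n : ℝ)⁻¹ * ∑ x ∈ Finset.Ioc N n, poissonTail d (w * Real.log (n / ((x - 1 : ℕ) : ℝ)))
      ≤ (w / (w + 1)) ^ d := by
  refine le_trans (mul_le_mul_of_nonneg_left ?_ (by positivity)) (sum_poissonTail_le d hw hn)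
  rw [← Finset.sum_image (f := fun y : ℕ => poissonTail d (w * Real.log (n / (y : ℝ))))
    (g := fun x => x - 1) (fun a ha b hb hab => by
      have := (Finset.mem_Ioc.1 ha).1; have := (Finset.mem_Ioc.1 hb).1
      simp only at hab; omega)]
  refine Finset.sum_le_sum_of_subset_of_nonneg ?_ fun x hx _ =>
    poissonTail_nonneg d (mul_nonneg hw (log_div_nonneg_of_mem hx))
  intro y hy
  obtain ⟨x, hx, rfl⟩ := Finset.mem_image.1 hy
  have := Finset.mem_Ioc.1 hx
  exact Finset.mem_Icc.2 (by omega)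

/-- The standardised average of the Poisson tails over the labels exceeding `N` is close to the
characteristic function of the sum of a gamma and an exponential random variable. -/
theorem norm_sum_poissonTail_sub_le {μ θ α z q s u : ℝ} (hμ : 0 < μ) (hθ : θ = 1 + μ) (hα0 : 0 < α)
    (hα : α ≤ μ⁻¹) (hz : 1 ≤ z) (hzθ : z < θ) (hq : 0 < q) {N n : ℕ} (hN : 1 ≤ N) (hNn : N ≤ n)
    (d : ℕ) :
    ‖(n : ℝ)⁻¹ • ∑ x ∈ Finset.Icc 1 n,
        (((if N < x then θ ^ d * poissonTail d (α * Real.log (n / x)) else 0 : ℝ)) : ℂ)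
          * Complex.exp (Complex.I * ((u * ((Real.log x - Real.log n + s) / q) : ℝ) : ℂ))
      - Complex.exp (Complex.I * ((u * (s / q) : ℝ) : ℂ)) * (1 + Complex.I * ((u / q : ℝ) : ℂ))⁻¹
        * (1 + Complex.I * ((μ / θ * (u / q) : ℝ) : ℂ)) ^ (-(d : ℤ))‖
      ≤ |u| / q * (N : ℝ)⁻¹ + θ * ((μ⁻¹ - α) * Real.log n + α * (N : ℝ)⁻¹)
        + (θ / z) ^ d * (Real.exp (-(1 - (z - 1) / μ) * Real.log (n / N)) / (1 - (z - 1) / μ)) := by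
  have hn : 1 ≤ n := hN.trans hNn
  have hn0 : (0 : ℝ) < n := by exact_mod_cast hn
  have hN0 : (0 : ℝ) < N := by exact_mod_cast hN
  have hθ0 : 0 < θ := by linarith
  have hz0 : 0 < z := by linarith
  have hw0 : 0 ≤ μ⁻¹ := by positivity
  have hwθ : μ⁻¹ / (μ⁻¹ + 1) = θ⁻¹ := by rw [hθ]; field_simp
  -- The decay rate left when e^{-t} competes with the Chernoff factor exp((z - 1)t/μ); it is
  -- positive because z < θ.
  set κ := 1 - (z - 1) / μ with hκ
  have hκ0 : 0 < κ := by
    rw [hκ, sub_pos, div_lt_one hμ]; linarith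
  -- Bounds the difference of the Poisson means t/μ and α log(n/L) at late labels L, using t ≤ log n
  -- and t - log(n/L) ≤ 1/N.
  set η := (μ⁻¹ - α) * Real.log n + α * (N : ℝ)⁻¹ with hη
  have hη0 : 0 ≤ η := add_nonneg (mul_nonneg (by linarith)
    (Real.log_nonneg (by exact_mod_cast hn))) (by positivity)
  set Φ : ℝ → ℂ := fun y => Complex.exp (Complex.I * ((u * ((y + s) / q) : ℝ) : ℂ)) with hΦ
  have hΦ1 : ∀ y, ‖Φ y‖ = 1 := fun y => by
    simp only [hΦ]; rw [mul_comm]; exact Complex.norm_exp_ofReal_mul_I _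
  have hΦlip : ∀ x y, ‖Φ x - Φ y‖ ≤ |u| / q * |x - y| := fun x y => by
    have h1 : Φ x - Φ y = Φ y * (Complex.exp (Complex.I * ((u * ((x - y) / q) : ℝ) : ℂ)) - 1) := by
      simp only [hΦ]
      rw [mul_sub, mul_one, ← Complex.exp_add]
      congr 2
      push_cast
      ring
    rw [h1, norm_mul, hΦ1, one_mul]
    refine (Real.norm_exp_I_mul_ofReal_sub_one_le).trans (le_of_eq ?_)
    rw [Real.norm_eq_abs, abs_mul, abs_div, abs_of_pos hq]; ring
  set a : ℕ → ℝ := fun x => if N < x then θ ^ d * poissonTail d (α * Real.log (n / x)) else 0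
    with ha
  set b : ℝ → ℝ := fun t => θ ^ d * poissonTail d (μ⁻¹ * t) with hb
  obtain ⟨hI1, hE1⟩ := integral_exp_smul_ceil hn fun x =>
    ((a x : ℝ) : ℂ) * Φ (Real.log x - Real.log n)
  rw [← hE1]
  have hre : 0 < (1 + Complex.I * ((u / q : ℝ) : ℂ)).re := by simp
  have hfun : ∀ t : ℝ, Real.exp (-t) • (((b t : ℝ) : ℂ) * Φ (-t))
      = (θ ^ d * Complex.exp (Complex.I * ((u * (s / q) : ℝ) : ℂ)))
        * (Complex.exp (-(1 + Complex.I * ((u / q : ℝ) : ℂ)) * t)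
          * (poissonTail d (μ⁻¹ * t) : ℂ)) := by
    intro t
    simp only [hb, hΦ, Complex.real_smul]
    push_cast
    have : Complex.exp (-(t : ℂ)) * Complex.exp (Complex.I * (u * ((-t + s) / q)))
        = Complex.exp (Complex.I * (u * (s / q)))
          * Complex.exp (-(1 + Complex.I * (u / q)) * t) := by
      rw [← Complex.exp_add, ← Complex.exp_add]; congr 1; ring
    linear_combination ((θ : ℂ) ^ d * (poissonTail d (μ⁻¹ * t) : ℂ)) * this
  have hI2 : IntegrableOn (fun t : ℝ => Real.exp (-t) • (((b t : ℝ) : ℂ) * Φ (-t))) (Set.Ioi 0) := by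
    simp only [hfun]
    exact (integrableOn_cexp_mul_poissonTail d hw0 hre).const_mul _
  have hE2 : ∫ t in Set.Ioi (0 : ℝ), Real.exp (-t) • (((b t : ℝ) : ℂ) * Φ (-t))
      = Complex.exp (Complex.I * ((u * (s / q) : ℝ) : ℂ)) * (1 + Complex.I * ((u / q : ℝ) : ℂ))⁻¹
        * (1 + Complex.I * ((μ / θ * (u / q) : ℝ) : ℂ)) ^ (-(d : ℤ)) := by
    simp only [hfun]
    rw [integral_const_mul, integral_cexp_mul_poissonTail d hw0 hre, zpow_neg, zpow_natCast,
      ← inv_pow]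
    have h3 : (θ : ℂ) * (((μ⁻¹ : ℝ) : ℂ) / (((μ⁻¹ : ℝ) : ℂ) + (1 + Complex.I * ((u / q : ℝ) : ℂ))))
        = (1 + Complex.I * ((μ / θ * (u / q) : ℝ) : ℂ))⁻¹ := by
      have hμc : (μ : ℂ) ≠ 0 := by exact_mod_cast hμ.ne'
      have hθc : (θ : ℂ) ≠ 0 := by exact_mod_cast hθ0.ne'
      have hqc : (q : ℂ) ≠ 0 := by exact_mod_cast hq.ne'
      have hθμ : (θ : ℂ) = 1 + μ := by exact_mod_cast hθ
      have hne1 : (μ : ℂ)⁻¹ + (1 + Complex.I * (u / q)) ≠ 0 := fun h => by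
        have h4 := congrArg Complex.re h
        have : ((μ : ℂ)⁻¹ + (1 + Complex.I * (u / q))).re = μ⁻¹ + 1 := by
          rw [← Complex.ofReal_inv, ← Complex.ofReal_div]; simp
        rw [this] at h4
        simp only [Complex.zero_re] at h4
        linarith
      push_cast
      rw [eq_comm, inv_eq_iff_eq_inv, mul_inv, inv_div]
      field_simp
      rw [hθμ]; ring
    rw [← h3, mul_pow]
    ring
  rw [← hE2, ← integral_sub hI1 hI2]
  -- A pointwise majorant with three parts: the phase error from rounding the label, the error from
  -- changing the Poisson mean, and the mass of the early labels that were cut off.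
  set M : ℝ → ℝ := fun t => |u| / q * (N : ℝ)⁻¹ * (θ ^ d * (Real.exp (-t) * poissonTail d (μ⁻¹ * t)))
    + η * (θ ^ d * (Real.exp (-t) * poissonTail (d - 1) (μ⁻¹ * t)))
    + (θ / z) ^ d * (Set.Ioi (Real.log (n / N))).indicator (fun t => Real.exp (-κ * t)) t with hM
  have hτ0 : 0 ≤ Real.log ((n : ℝ) / N) := log_div_nonneg_of_mem (Finset.mem_Icc.2 ⟨hN, hNn⟩)
  have j1 := integrableOn_exp_mul_poissonTail d hw0
  have j2 := integrableOn_exp_mul_poissonTail (d - 1) hw0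
  have j3 : IntegrableOn ((Set.Ioi (Real.log ((n : ℝ) / N))).indicator
      fun t => Real.exp (-κ * t)) (Set.Ioi 0) :=
    IntegrableOn.indicator (exp_neg_integrableOn_Ioi 0 hκ0) measurableSet_Ioi
  have k1 := (j1.const_mul (θ ^ d)).const_mul (|u| / q * (N : ℝ)⁻¹)
  have k2 := (j2.const_mul (θ ^ d)).const_mul η
  have k3 := j3.const_mul ((θ / z) ^ d)
  have hMint : IntegrableOn M (Set.Ioi 0) := (k1.add k2).add k3
  refine (norm_integral_le_of_norm_le hMint ?_).trans ?_
  · have hae : ∀ᵐ t ∂(volume.restrict (Set.Ioi (0 : ℝ))), t ≠ Real.log ((n : ℝ) / N) :=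
      Measure.ae_ne _ _
    filter_upwards [ae_restrict_mem measurableSet_Ioi, hae] with t ht hne
    have ht0 : (0 : ℝ) < t := ht
    have hLmem := ceil_mul_exp_mem hn ht0
    have hLt := log_div_ceil_le hn t
    have hceil := Nat.ceil_lt_add_one (mul_pos hn0 (Real.exp_pos (-t))).le
    have hleceil := Nat.le_ceil ((n : ℝ) * Real.exp (-t))
    have hlog0 := log_div_nonneg_of_mem hLmem
    set L := ⌈(n : ℝ) * Real.exp (-t)⌉₊ with hL
    have hL0 : (0 : ℝ) < L := by exact_mod_cast (Finset.mem_Icc.1 hLmem).1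
    have hwt : 0 ≤ μ⁻¹ * t := by positivity
    have hαL : 0 ≤ α * Real.log ((n : ℝ) / L) := mul_nonneg hα0.le hlog0
    have hαLle : α * Real.log ((n : ℝ) / L) ≤ μ⁻¹ * t :=
      mul_le_mul hα hLt hlog0 hw0
    have hexp := Real.exp_pos (-t)
    rw [← smul_sub, norm_smul, Real.norm_eq_abs, abs_of_pos hexp]
    have hb0 : 0 ≤ b t := mul_nonneg (by positivity) (poissonTail_nonneg d hwt)
    have hd1 : 0 ≤ θ ^ d * poissonTail (d - 1) (μ⁻¹ * t) :=
      mul_nonneg (by positivity) (poissonTail_nonneg _ hwt)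
    have hind0 : 0 ≤ (θ / z) ^ d
        * (Set.Ioi (Real.log ((n : ℝ) / N))).indicator (fun t => Real.exp (-κ * t)) t :=
      mul_nonneg (by positivity) (Set.indicator_nonneg (fun _ _ => (Real.exp_pos _).le) t)
    by_cases hNL : N < L
    · have haL : a L = θ ^ d * poissonTail d (α * Real.log (n / L)) := if_pos hNL
      have ha0 : 0 ≤ a L := by
        rw [haL]; exact mul_nonneg (by positivity) (poissonTail_nonneg d hαL)
      have hab : a L ≤ b t := by
        rw [haL]
        exact mul_le_mul_of_nonneg_left (poissonTail_mono d hαL hαLle) (by positivity)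
      have hNn' : (N : ℝ) ≤ n * Real.exp (-t) := by
        have : (N : ℝ) + 1 ≤ L := by exact_mod_cast hNL
        linarith
      have hdist : t - Real.log ((n : ℝ) / L) ≤ (N : ℝ)⁻¹ := by
        have h5 : t - Real.log ((n : ℝ) / L) = Real.log (L / (n * Real.exp (-t))) := by
          rw [Real.log_div hn0.ne' hL0.ne', Real.log_div hL0.ne' (by positivity),
            Real.log_mul hn0.ne' hexp.ne', Real.log_exp]
          ring
        rw [h5]
        refine (Real.log_le_sub_one_of_pos (by positivity)).trans ?_
        have h6 : (L : ℝ) / (n * Real.exp (-t)) - 1 ≤ 1 / (n * Real.exp (-t)) := by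
          rw [div_sub_one (by positivity)]
          exact div_le_div_of_nonneg_right (by linarith) (by positivity)
        refine h6.trans ?_
        rw [inv_eq_one_div]
        exact one_div_le_one_div_of_le hN0 hNn'
      have htn : t ≤ Real.log n := by
        rw [Real.le_log_iff_exp_le hn0]
        have h1N : (1 : ℝ) ≤ N := by exact_mod_cast hN
        have := mul_le_mul_of_nonneg_right (h1N.trans hNn') (Real.exp_pos t).le
        rwa [mul_assoc, ← Real.exp_add, neg_add_cancel, Real.exp_zero, mul_one, one_mul] at this
      have hba : b t - a L ≤ η * (θ ^ d * poissonTail (d - 1) (μ⁻¹ * t)) := by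
        rw [haL]
        have h7 := poissonTail_sub_le d hαL hαLle
        have h8 : μ⁻¹ * t - α * Real.log ((n : ℝ) / L) ≤ η := by
          have h9 : (μ⁻¹ - α) * t ≤ (μ⁻¹ - α) * Real.log n :=
            mul_le_mul_of_nonneg_left htn (by linarith)
          have h10 := mul_le_mul_of_nonneg_left hdist hα0.le
          rw [hη]; linarith
        have h11 : poissonTail d (μ⁻¹ * t) - poissonTail d (α * Real.log ((n : ℝ) / L))
            ≤ η * poissonTail (d - 1) (μ⁻¹ * t) :=
          h7.trans (mul_le_mul_of_nonneg_right h8 (poissonTail_nonneg _ hwt))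
        have h12 := mul_le_mul_of_nonneg_left h11 (show 0 ≤ θ ^ d by positivity)
        simp only [hb]
        linarith
      have hphase : ‖Φ (Real.log L - Real.log n) - Φ (-t)‖ ≤ |u| / q * (N : ℝ)⁻¹ := by
        refine (hΦlip _ _).trans (mul_le_mul_of_nonneg_left ?_ (by positivity))
        have h5 : Real.log L - Real.log n - -t = t - Real.log ((n : ℝ) / L) := by
          rw [Real.log_div hn0.ne' hL0.ne']; ring
        rw [h5, abs_of_nonneg (by linarith)]
        exact hdist
      have hsplit : ((a L : ℝ) : ℂ) * Φ (Real.log L - Real.log n) - ((b t : ℝ) : ℂ) * Φ (-t)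
          = ((a L : ℝ) : ℂ) * (Φ (Real.log L - Real.log n) - Φ (-t))
            - ((b t - a L : ℝ) : ℂ) * Φ (-t) := by push_cast; ring
      have hnorm : ‖((a L : ℝ) : ℂ) * Φ (Real.log L - Real.log n) - ((b t : ℝ) : ℂ) * Φ (-t)‖
          ≤ |u| / q * (N : ℝ)⁻¹ * b t + η * (θ ^ d * poissonTail (d - 1) (μ⁻¹ * t)) := by
        rw [hsplit]
        refine (norm_sub_le _ _).trans (add_le_add ?_ ?_)
        · rw [norm_mul, Complex.norm_real, Real.norm_eq_abs, abs_of_nonneg ha0, mul_comm]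
          exact mul_le_mul hphase hab ha0 (by positivity)
        · rw [norm_mul, hΦ1, mul_one, Complex.norm_real, Real.norm_eq_abs,
            abs_of_nonneg (by linarith)]
          exact hba
      have := mul_le_mul_of_nonneg_left hnorm hexp.le
      simp only [hM, hb] at this ⊢
      linarith
    · have haL : a L = 0 := if_neg hNL
      have hge : Real.log ((n : ℝ) / N) < t := by
        refine lt_of_le_of_ne ?_ hne.symm
        rw [Real.log_le_iff_le_exp (by positivity), div_le_iff₀ hN0]
        have h5 : (n : ℝ) * Real.exp (-t) ≤ N :=
          hleceil.trans (by exact_mod_cast not_lt.1 hNL)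
        have := mul_le_mul_of_nonneg_right h5 (Real.exp_pos t).le
        rw [mul_assoc, ← Real.exp_add, neg_add_cancel, Real.exp_zero, mul_one] at this
        linarith
      rw [haL, Complex.ofReal_zero, zero_mul, zero_sub, norm_neg, norm_mul, hΦ1, mul_one,
        Complex.norm_real, Real.norm_eq_abs, abs_of_nonneg hb0]
      have hT : Real.exp (-t) * b t ≤ (θ / z) ^ d
          * (Set.Ioi (Real.log ((n : ℝ) / N))).indicator (fun t => Real.exp (-κ * t)) t := by
        rw [Set.indicator_of_mem (show t ∈ Set.Ioi (Real.log ((n : ℝ) / N)) from hge)]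
        have h5 := poissonTail_le_chernoff d hwt hz
        calc Real.exp (-t) * b t
            ≤ Real.exp (-t) * (θ ^ d * ((z ^ d)⁻¹ * Real.exp ((z - 1) * (μ⁻¹ * t)))) :=
              mul_le_mul_of_nonneg_left (mul_le_mul_of_nonneg_left h5 (by positivity)) hexp.le
          _ = (θ / z) ^ d * (Real.exp (-t) * Real.exp ((z - 1) * (μ⁻¹ * t))) := by
              rw [div_pow]; ring
          _ = _ := by
              rw [← Real.exp_add, hκ]; congr 2; field_simp; ring
      have h1 : 0 ≤ |u| / q * (N : ℝ)⁻¹ * (θ ^ d * (Real.exp (-t) * poissonTail d (μ⁻¹ * t))) := by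
        have := poissonTail_nonneg d hwt
        positivity
      have h2 : 0 ≤ η * (θ ^ d * (Real.exp (-t) * poissonTail (d - 1) (μ⁻¹ * t))) := by
        have := poissonTail_nonneg (d - 1) hwt
        positivity
      simp only [hM]
      linarith
  · have hEM : ∫ t in Set.Ioi (0 : ℝ), M t
        = |u| / q * (N : ℝ)⁻¹ * (θ ^ d * (μ⁻¹ / (μ⁻¹ + 1)) ^ d)
          + η * (θ ^ d * (μ⁻¹ / (μ⁻¹ + 1)) ^ (d - 1))
          + (θ / z) ^ d * (Real.exp (-κ * Real.log (n / N)) / κ) := by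
      simp only [hM]
      have k12 : Integrable (fun t => |u| / q * (N : ℝ)⁻¹
          * (θ ^ d * (Real.exp (-t) * poissonTail d (μ⁻¹ * t)))
          + η * (θ ^ d * (Real.exp (-t) * poissonTail (d - 1) (μ⁻¹ * t))))
          (volume.restrict (Set.Ioi 0)) := k1.add k2
      rw [integral_add k12 k3, integral_add k1 k2]
      simp only [integral_const_mul]
      rw [integral_exp_mul_poissonTail d hw0, integral_exp_mul_poissonTail (d - 1) hw0,
        setIntegral_indicator measurableSet_Ioi, Set.Ioi_inter_Ioi, sup_eq_right.2 hτ0,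
        integral_exp_mul_Ioi (by linarith)]
      congr 2
      rw [neg_div_neg_eq]
    rw [hEM, hwθ]
    have h1 : θ ^ d * θ⁻¹ ^ d = 1 := by
      rw [← mul_pow, mul_inv_cancel₀ hθ0.ne', one_pow]
    have h2 : θ ^ d * θ⁻¹ ^ (d - 1) ≤ θ := by
      rcases d with _ | d
      · simp; linarith
      · rw [Nat.add_sub_cancel, pow_succ, mul_right_comm, ← mul_pow, mul_inv_cancel₀ hθ0.ne',
          one_pow, one_mul]
    have h3 := mul_le_mul_of_nonneg_left h2 hη0
    rw [h1, mul_one, mul_comm θ η]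
    linarith

/-! ### Choice of the parameters -/

/-- Choices of a tilting parameter `z`, a threshold `N n` separating early from late vertices, a
tolerance `r n` for the average weight, and bounds `α n ≤ μ⁻¹ ≤ β n` for the connection rates,
for which all error terms are asymptotically negligible. -/
structure IsTuning (μ θ wstar c z : ℝ) (N : ℕ → ℕ) (r α β : ℕ → ℝ) : Prop where
  one_le_z : 1 ≤ z
  z_lt : z < θ
  one_le_N : ∀ᶠ n in atTop, 1 ≤ N n
  N_le : ∀ᶠ n in atTop, N n ≤ n
  r_nonneg : ∀ᶠ n in atTop, 0 ≤ r n
  α_pos : ∀ᶠ n in atTop, 0 < α n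
  α_le : ∀ᶠ n in atTop, α n ≤ μ⁻¹
  le_β : ∀ᶠ n in atTop, μ⁻¹ ≤ β n
  β_le : ∀ᶠ n in atTop, β n ≤ 2 * μ⁻¹
  add_le : ∀ᶠ n in atTop, μ + r n ≤ (α n)⁻¹
  le_sub : ∀ᶠ n in atTop, (β n)⁻¹ + (N n : ℝ)⁻¹ ≤ μ - r n
  tendsto_inv : Tendsto (fun n => (N n : ℝ)⁻¹) atTop (𝓝 0)
  tendsto_α : Tendsto (fun n : ℕ => (μ⁻¹ - α n) * Real.log n) atTop (𝓝 0)
  tendsto_β : Tendsto (fun n : ℕ => (β n * μ - 1) * (c * Real.log n)) atTop (𝓝 0)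
  tendsto_late : Tendsto (fun n : ℕ => Real.exp (Real.log (θ / z) * (c * Real.log n))
    * Real.exp (-(1 - (z - 1) / μ) * Real.log (n / N n))) atTop (𝓝 0)
  tendsto_early : Tendsto (fun n : ℕ => Real.exp (Real.log (θ / z) * (c * Real.log n))
    * ((N n : ℝ) / n * Real.exp ((z - 1) * ((1 + Real.log (N n)) / wstar
      + β n * (1 + Real.log n))))) atTop (𝓝 0)
  tendsto_regular : ∀ K : ℝ, Tendsto (fun n : ℕ => (n : ℝ) * (2 * Real.exp (-2 * r n ^ 2 * N n))
    * Real.exp (K * Real.log n)) atTop (𝓝 0)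

theorem tendsto_log_natCast_atTop : Tendsto (fun n : ℕ => Real.log n) atTop atTop :=
  Real.tendsto_log_atTop.comp tendsto_natCast_atTop_atTop

theorem tendsto_exp_mul_log_add {A : ℝ} (hA : A < 0) (B : ℝ) :
    Tendsto (fun n : ℕ => Real.exp (A * Real.log n + B)) atTop (𝓝 0) := by
  refine Real.tendsto_exp_atBot.comp (tendsto_atBot_add_const_right _ _ ?_)
  exact tendsto_log_natCast_atTop.const_mul_atTop_of_neg hA

/-- Take z = θ e^{-a}, N = ⌈n^ε⌉, and, with ρ = 1/log² n, r = μρ/4 and rates (1 ∓ ρ)/μ. Since ρ log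
n → 0, d-th powers of the relative rate error tend to 1, while ρ² N still beats every multiple of
log n, so irregular weights have superpolynomially small probability. -/
theorem exists_isTuning {μ θ wstar c : ℝ} (hμ : 0 < μ) (hθ : θ = 1 + μ) (hws : 0 < wstar)
    (hc : c ∈ Set.Ioo 0 (θ / (θ - 1))) :
    ∃ (z : ℝ) (N : ℕ → ℕ) (r α β : ℕ → ℝ), IsTuning μ θ wstar c z N r α β := by
  have hθ1 : 1 < θ := by linarith
  have hθ0 : 0 < θ := by linarith
  obtain ⟨hc0, hc1⟩ := hc
  rw [show θ - 1 = μ by linarith] at hc1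
  -- Both sides vanish at a = 0, with slopes c and θ/μ, so c < θ/(θ - 1) makes the inequality true
  -- for small a; this is the only use of that bound. The condition a ≤ log θ ensures z ≥ 1.
  obtain ⟨a, ha0, haθ, hac⟩ : ∃ a, 0 < a ∧ a ≤ Real.log θ ∧ a * c < θ / μ * (1 - Real.exp (-a)) := by
    have hgap : 0 < θ / μ / c - 1 := by rw [sub_pos, one_lt_div hc0]; exact hc1
    refine ⟨min (Real.log θ) ((θ / μ / c - 1) / 2), lt_min (Real.log_pos hθ1) (by linarith),
      min_le_left _ _, ?_⟩
    set a := min (Real.log θ) ((θ / μ / c - 1) / 2)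
    have ha0 : 0 < a := lt_min (Real.log_pos hθ1) (by linarith)
    have ha1 : 1 + a < θ / μ / c := by
      have : a ≤ (θ / μ / c - 1) / 2 := min_le_right _ _
      linarith
    have h1 : Real.exp (-a) ≤ (1 + a)⁻¹ := by
      rw [Real.exp_neg]
      exact inv_anti₀ (by linarith) (by linarith [Real.add_one_le_exp a])
    have h2 : a * (1 + a)⁻¹ ≤ 1 - Real.exp (-a) := by
      have : a * (1 + a)⁻¹ = 1 - (1 + a)⁻¹ := by field_simp; ring
      linarith
    have h3 : a * c < θ / μ * (a * (1 + a)⁻¹) := by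
      rw [lt_div_iff₀ hc0] at ha1
      have : a * c * (1 + a) < θ / μ * a := by nlinarith
      calc a * c = a * c * (1 + a) * (1 + a)⁻¹ := by field_simp
        _ < θ / μ * a * (1 + a)⁻¹ := mul_lt_mul_of_pos_right this (by positivity)
        _ = _ := by ring
    exact h3.trans_le (mul_le_mul_of_nonneg_left h2 (by positivity))
  set z := θ * Real.exp (-a) with hz
  have hz0 : 0 < z := by positivity
  have hz1 : 1 ≤ z := by
    have h1 : Real.exp (-Real.log θ) ≤ Real.exp (-a) := Real.exp_le_exp.2 (by linarith)
    rw [Real.exp_neg, Real.exp_log hθ0] at h1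
    have := mul_le_mul_of_nonneg_left h1 hθ0.le
    rwa [mul_inv_cancel₀ hθ0.ne'] at this
  have hzθ : z < θ := by
    have : Real.exp (-a) < 1 := Real.exp_lt_one_iff.2 (by linarith)
    exact mul_lt_of_lt_one_right hθ0 this
  have hlogz : Real.log (θ / z) = a := by
    rw [hz, Real.log_div hθ0.ne' (by positivity), Real.log_mul hθ0.ne' (Real.exp_pos _).ne',
      Real.log_exp]; ring
  set κ := 1 - (z - 1) / μ with hκ
  have hκa : κ = θ / μ * (1 - Real.exp (-a)) := by
    rw [hκ, hz]; field_simp; linarith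
  have hκc : a * c < κ := hκa ▸ hac
  have hκ0 : 0 < κ := lt_trans (by positivity) hκc
  -- To leading order the powers of n are a c - κ + ε(1 + (z - 1)/wstar) for early labels and a c -
  -- κ + εκ for the late cut-off. `D` dominates both coefficients of ε, so one small ε makes both
  -- negative.
  set D := 1 + (z - 1) / wstar + κ with hD
  have hz1' : 0 ≤ z - 1 := by linarith
  have hD0 : 0 < D := by positivity
  obtain ⟨ε, hε0, hε1, hεD⟩ : ∃ ε, 0 < ε ∧ ε < 1 ∧ ε * D < κ - a * c := by
    refine ⟨min (1 / 2) ((κ - a * c) / (2 * D)),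
      lt_min (by norm_num) (div_pos (by linarith) (by linarith)),
      (min_le_left _ _).trans_lt (by norm_num), ?_⟩
    calc _ ≤ (κ - a * c) / (2 * D) * D := mul_le_mul_of_nonneg_right (min_le_right _ _) hD0.le
      _ = (κ - a * c) / 2 := by field_simp
      _ < κ - a * c := by linarith
  have hlog := tendsto_log_natCast_atTop
  set N : ℕ → ℕ := fun n => ⌈(n : ℝ) ^ ε⌉₊ with hN
  set ρ : ℕ → ℝ := fun n => (Real.log n ^ 2)⁻¹ with hρ
  have hN_ge : ∀ n : ℕ, (n : ℝ) ^ ε ≤ N n := fun n => Nat.le_ceil _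
  have hpow : ∀ᶠ n : ℕ in atTop, (n : ℝ) ^ ε = Real.exp (ε * Real.log n) := by
    filter_upwards [eventually_gt_atTop 0] with n hn
    rw [Real.rpow_def_of_pos (by exact_mod_cast hn), mul_comm]
  have hN_le2 : ∀ᶠ n : ℕ in atTop, (N n : ℝ) ≤ 2 * (n : ℝ) ^ ε := by
    filter_upwards [eventually_ge_atTop 1] with n hn
    have h1 : (1 : ℝ) ≤ (n : ℝ) ^ ε := Real.one_le_rpow (by exact_mod_cast hn) hε0.le
    have := Nat.ceil_lt_add_one (zero_le_one.trans h1)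
    linarith
  have hN1 : ∀ᶠ n : ℕ in atTop, 1 ≤ N n := by
    filter_upwards [eventually_ge_atTop 1] with n hn
    exact Nat.one_le_ceil_iff.2 (Real.rpow_pos_of_pos (by exact_mod_cast hn) _)
  have hρ0 : Tendsto ρ atTop (𝓝 0) :=
    tendsto_inv_atTop_zero.comp ((tendsto_pow_atTop two_ne_zero).comp hlog)
  have hρpos : ∀ᶠ n in atTop, 0 < ρ n := by
    filter_upwards [hlog.eventually_gt_atTop 0] with n hn
    simp only [hρ]; positivity
  have hρlog : Tendsto (fun n : ℕ => ρ n * Real.log n) atTop (𝓝 0) := by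
    refine (tendsto_inv_atTop_zero.comp hlog).congr' ?_
    filter_upwards [hlog.eventually_gt_atTop 0] with n hn
    simp only [hρ, Function.comp]; field_simp
  have hρ1 : ∀ᶠ n in atTop, ρ n < 1 / 2 := hρ0.eventually_lt_const (by norm_num)
  have hlogpow : ∀ m : ℕ, ∀ C : ℝ, ∀ᶠ n : ℕ in atTop, C * Real.log n ^ m ≤ (n : ℝ) ^ ε := by
    intro m C
    have h1 : Tendsto (fun x : ℝ => x ^ m / Real.exp (ε * x)) atTop (𝓝 0) := by
      have := isLittleO_pow_exp_pos_mul_atTop (k := m) hε0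
      exact this.tendsto_div_nhds_zero
    have h2 := (h1.comp hlog).const_mul C
    rw [mul_zero] at h2
    filter_upwards [h2.eventually_le_const one_pos, hpow] with n hn hp
    rw [hp]
    simp only [Function.comp] at hn
    rwa [← mul_div_assoc, div_le_one (Real.exp_pos _)] at hn
  have hNinv : Tendsto (fun n => (N n : ℝ)⁻¹) atTop (𝓝 0) := by
    refine tendsto_inv_atTop_zero.comp (tendsto_atTop_mono hN_ge ?_)
    exact (tendsto_rpow_atTop hε0).comp tendsto_natCast_atTop_atTop
  have hlogN : ∀ᶠ n : ℕ in atTop, Real.log (N n) ≤ Real.log 2 + ε * Real.log n := by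
    filter_upwards [hN_le2, hN1, eventually_gt_atTop 0] with n h1 h2 h3
    have hn0 : (0 : ℝ) < n := by exact_mod_cast h3
    have := Real.log_le_log (by exact_mod_cast h2) h1
    rwa [Real.log_mul (by norm_num) (Real.rpow_pos_of_pos hn0 _).ne', Real.log_rpow hn0] at this
  refine ⟨z, N, fun n => μ * ρ n / 4, fun n => (1 - ρ n) / μ, fun n => (1 + ρ n) / μ, ?_⟩
  refine
    { one_le_z := hz1
      z_lt := hzθ
      one_le_N := hN1
      N_le := ?_
      r_nonneg := ?_
      α_pos := ?_
      α_le := ?_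
      le_β := ?_
      β_le := ?_
      add_le := ?_
      le_sub := ?_
      tendsto_inv := hNinv
      tendsto_α := ?_
      tendsto_β := ?_
      tendsto_late := ?_
      tendsto_early := ?_
      tendsto_regular := ?_ }
  · filter_upwards [eventually_ge_atTop 1] with n hn
    rw [hN, Nat.ceil_le]
    have h1 : (1 : ℝ) ≤ n := by exact_mod_cast hn
    simpa using Real.rpow_le_rpow_of_exponent_le h1 hε1.le
  · filter_upwards [hρpos] with n hn; positivity
  · filter_upwards [hρ1] with n hn
    exact div_pos (by linarith) hμ
  · filter_upwards [hρpos] with n hn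
    rw [inv_eq_one_div]
    exact div_le_div_of_nonneg_right (by linarith) hμ.le
  · filter_upwards [hρpos] with n hn
    rw [inv_eq_one_div]
    exact div_le_div_of_nonneg_right (by linarith) hμ.le
  · filter_upwards [hρ1] with n hn
    rw [← div_eq_mul_inv]
    exact div_le_div_of_nonneg_right (by linarith) hμ.le
  · filter_upwards [hρ1, hρpos] with n h1 h2
    rw [inv_div, le_div_iff₀ (by linarith)]
    nlinarith [mul_pos hμ h2]
  -- The inverse upper rate gains at least μρ/2 below μ; one half of this pays for N⁻¹ and the other
  -- for r.
  · filter_upwards [hρ1, hρpos, hlogpow 2 (4 / μ), hN1, hlog.eventually_gt_atTop 0]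
      with n h1 h2 h3 h4 h5
    have hN0 : (0 : ℝ) < N n := by exact_mod_cast h4
    have h6 : (N n : ℝ)⁻¹ ≤ μ * ρ n / 4 := by
      have h7 : 4 / μ * Real.log n ^ 2 ≤ N n := h3.trans (hN_ge n)
      have h8 := inv_anti₀ (by positivity) h7
      refine h8.trans (le_of_eq ?_)
      simp only [hρ]; field_simp
    have h9 : ((1 + ρ n) / μ)⁻¹ ≤ μ - μ * ρ n / 2 := by
      rw [inv_div, div_le_iff₀ (by linarith)]
      nlinarith [mul_pos hμ h2]
    linarith
  · have := hρlog.const_mul μ⁻¹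
    rw [mul_zero] at this
    refine this.congr fun n => ?_
    field_simp; ring
  · have := hρlog.const_mul c
    rw [mul_zero] at this
    refine this.congr fun n => ?_
    field_simp; ring
  · refine squeeze_zero' (.of_forall fun n => by positivity) ?_
      (tendsto_exp_mul_log_add (A := a * c - κ * (1 - ε)) ?_ (κ * Real.log 2))
    · filter_upwards [hlogN, hN1, eventually_gt_atTop 0] with n h1 h2 h3
      have hn0 : (0 : ℝ) < n := by exact_mod_cast h3
      have hN0 : (0 : ℝ) < N n := by exact_mod_cast h2
      rw [← Real.exp_add, hlogz, Real.log_div hn0.ne' hN0.ne']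
      refine Real.exp_le_exp.2 ?_
      have := mul_le_mul_of_nonneg_left h1 hκ0.le
      linarith
    · have : 0 ≤ ε * (1 + (z - 1) / wstar) := by positivity
      have : ε * D = ε * (1 + (z - 1) / wstar) + ε * κ := by rw [hD]; ring
      linarith
  · have hlim : ∀ B : ℝ, Tendsto (fun n : ℕ =>
        Real.exp ((a * c - κ + ε * (1 + (z - 1) / wstar)) * Real.log n + B)) atTop (𝓝 0) := by
      refine fun B => tendsto_exp_mul_log_add ?_ B
      have : ε * D = ε * (1 + (z - 1) / wstar) + ε * κ := by rw [hD]; ring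
      have : 0 < ε * κ := by positivity
      linarith
    refine squeeze_zero' (.of_forall fun n => by positivity) ?_
      (hlim (Real.log 2 + (z - 1) * ((1 + Real.log 2) / wstar + 2 / μ + 1 / μ)))
    filter_upwards [hlogN, hN1, eventually_gt_atTop 0, hρ1, hρpos,
      hρlog.eventually_le_const one_pos] with n h1 h2 h3 h4 h5 h6
    have hn0 : (0 : ℝ) < n := by exact_mod_cast h3
    have hN0 : (0 : ℝ) < N n := by exact_mod_cast h2
    have e1 : (N n : ℝ) / n = Real.exp (Real.log (N n) - Real.log n) := by
      rw [Real.exp_sub, Real.exp_log hN0, Real.exp_log hn0]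
    rw [e1, ← Real.exp_add, ← Real.exp_add, hlogz]
    refine Real.exp_le_exp.2 ?_
    have e2 : (1 + Real.log (N n)) / wstar ≤ (1 + Real.log 2) / wstar + ε / wstar * Real.log n := by
      have : (1 + Real.log 2) / wstar + ε / wstar * Real.log n
          = (1 + (Real.log 2 + ε * Real.log n)) / wstar := by ring
      rw [this]
      exact div_le_div_of_nonneg_right (by linarith) hws.le
    have e3 : (1 + ρ n) / μ * (1 + Real.log n) ≤ 2 / μ + 1 / μ + Real.log n / μ := by
      rw [← add_div, ← add_div, div_mul_eq_mul_div]
      refine div_le_div_of_nonneg_right ?_ hμ.le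
      nlinarith
    have e4 := mul_le_mul_of_nonneg_left (add_le_add e2 e3) hz1'
    have e5 : (z - 1) * ((1 + Real.log 2) / wstar + ε / wstar * Real.log n
        + (2 / μ + 1 / μ + Real.log n / μ))
        = (z - 1) * ((1 + Real.log 2) / wstar + 2 / μ + 1 / μ)
          + (ε * ((z - 1) / wstar) + (1 - κ)) * Real.log n := by rw [hκ]; ring
    rw [e5] at e4
    linarith
  · intro K
    have hlim := tendsto_exp_mul_log_add (A := -1) (by norm_num) (Real.log 2)
    refine squeeze_zero' (.of_forall fun n => by positivity) ?_ hlim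
    -- The sixth power: r² is of order 1/log⁴ n, so N ≥ (8/μ²) log⁶ n makes the Hoeffding exponent
    -- at least log² n, which exceeds (K + 2) log n.
    filter_upwards [hlogpow 6 (8 / μ ^ 2), hlog.eventually_gt_atTop 0,
      hlog.eventually_ge_atTop (K + 2), eventually_gt_atTop 0] with n h1 h2 h3 h4
    have hn0 : (0 : ℝ) < n := by exact_mod_cast h4
    have e1 : Real.log n ^ 2 ≤ 2 * (μ * ρ n / 4) ^ 2 * N n := by
      have h5 := h1.trans (hN_ge n)
      have h6 := mul_le_mul_of_nonneg_left h5
        (show 0 ≤ 2 * (μ * ρ n / 4) ^ 2 by positivity)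
      refine le_trans (le_of_eq ?_) h6
      simp only [hρ]; field_simp; norm_num
    have e2 : (K + 2) * Real.log n ≤ Real.log n ^ 2 := by
      rw [sq]; exact mul_le_mul_of_nonneg_right h3 h2.le
    have e3 : (n : ℝ) * (2 * Real.exp (-2 * (μ * ρ n / 4) ^ 2 * N n)) * Real.exp (K * Real.log n)
        = Real.exp (Real.log n + Real.log 2 + -2 * (μ * ρ n / 4) ^ 2 * N n + K * Real.log n) := by
      rw [Real.exp_add, Real.exp_add, Real.exp_add, Real.exp_log hn0, Real.exp_log two_pos]; ring
    rw [e3]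
    refine Real.exp_le_exp.2 ?_
    linarith

/-! ### Asymptotics of the one-label masses -/

/-- The rescaled logarithm of the label `x`. -/
noncomputable def labelScale (θ : ℝ) (n : ℕ) (y : ℝ) (x : ℕ) : ℝ :=
  (Real.log x - (Real.log n - (1 - θ⁻¹) * y)) / √((1 - θ⁻¹) ^ 2 * y)

/-- The normalised Poisson approximation for the probability that the vertex `x` is chosen
uniformly at random from `{1, …, n}` and has in-degree at least `d`, restricted to labels
exceeding `N`. -/
noncomputable def lateMass (θ α : ℝ) (N n d x : ℕ) : ℝ :=
  (n : ℝ)⁻¹ * if N < x then θ ^ d * poissonTail d (α * Real.log (n / x)) else 0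

theorem lateMass_nonneg {θ α : ℝ} (hθ : 0 ≤ θ) (hα : 0 ≤ α) {N n d x : ℕ}
    (hx : x ∈ Finset.Icc 1 n) : 0 ≤ lateMass θ α N n d x := by
  unfold lateMass
  refine mul_nonneg (by positivity) ?_
  split_ifs
  · exact mul_nonneg (by positivity)
      (poissonTail_nonneg d (mul_nonneg hα (log_div_nonneg_of_mem hx)))
  · exact le_rfl

/-- The Chernoff bound at z = θ gives θ^d times the tail at most n/x, hence mass at most 1/x. No
single label carries much mass, which makes coincidences among several labels negligible. -/
theorem lateMass_le {μ θ α : ℝ} (hμ : 0 < μ) (hθ : θ = 1 + μ) (hα0 : 0 ≤ α) (hα : α ≤ μ⁻¹)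
    {N n d x : ℕ} (hN : 1 ≤ N) (hx : x ∈ Finset.Icc 1 n) :
    lateMass θ α N n d x ≤ (N : ℝ)⁻¹ := by
  have hθ0 : 0 < θ := by linarith
  have hN0 : (0 : ℝ) < N := by exact_mod_cast hN
  unfold lateMass
  split_ifs with h
  · have hx0 : (0 : ℝ) < x := by exact_mod_cast (Finset.mem_Icc.1 hx).1
    have hn0 : (0 : ℝ) < n := hx0.trans_le (by exact_mod_cast (Finset.mem_Icc.1 hx).2)
    have hl := log_div_nonneg_of_mem hx
    have h1 := poissonTail_le_chernoff d (mul_nonneg hα0 hl) (show 1 ≤ θ by linarith)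
    have h2 : Real.exp ((θ - 1) * (α * Real.log ((n : ℝ) / x))) ≤ n / x := by
      rw [← Real.le_log_iff_exp_le (by positivity), ← mul_assoc]
      refine mul_le_of_le_one_left hl ?_
      have := mul_le_mul_of_nonneg_left hα hμ.le
      rw [mul_inv_cancel₀ hμ.ne'] at this
      rw [hθ]; linarith
    calc (n : ℝ)⁻¹ * (θ ^ d * poissonTail d (α * Real.log (n / x)))
        ≤ (n : ℝ)⁻¹ * (θ ^ d * ((θ ^ d)⁻¹ * (n / x))) := by gcongr; exact h1.trans (by gcongr)
      _ = (x : ℝ)⁻¹ := by field_simp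
      _ ≤ (N : ℝ)⁻¹ := inv_anti₀ hN0 (by exact_mod_cast h.le)
  · rw [mul_zero]; positivity

section asymptotics

variable {μ θ wstar c z : ℝ} {N : ℕ → ℕ} {r α β : ℕ → ℝ}

theorem IsTuning.pow_le_exp (ht : IsTuning μ θ wstar c z N r α β) {n d : ℕ}
    (hd : (d : ℝ) ≤ c * Real.log n) :
    (θ / z) ^ d ≤ Real.exp (Real.log (θ / z) * (c * Real.log n)) := by
  have hz0 : 0 < z := by linarith [ht.one_le_z]
  have h1 : 1 < θ / z := (one_lt_div hz0).2 ht.z_lt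
  rw [← Real.exp_log (show 0 < (θ / z) ^ d by positivity), Real.log_pow]
  refine Real.exp_le_exp.2 ?_
  rw [mul_comm]
  exact mul_le_mul_of_nonneg_left hd (Real.log_pos h1).le

/-- The law with masses `lateMass` is asymptotically normal. -/
theorem IsTuning.tendsto_sum_lateMass (ht : IsTuning μ θ wstar c z N r α β) (hμ : 0 < μ)
    (hθ : θ = 1 + μ) {d : ℕ → ℕ} (hd : Tendsto d atTop atTop)
    (hdc : ∀ᶠ n : ℕ in atTop, (d n : ℝ) ≤ c * Real.log n) (u : ℝ) :
    Tendsto (fun n => ∑ x ∈ Finset.Icc 1 n, (lateMass θ (α n) (N n) n (d n) x : ℂ)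
        * Complex.exp (Complex.I * ((u * labelScale θ n (d n) x : ℝ) : ℂ)))
      atTop (𝓝 (Complex.exp (-(u ^ 2 / 2)))) := by
  have hθ0 : 0 < θ := by linarith
  have hz0 : 0 < z := by linarith [ht.one_le_z]
  set σ := 1 - θ⁻¹ with hσ
  -- The standardisation constant 1 - θ⁻¹ is the mean of each exponential summand in the gamma
  -- variable.
  have hσμ : σ = μ / θ := by rw [hσ, hθ]; field_simp; ring
  have hσ0 : 0 < σ := by rw [hσμ]; positivity
  have hκ0 : 0 < 1 - (z - 1) / μ := by
    rw [sub_pos, div_lt_one hμ]; linarith [ht.z_lt]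
  have hsqrt : Tendsto (fun n => √(d n : ℝ)) atTop atTop :=
    Real.tendsto_sqrt_atTop.comp (tendsto_natCast_atTop_atTop.comp hd)
  have hq : Tendsto (fun n => σ * √(d n : ℝ)) atTop atTop := hsqrt.const_mul_atTop hσ0
  have huq : Tendsto (fun n => u / (σ * √(d n : ℝ))) atTop (𝓝 0) := tendsto_const_nhds.div_atTop hq
  have hlim : Tendsto (fun n => Complex.exp (Complex.I * ((u * √(d n : ℝ) : ℝ) : ℂ))
      * (1 + Complex.I * ((u / (σ * √(d n : ℝ)) : ℝ) : ℂ))⁻¹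
      * (1 + Complex.I * ((u / √(d n : ℝ) : ℝ) : ℂ)) ^ (-(d n : ℤ))) atTop
      (𝓝 (Complex.exp (-(u ^ 2 / 2)))) := by
    have h1 := (tendsto_gamma_charFun u).comp hd
    -- The additional standard exponential summand disappears after division by σ√d.
    have h2 : Tendsto (fun n => (1 + Complex.I * ((u / (σ * √(d n : ℝ)) : ℝ) : ℂ))⁻¹) atTop
        (𝓝 1) := by
      have h3 := (((Complex.continuous_ofReal.tendsto 0).comp huq).const_mul Complex.I).const_add 1
      simp only [Complex.ofReal_zero, mul_zero, add_zero] at h3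
      simpa using h3.inv₀ one_ne_zero
    have h4 := h1.mul h2
    rw [mul_one] at h4
    refine h4.congr fun n => ?_
    simp only [Function.comp]
    push_cast
    ring
  have herr : Tendsto (fun n => |u / (σ * √(d n : ℝ))| * (N n : ℝ)⁻¹
      + θ * ((μ⁻¹ - α n) * Real.log n + μ⁻¹ * (N n : ℝ)⁻¹)
      + Real.exp (Real.log (θ / z) * (c * Real.log n))
        * Real.exp (-(1 - (z - 1) / μ) * Real.log (n / N n)) / (1 - (z - 1) / μ))
      atTop (𝓝 0) := by
    have h1 := ((huq.abs.mul ht.tendsto_inv).add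
      ((ht.tendsto_α.add (ht.tendsto_inv.const_mul μ⁻¹)).const_mul θ)).add
      (ht.tendsto_late.div_const (1 - (z - 1) / μ))
    simpa using h1
  rw [tendsto_iff_norm_sub_tendsto_zero] at hlim ⊢
  have htot := herr.add hlim
  rw [add_zero] at htot
  refine squeeze_zero' (.of_forall fun _ => norm_nonneg _) ?_ htot
  filter_upwards [ht.one_le_N, ht.N_le, ht.α_pos, ht.α_le, hdc, hd.eventually_gt_atTop 0]
    with n hN hNn hα0 hα hdn hd0
  have hd0' : (0 : ℝ) < d n := by exact_mod_cast hd0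
  have hs0 : 0 < √(d n : ℝ) := Real.sqrt_pos.2 hd0'
  have hq0 : 0 < σ * √(d n : ℝ) := by positivity
  have hmain := norm_sum_poissonTail_sub_le (u := u) (s := σ * d n) hμ hθ hα0 hα ht.one_le_z
    ht.z_lt hq0 hN hNn (d n)
  have e1 : σ * d n / (σ * √(d n : ℝ)) = √(d n : ℝ) := by
    rw [mul_div_mul_left _ _ hσ0.ne', Real.div_sqrt]
  have e2 : μ / θ * (u / (σ * √(d n : ℝ))) = u / √(d n : ℝ) := by
    rw [← hσμ]; field_simp
  rw [e1, e2] at hmain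
  have e3 : (n : ℝ)⁻¹ • ∑ x ∈ Finset.Icc 1 n,
        (((if N n < x then θ ^ d n * poissonTail (d n) (α n * Real.log (n / x)) else 0 : ℝ)) : ℂ)
          * Complex.exp (Complex.I * ((u * ((Real.log x - Real.log n + σ * d n)
            / (σ * √(d n : ℝ))) : ℝ) : ℂ))
      = ∑ x ∈ Finset.Icc 1 n, (lateMass θ (α n) (N n) n (d n) x : ℂ)
        * Complex.exp (Complex.I * ((u * labelScale θ n (d n) x : ℝ) : ℂ)) := by
    rw [Finset.smul_sum]
    refine Finset.sum_congr rfl fun x _ => ?_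
    have hscale : (Real.log x - Real.log n + σ * d n) / (σ * √(d n : ℝ))
        = labelScale θ n (d n) x := by
      rw [labelScale, ← hσ, Real.sqrt_mul (sq_nonneg σ), Real.sqrt_sq hσ0.le]
      congr 1
      ring
    rw [hscale, Complex.real_smul, lateMass, Complex.ofReal_mul (n : ℝ)⁻¹, mul_assoc]
  rw [e3] at hmain
  refine (norm_sub_le_norm_sub_add_norm_sub _ _ _).trans (add_le_add (hmain.trans ?_) le_rfl)
  have hN0 : (0 : ℝ) ≤ (N n : ℝ)⁻¹ := by positivity
  refine add_le_add (add_le_add ?_ ?_) ?_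
  · rw [abs_div, abs_of_pos hq0]
  · exact mul_le_mul_of_nonneg_left (add_le_add le_rfl (mul_le_mul_of_nonneg_right hα hN0)) hθ0.le
  · rw [← mul_div_assoc]
    exact div_le_div_of_nonneg_right
      (mul_le_mul_of_nonneg_right (ht.pow_le_exp hdn) (Real.exp_pos _).le) hκ0.le

theorem IsTuning.tendsto_sum_lateMass_real (ht : IsTuning μ θ wstar c z N r α β) (hμ : 0 < μ)
    (hθ : θ = 1 + μ) {d : ℕ → ℕ} (hd : Tendsto d atTop atTop)
    (hdc : ∀ᶠ n : ℕ in atTop, (d n : ℝ) ≤ c * Real.log n) :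
    Tendsto (fun n => ∑ x ∈ Finset.Icc 1 n, lateMass θ (α n) (N n) n (d n) x) atTop (𝓝 1) := by
  have h := (Complex.continuous_re.tendsto _).comp (ht.tendsto_sum_lateMass hμ hθ hd hdc 0)
  simpa [Function.comp_def] using h

theorem IsTuning.pow_β_le (ht : IsTuning μ θ wstar c z N r α β) (hμ : 0 < μ) {d : ℕ → ℕ}
    (hdc : ∀ᶠ n : ℕ in atTop, (d n : ℝ) ≤ c * Real.log n) :
    ∀ᶠ n in atTop, (β n * μ) ^ d n ≤ Real.exp ((β n * μ - 1) * (c * Real.log n)) := by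
  filter_upwards [hdc, ht.le_β] with n hdn hβ
  have h1 : 1 ≤ β n * μ := by
    have := mul_le_mul_of_nonneg_right hβ hμ.le
    rwa [inv_mul_cancel₀ hμ.ne'] at this
  calc (β n * μ) ^ d n ≤ Real.exp (β n * μ - 1) ^ d n :=
        pow_le_pow_left₀ (by linarith) (by linarith [Real.add_one_le_exp (β n * μ - 1)]) _
    _ = Real.exp ((β n * μ - 1) * d n) := by rw [← Real.exp_nat_mul, mul_comm]
    _ ≤ _ := Real.exp_le_exp.2 (mul_le_mul_of_nonneg_left hdn (by linarith))

/-- Using the rate β instead of 1/μ costs a factor at most βμ per unit of degree, uniformly in the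
weight; its d-th power tends to 1. -/
theorem div_add_one_le {w β μ θ : ℝ} (hμ : 0 < μ) (hθ : θ = 1 + μ) (hw : 0 < w) (hβ : μ⁻¹ ≤ β) :
    θ * (w * β / (w * β + 1)) ≤ β * μ * (θ * w / (w + μ)) := by
  have hβ0 : 0 < β := lt_of_lt_of_le (by positivity) hβ
  have h1 : 1 ≤ β * μ := by
    have := mul_le_mul_of_nonneg_right hβ hμ.le
    rwa [inv_mul_cancel₀ hμ.ne'] at this
  have hθ0 : 0 < θ := by linarith
  have h2 : w * β / (w * β + 1) ≤ β * μ * w / (w + μ) := by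
    rw [div_le_div_iff₀ (by positivity) (by positivity)]
    have : w * β * (w + μ) ≤ w * β * (μ * (w * β + 1)) :=
      mul_le_mul_of_nonneg_left (by nlinarith) (by positivity)
    linarith
  calc _ ≤ θ * (β * μ * w / (w + μ)) := mul_le_mul_of_nonneg_left h2 hθ0.le
    _ = _ := by ring

/-- Since θ = 1 + μ, the ratio θx/(x + μ) is at most 1 on (0, 1] and equals 1 only at x = 1, so its
powers converge to the indicator of the atom. This is why only weight-one vertices survive in the
limit. -/
theorem tendsto_integral_pow_weight {Ω : Type*} [MeasurableSpace Ω] {P : Measure Ω}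
    [IsProbabilityMeasure P] {X : Ω → ℝ} (hX : Measurable X) (hμ : 0 < μ) (hθ : θ = 1 + μ)
    (hX01 : ∀ᵐ ω ∂P, 0 < X ω ∧ X ω ≤ 1) {d : ℕ → ℕ} (hd : Tendsto d atTop atTop) :
    Tendsto (fun n => ∫ ω, (θ * X ω / (X ω + μ)) ^ d n ∂P) atTop
      (𝓝 (P.real {ω | X ω = 1})) := by
  classical
  have hm : MeasurableSet {ω | X ω = 1} := hX (measurableSet_singleton 1)
  have hlim : ∫ ω, {ω | X ω = 1}.indicator (fun _ => (1 : ℝ)) ω ∂P = P.real {ω | X ω = 1} := by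
    rw [integral_indicator_const _ hm]; simp
  have hθ0 : 0 < θ := by linarith
  rw [← hlim]
  refine tendsto_integral_of_dominated_convergence (fun _ => 1)
    (fun n => Measurable.aestronglyMeasurable (by fun_prop)) (integrable_const 1) (fun n => ?_) ?_
  · filter_upwards [hX01] with ω ⟨h0, h1⟩
    rw [Real.norm_eq_abs, abs_of_nonneg (by positivity)]
    refine pow_le_one₀ (by positivity) ((div_le_one (by positivity)).2 ?_)
    rw [hθ]; nlinarith
  · filter_upwards [hX01] with ω ⟨h0, h1⟩
    by_cases h : X ω = 1
    · have h2 : θ * X ω / (X ω + μ) = 1 := by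
        rw [h, mul_one, hθ]; exact div_self (by positivity)
      rw [Set.indicator_of_mem (show ω ∈ {ω | X ω = 1} from h)]
      simp only [h2, one_pow]
      exact tendsto_const_nhds
    · rw [Set.indicator_of_notMem (show ω ∉ {ω | X ω = 1} from h)]
      refine (tendsto_pow_atTop_nhds_zero_of_lt_one (by positivity)
        ((div_lt_one (by positivity)).2 ?_)).comp hd
      have : X ω < 1 := lt_of_le_of_ne h1 h
      rw [hθ]; nlinarith

/-- Sum over one label of the upper bound for the probability of a large in-degree. -/
theorem sum_upper_le {Ω : Type*} [MeasurableSpace Ω] {P : Measure Ω}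
    [IsProbabilityMeasure P] {X : Ω → ℝ} (hX : Measurable X) (hμ : 0 < μ) (hθ : θ = 1 + μ)
    (hX01 : ∀ᵐ ω ∂P, 0 < X ω ∧ X ω ≤ 1) {b B z : ℝ} (hβ : μ⁻¹ ≤ b) (hz : 1 ≤ z) {N n : ℕ}
    (hN : 1 ≤ N) (hNn : N ≤ n) (d : ℕ) :
    ∑ x ∈ Finset.Icc 1 n, (n : ℝ)⁻¹ * (θ ^ d * if x ≤ N then (z ^ d)⁻¹ * Real.exp B
      else ∫ ω, poissonTail d (X ω * (b * Real.log (n / ((x - 1 : ℕ) : ℝ)))) ∂P)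
      ≤ (θ / z) ^ d * ((N : ℝ) / n * Real.exp B)
        + (b * μ) ^ d * ∫ ω, (θ * X ω / (X ω + μ)) ^ d ∂P := by
  classical
  have hn : 1 ≤ n := hN.trans hNn
  have hn0 : (0 : ℝ) < n := by exact_mod_cast hn
  have hz0 : 0 < z := by linarith
  have hθ0 : 0 < θ := by linarith
  have hb0 : 0 < b := lt_of_lt_of_le (by positivity) hβ
  rw [← Finset.sum_filter_add_sum_filter_not (Finset.Icc 1 n) (fun x => x ≤ N)]
  refine add_le_add ?_ ?_
  · have hf : (Finset.Icc 1 n).filter (fun x => x ≤ N) = Finset.Icc 1 N := by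
      ext x; simp only [Finset.mem_filter, Finset.mem_Icc]; omega
    rw [hf, Finset.sum_congr rfl fun x hx => by rw [if_pos (Finset.mem_Icc.1 hx).2]]
    rw [Finset.sum_const, Nat.card_Icc, Nat.add_sub_cancel, nsmul_eq_mul, div_pow]
    refine le_of_eq ?_
    field_simp
  · have hf : (Finset.Icc 1 n).filter (fun x => ¬ x ≤ N) = Finset.Ioc N n := by
      ext x; simp only [Finset.mem_filter, Finset.mem_Icc, Finset.mem_Ioc]; omega
    rw [hf, Finset.sum_congr rfl fun x hx => by
      rw [if_neg (not_le.2 (Finset.mem_Ioc.1 hx).1)]]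
    have hlog : ∀ x ∈ Finset.Ioc N n, 0 ≤ Real.log (n / ((x - 1 : ℕ) : ℝ)) := fun x hx => by
      have := Finset.mem_Ioc.1 hx
      exact log_div_nonneg_of_mem (Finset.mem_Icc.2 (by omega))
    have hint : ∀ x ∈ Finset.Ioc N n, Integrable
        (fun ω => poissonTail d (X ω * (b * Real.log (n / ((x - 1 : ℕ) : ℝ))))) P := by
      intro x hx
      refine Integrable.of_bound (C := 1) ?_ ?_
      · exact ((continuous_poissonTail d).measurable.comp (hX.mul_const _)).aestronglyMeasurable
      · filter_upwards [hX01] with ω ⟨h0, h1⟩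
        have h3 : 0 ≤ X ω * (b * Real.log (n / ((x - 1 : ℕ) : ℝ))) :=
          mul_nonneg h0.le (mul_nonneg hb0.le (hlog x hx))
        rw [Real.norm_eq_abs, abs_of_nonneg (poissonTail_nonneg d h3)]
        exact poissonTail_le_one d h3
    have hintR : Integrable (fun ω => (θ * X ω / (X ω + μ)) ^ d) P := by
      refine Integrable.of_bound (C := 1) (Measurable.aestronglyMeasurable (by fun_prop)) ?_
      filter_upwards [hX01] with ω ⟨h0, h1⟩
      rw [Real.norm_eq_abs, abs_of_nonneg (by positivity)]
      refine pow_le_one₀ (by positivity) ((div_le_one (by positivity)).2 ?_)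
      rw [hθ]; nlinarith
    rw [← Finset.mul_sum, ← Finset.mul_sum, ← integral_finsetSum _ hint, ← integral_const_mul,
      ← integral_const_mul, ← integral_const_mul]
    refine integral_mono_ae (((integrable_finsetSum _ hint).const_mul _).const_mul _)
      (hintR.const_mul _) ?_
    filter_upwards [hX01] with ω ⟨h0, h1⟩
    have h2 := sum_poissonTail_pred_le d (mul_nonneg h0.le hb0.le) hN hn
    simp only [mul_assoc (X ω) b] at h2
    calc _ = θ ^ d * ((n : ℝ)⁻¹ * ∑ x ∈ Finset.Ioc N n,
            poissonTail d (X ω * (b * Real.log (n / ((x - 1 : ℕ) : ℝ))))) := by ring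
      _ ≤ θ ^ d * (X ω * b / (X ω * b + 1)) ^ d :=
          mul_le_mul_of_nonneg_left h2 (by positivity)
      _ = (θ * (X ω * b / (X ω * b + 1))) ^ d := by rw [mul_pow]
      _ ≤ (b * μ * (θ * X ω / (X ω + μ))) ^ d :=
          pow_le_pow_left₀ (by positivity) (div_add_one_le hμ hθ h0 hβ) d
      _ = _ := by rw [mul_pow]

/-- Sum over one label of the error term in the lower bound. -/
theorem sum_lower_error_le (hμ : 0 < μ) (hθ : θ = 1 + μ) {b : ℝ} (hβ : μ⁻¹ ≤ b) {N n : ℕ}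
    (hN : 1 ≤ N) (hn : 1 ≤ n) (d : ℕ) :
    ∑ x ∈ Finset.Ioc N n, (n : ℝ)⁻¹ * (θ ^ d
      * poissonTail (d - 2) (b * Real.log (n / ((x - 1 : ℕ) : ℝ)))) ≤ θ ^ 2 * (b * μ) ^ d := by
  have hθ0 : 0 < θ := by linarith
  have hb0 : 0 < b := lt_of_lt_of_le (by positivity) hβ
  have h1 : 1 ≤ b * μ := by
    have := mul_le_mul_of_nonneg_right hβ hμ.le
    rwa [inv_mul_cancel₀ hμ.ne'] at this
  have h2 := sum_poissonTail_pred_le (d - 2) hb0.le hN hn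
  have h3 : θ * (b / (b + 1)) ≤ b * μ := by
    have := div_add_one_le hμ hθ one_pos hβ
    rw [one_mul, mul_one, ← hθ, div_self hθ0.ne', mul_one] at this
    exact this
  rw [← Finset.mul_sum, ← Finset.mul_sum]
  have h4 : θ ^ d ≤ θ ^ 2 * θ ^ (d - 2) := by
    rw [← pow_add]
    exact pow_le_pow_right₀ (by linarith) (by omega)
  calc _ = θ ^ d * ((n : ℝ)⁻¹ * ∑ x ∈ Finset.Ioc N n,
          poissonTail (d - 2) (b * Real.log (n / ((x - 1 : ℕ) : ℝ)))) := by ring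
    _ ≤ θ ^ d * (b / (b + 1)) ^ (d - 2) := mul_le_mul_of_nonneg_left h2 (by positivity)
    _ ≤ θ ^ 2 * θ ^ (d - 2) * (b / (b + 1)) ^ (d - 2) :=
        mul_le_mul_of_nonneg_right h4 (by positivity)
    _ = θ ^ 2 * (θ * (b / (b + 1))) ^ (d - 2) := by rw [mul_pow]; ring
    _ ≤ θ ^ 2 * (b * μ) ^ (d - 2) := by gcongr
    _ ≤ θ ^ 2 * (b * μ) ^ d := by
        refine mul_le_mul_of_nonneg_left (pow_le_pow_right₀ h1 (Nat.sub_le d 2)) (by positivity)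

end asymptotics

/-! ### Comparison of measures on tuples of labels -/

/-- The negative part of q - a is at most e, so |q - a| ≤ q - a + 2e. Thus a pointwise lower bound
for q together with an upper bound for its total mass controls the total variation distance; no
pointwise upper bound is needed. -/
theorem norm_sum_mul_sub_le {κ : Type*} [DecidableEq κ] {S T : Finset κ} (hST : S ⊆ T)
    {q a e : κ → ℝ} {f : κ → ℂ} (ha : ∀ x ∈ T, 0 ≤ a x) (he : ∀ x ∈ T, 0 ≤ e x)
    (hq : ∀ x ∈ S, a x ≤ q x + e x) (hf : ∀ x, ‖f x‖ ≤ 1) :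
    ‖∑ x ∈ S, (q x : ℂ) * f x - ∑ x ∈ T, (a x : ℂ) * f x‖
      ≤ (∑ x ∈ S, q x - ∑ x ∈ T, a x) + 2 * ∑ x ∈ T, e x + 2 * ∑ x ∈ T \ S, a x := by
  have h1 : ∑ x ∈ S, (q x : ℂ) * f x - ∑ x ∈ T, (a x : ℂ) * f x
      = ∑ x ∈ S, ((q x - a x : ℝ) : ℂ) * f x - ∑ x ∈ T \ S, (a x : ℂ) * f x := by
    rw [← Finset.sum_sdiff hST (f := fun x => (a x : ℂ) * f x)]
    simp only [Complex.ofReal_sub, sub_mul, Finset.sum_sub_distrib]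
    ring
  have h2 : ‖∑ x ∈ S, ((q x - a x : ℝ) : ℂ) * f x‖ ≤ ∑ x ∈ S, (q x - a x + 2 * e x) := by
    refine norm_sum_le_of_le _ fun x hx => ?_
    rw [norm_mul, Complex.norm_real, Real.norm_eq_abs]
    refine (mul_le_of_le_one_right (abs_nonneg _) (hf x)).trans (abs_le.2 ⟨?_, ?_⟩)
    · linarith [hq x hx, he x (hST hx)]
    · linarith [he x (hST hx)]
  have h3 : ‖∑ x ∈ T \ S, (a x : ℂ) * f x‖ ≤ ∑ x ∈ T \ S, a x := by
    refine norm_sum_le_of_le _ fun x hx => ?_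
    have := ha x (Finset.mem_sdiff.1 hx).1
    rw [norm_mul, Complex.norm_real, Real.norm_eq_abs, abs_of_nonneg this]
    exact mul_le_of_le_one_right this (hf x)
  have h4 : ∑ x ∈ S, e x ≤ ∑ x ∈ T, e x :=
    Finset.sum_le_sum_of_subset_of_nonneg hST fun x hx _ => he x hx
  have h5 := Finset.sum_sdiff hST (f := a)
  rw [Finset.sum_add_distrib, Finset.sum_sub_distrib, ← Finset.mul_sum] at h2
  rw [h1]
  refine (norm_sub_le _ _).trans ?_
  linarith

/-- A non-injective tuple has two coordinates with a common label x. One of these two factors is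
bounded by δ, the other is summed over x, and the remaining coordinates are summed freely. -/
theorem sum_not_injective_prod_le {ι : Type*} [Fintype ι] [DecidableEq ι] (s : Finset ℕ)
    {a : ι → ℕ → ℝ} (ha : ∀ i, ∀ x ∈ s, 0 ≤ a i x) {A δ : ℝ} (hA1 : 1 ≤ A) (hδ0 : 0 ≤ δ)
    (hA : ∀ i, ∑ x ∈ s, a i x ≤ A) (hδ : ∀ i, ∀ x ∈ s, a i x ≤ δ) :
    ∑ ℓ ∈ Fintype.piFinset (fun _ : ι => s) with ¬ Function.Injective ℓ, ∏ i, a i (ℓ i)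
      ≤ Fintype.card ι ^ 2 * (A * δ * A ^ Fintype.card ι) := by
  classical
  -- Forces the two coordinates of the pair to take the value x while keeping product form, so that
  -- the sum over tuples still factorises.
  set b : ι × ι → ℕ → ι → ℕ → ℝ := fun p x l y =>
    if (l = p.1 ∨ l = p.2) ∧ y ≠ x then 0 else a l y with hb
  have hb0 : ∀ p x l, ∀ y ∈ s, 0 ≤ b p x l y := fun p x l y hy => by
    simp only [hb]; split_ifs
    · exact le_rfl
    · exact ha l y hy
  have h1 : ∀ ℓ ∈ (Fintype.piFinset fun _ : ι => s).filter (fun ℓ => ¬ Function.Injective ℓ),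
      ∏ i, a i (ℓ i) ≤ ∑ p ∈ Finset.univ.offDiag, ∑ x ∈ s, ∏ l, b p x l (ℓ l) := by
    intro ℓ hℓ
    rw [Finset.mem_filter, Fintype.mem_piFinset] at hℓ
    obtain ⟨hℓs, hni⟩ := hℓ
    simp only [Function.Injective, not_forall] at hni
    obtain ⟨i, j, hij, hne⟩ := hni
    have hnn : ∀ p x, 0 ≤ ∏ l, b p x l (ℓ l) := fun p x =>
      Finset.prod_nonneg fun l _ => hb0 p x l _ (hℓs l)
    have hmem : (i, j) ∈ (Finset.univ : Finset ι).offDiag := by simp [hne]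
    refine le_trans ?_ (Finset.single_le_sum (f := fun p => ∑ x ∈ s, ∏ l, b p x l (ℓ l))
      (fun p _ => Finset.sum_nonneg fun x _ => hnn p x) hmem)
    refine le_trans (le_of_eq ?_) (Finset.single_le_sum
      (f := fun x => ∏ l, b (i, j) x l (ℓ l)) (fun x _ => hnn _ x) (hℓs i))
    refine Finset.prod_congr rfl fun l _ => ?_
    simp only [hb]
    rw [if_neg]
    rintro ⟨rfl | rfl, h⟩
    · exact h rfl
    · exact h hij.symm
  have h2 : ∀ p ∈ (Finset.univ : Finset ι).offDiag, ∀ x ∈ s,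
      ∑ ℓ ∈ Fintype.piFinset (fun _ : ι => s), ∏ l, b p x l (ℓ l)
        ≤ a p.1 x * (δ * A ^ Fintype.card ι) := by
    rintro ⟨i, j⟩ hp x hx
    have hne : i ≠ j := by simpa using hp
    rw [← Finset.prod_univ_sum]
    have e1 : ∀ l, l = i ∨ l = j → ∑ y ∈ s, b (i, j) x l y = a l x := by
      intro l hl
      rw [Finset.sum_eq_single x]
      · simp [hb]
      · intro y _ hy
        simp only [hb]
        rw [if_pos ⟨hl, hy⟩]
      · exact fun h => absurd hx h
    have e2 : ∀ l, ∑ y ∈ s, b (i, j) x l y ≤ A := by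
      intro l
      refine le_trans (Finset.sum_le_sum fun y hy => ?_) (hA l)
      simp only [hb]
      split_ifs
      · exact ha l y hy
      · exact le_rfl
    have e3 : ∀ l, 0 ≤ ∑ y ∈ s, b (i, j) x l y := fun l =>
      Finset.sum_nonneg fun y hy => hb0 _ x l y hy
    have hj : j ∈ Finset.univ.erase i := Finset.mem_erase.2 ⟨hne.symm, Finset.mem_univ _⟩
    rw [← Finset.mul_prod_erase _ _ (Finset.mem_univ i), ← Finset.mul_prod_erase _ _ hj,
      e1 i (.inl rfl), e1 j (.inr rfl)]
    refine mul_le_mul_of_nonneg_left (mul_le_mul (hδ j x hx) ?_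
      (Finset.prod_nonneg fun l _ => e3 l) hδ0) (ha i x hx)
    refine (Finset.prod_le_prod (fun l _ => e3 l) fun l _ => e2 l).trans ?_
    rw [Finset.prod_const]
    exact pow_le_pow_right₀ hA1 (Finset.card_le_univ _)
  have hA0 : 0 ≤ A := by linarith
  calc _ ≤ ∑ ℓ ∈ (Fintype.piFinset fun _ : ι => s).filter (fun ℓ => ¬ Function.Injective ℓ),
        ∑ p ∈ Finset.univ.offDiag, ∑ x ∈ s, ∏ l, b p x l (ℓ l) := Finset.sum_le_sum h1
    _ ≤ ∑ ℓ ∈ Fintype.piFinset fun _ : ι => s,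
        ∑ p ∈ Finset.univ.offDiag, ∑ x ∈ s, ∏ l, b p x l (ℓ l) :=
        Finset.sum_le_sum_of_subset_of_nonneg (Finset.filter_subset _ _) fun ℓ hℓ _ =>
          Finset.sum_nonneg fun p _ => Finset.sum_nonneg fun x _ =>
            Finset.prod_nonneg fun l _ => hb0 p x l _ (Fintype.mem_piFinset.1 hℓ l)
    _ = ∑ p ∈ Finset.univ.offDiag, ∑ x ∈ s,
        ∑ ℓ ∈ Fintype.piFinset fun _ : ι => s, ∏ l, b p x l (ℓ l) := by
        rw [Finset.sum_comm]
        exact Finset.sum_congr rfl fun p _ => Finset.sum_comm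
    _ ≤ ∑ p ∈ (Finset.univ : Finset ι).offDiag, A * δ * A ^ Fintype.card ι := by
        refine Finset.sum_le_sum fun p hp => (Finset.sum_le_sum (h2 p hp)).trans ?_
        rw [← Finset.sum_mul, mul_assoc]
        exact mul_le_mul_of_nonneg_right (hA p.1) (by positivity)
    _ ≤ _ := by
        rw [Finset.sum_const, nsmul_eq_mul]
        refine mul_le_mul_of_nonneg_right ?_ (by positivity)
        have : (Finset.univ : Finset ι).offDiag.card ≤ Fintype.card ι ^ 2 := by
          rw [Finset.offDiag_card, Finset.card_univ, sq]
          exact Nat.sub_le _ _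
        exact_mod_cast this

/-! ### Upper and lower bounds for the tuple masses -/

/-- The normalised probability that the vertices `ℓ i` are sampled and have in-degree at least
`d i`. -/
noncomputable def degreeMass {Ω ι : Type*} [MeasurableSpace Ω] [Fintype ι] (P : Measure Ω)
    (par : ℕ → Ω → ℕ) (θ : ℝ) (n : ℕ) (d ℓ : ι → ℕ) : ℝ :=
  (∏ i, (n : ℝ)⁻¹ * θ ^ d i) * P.real (degreeEvent par n ℓ d)

/-- The injective choices of labels from `{1, …, n}`. -/
def injLabels (ι : Type*) [Fintype ι] [DecidableEq ι] (n : ℕ) : Finset (ι → ℕ) :=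
  (Fintype.piFinset fun _ : ι => Finset.Icc 1 n).filter Function.Injective

/-- Error in the lower bound of `degreeMass` by `lateMass`. -/
noncomputable def lowerError {ι : Type*} [Fintype ι] (θ g b : ℝ) (α : ℝ) (N n : ℕ) (d ℓ : ι → ℕ) : ℝ :=
  g * ∏ i, lateMass θ α N n (d i) (ℓ i)
    + 3 ^ Fintype.card ι * ((Fintype.card ι * b) ^ 2 * (2 / N))
      * ∏ i, if N < ℓ i then (n : ℝ)⁻¹
        * (θ ^ d i * poissonTail (d i - 2) (b * Real.log (n / ((ℓ i - 1 : ℕ) : ℝ)))) else 0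

theorem lowerError_nonneg {ι : Type*} [Fintype ι] {θ : ℝ} (hθ0 : 0 ≤ θ) {g b α : ℝ} (hg : 0 ≤ g)
    (hb0 : 0 ≤ b) (hα0 : 0 ≤ α)
    {N n : ℕ} (hN : 1 ≤ N) (d : ι → ℕ) {ℓ : ι → ℕ} (hℓ : ∀ i, ℓ i ∈ Finset.Icc 1 n) :
    0 ≤ lowerError θ g b α N n d ℓ := by
  refine add_nonneg (mul_nonneg hg (Finset.prod_nonneg fun i _ => lateMass_nonneg hθ0 hα0 (hℓ i)))
    (mul_nonneg (by positivity) (Finset.prod_nonneg fun i _ => ?_))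
  split_ifs with h
  · have hx' := Finset.mem_Icc.1 (hℓ i)
    exact mul_nonneg (by positivity) (mul_nonneg (by positivity) (poissonTail_nonneg _
      (mul_nonneg hb0 (log_div_nonneg_of_mem (Finset.mem_Icc.2 (by omega))))))
  · exact le_rfl

section mass

variable {Ω : Type*} [MeasurableSpace Ω] {P : Measure Ω} [IsProbabilityMeasure P]
  {W : ℕ → Ω → ℝ} {par : ℕ → Ω → ℕ} {μ θ wstar c z : ℝ}
  {ι : Type*} [Fintype ι] [DecidableEq ι]

/-- Dropping injectivity lets the sum of product bounds factorise over single labels. The irregular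
weights contribute once per tuple, and the number of tuples, at most n^k, cancels against the
normalisation n^{-k}. -/
theorem sum_degreeMass_le (hT : IsWeightedRecursiveTree P W par) (hws : 0 < wstar)
    (hW : ∀ᵐ ω ∂P, ∀ i, 1 ≤ i → wstar ≤ W i ω ∧ W i ω ≤ 1) (hμ : 0 < μ) (hθ : θ = 1 + μ)
    {N n : ℕ} {r b : ℝ} (hb : μ⁻¹ ≤ b) (hN : 1 ≤ N) (hNn : N ≤ n)
    (hβ : b⁻¹ + (N : ℝ)⁻¹ ≤ μ - r) (hz : 1 ≤ z) (d : ι → ℕ) :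
    ∑ ℓ ∈ injLabels ι n, degreeMass P par θ n d ℓ
      ≤ ∏ i, ((θ / z) ^ d i * ((N : ℝ) / n
            * Real.exp ((z - 1) * ((1 + Real.log N) / wstar + b * (1 + Real.log n))))
          + (b * μ) ^ d i * ∫ ω, (θ * W 1 ω / (W 1 ω + μ)) ^ d i ∂P)
        + (∏ i, θ ^ d i) * P.real (regularEvent W μ r N n)ᶜ := by
  have hθ0 : 0 < θ := by linarith
  have hb0 : 0 < b := lt_of_lt_of_le (by positivity) hb
  have hn0 : (0 : ℝ) < n := by exact_mod_cast hN.trans hNn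
  have hz0 : 0 < z := by linarith
  have hX01 : ∀ᵐ ω ∂P, 0 < W 1 ω ∧ W 1 ω ≤ 1 := by
    filter_upwards [hW] with ω h using ⟨hws.trans_le (h 1 le_rfl).1, (h 1 le_rfl).2⟩
  set B := (z - 1) * ((1 + Real.log N) / wstar + b * (1 + Real.log n))
  set F : ι → ℕ → ℝ := fun i x => if x ≤ N then (z ^ d i)⁻¹ * Real.exp B
      else ∫ ω, poissonTail (d i) (W 1 ω * (b * Real.log (n / ((x - 1 : ℕ) : ℝ)))) ∂P with hF
  have hF0 : ∀ i, ∀ x ∈ Finset.Icc 1 n, 0 ≤ F i x := by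
    intro i x hx
    simp only [hF]
    split_ifs with h
    · positivity
    · refine integral_nonneg_of_ae ?_
      filter_upwards [hX01] with ω hω
      have hx' := Finset.mem_Icc.1 hx
      exact poissonTail_nonneg _ (mul_nonneg hω.1.le (mul_nonneg hb0.le
        (log_div_nonneg_of_mem (Finset.mem_Icc.2 (by omega)))))
  have h1 : ∀ ℓ ∈ injLabels ι n, degreeMass P par θ n d ℓ
      ≤ ∏ i, ((n : ℝ)⁻¹ * (θ ^ d i * F i (ℓ i)))
        + (∏ i, (n : ℝ)⁻¹ * θ ^ d i) * P.real (regularEvent W μ r N n)ᶜ := by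
    intro ℓ hℓ
    rw [injLabels, Finset.mem_filter, Fintype.mem_piFinset] at hℓ
    have h2 := hT.measureReal_degreeEvent_le hws hW hb0 hN hNn hβ hz
      (fun i => (Finset.mem_Icc.1 (hℓ.1 i)).1) (fun i => (Finset.mem_Icc.1 (hℓ.1 i)).2) hℓ.2 d
    simp only [← mul_assoc]
    rw [Finset.prod_mul_distrib (g := fun i => F i (ℓ i)), ← mul_add]
    exact mul_le_mul_of_nonneg_left h2 (Finset.prod_nonneg fun i _ => by positivity)
  refine (Finset.sum_le_sum h1).trans ?_
  rw [Finset.sum_add_distrib]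
  refine add_le_add ?_ ?_
  · calc _ ≤ ∑ ℓ ∈ Fintype.piFinset fun _ : ι => Finset.Icc 1 n,
          ∏ i, ((n : ℝ)⁻¹ * (θ ^ d i * F i (ℓ i))) :=
          Finset.sum_le_sum_of_subset_of_nonneg (Finset.filter_subset _ _) fun ℓ hℓ _ =>
            Finset.prod_nonneg fun i _ => by
              have := hF0 i _ (Fintype.mem_piFinset.1 hℓ i)
              positivity
      _ = ∏ i, ∑ x ∈ Finset.Icc 1 n, (n : ℝ)⁻¹ * (θ ^ d i * F i x) := by
          rw [Finset.prod_univ_sum]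
      _ ≤ _ := by
          refine Finset.prod_le_prod (fun i _ => Finset.sum_nonneg fun x hx => ?_) fun i _ => ?_
          · have := hF0 i x hx
            positivity
          · exact sum_upper_le (hT.measurable_weight 1 le_rfl) hμ hθ hX01 hb hz hN hNn (d i)
  · rw [Finset.sum_const, nsmul_eq_mul, ← mul_assoc]
    refine mul_le_mul_of_nonneg_right ?_ measureReal_nonneg
    rw [Finset.prod_mul_distrib, ← mul_assoc]
    refine mul_le_of_le_one_left (Finset.prod_nonneg fun i _ => by positivity) ?_
    have hcard : (injLabels ι n).card ≤ n ^ Fintype.card ι := by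
      refine (Finset.card_filter_le _ _).trans ?_
      simp
    rw [Finset.prod_const, Finset.card_univ]
    calc _ ≤ ((n : ℝ) ^ Fintype.card ι) * (n : ℝ)⁻¹ ^ Fintype.card ι := by
          refine mul_le_mul_of_nonneg_right (by exact_mod_cast hcard) (by positivity)
      _ = 1 := by rw [← mul_pow, mul_inv_cancel₀ hn0.ne', one_pow]

/-- For tuples with all labels beyond N this is the normalised lower bound for weight-one vertices.
If some label is at most N, the left side vanishes. -/
theorem prod_lateMass_le (hT : IsWeightedRecursiveTree P W par)
    (hW1 : ∀ᵐ ω ∂P, ∀ i, 1 ≤ i → W i ω ≤ 1) (hθ0 : 0 ≤ θ)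
    {N n : ℕ} {r b α : ℝ} (hb0 : 0 < b) (hα0 : 0 < α) (hN : 1 ≤ N)
    (hα : μ + r ≤ α⁻¹) (hβ : b⁻¹ + (N : ℝ)⁻¹ ≤ μ - r) (d : ι → ℕ) {ℓ : ι → ℕ}
    (hℓ : ℓ ∈ injLabels ι n) :
    P.real {ω | W 1 ω = 1} ^ Fintype.card ι * ∏ i, lateMass θ α N n (d i) (ℓ i)
      ≤ degreeMass P par θ n d ℓ
        + lowerError θ (P.real (regularEvent W μ r N n)ᶜ) b α N n d ℓ := by
  rw [injLabels, Finset.mem_filter, Fintype.mem_piFinset] at hℓ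
  by_cases hall : ∀ i, N < ℓ i
  · have h := hT.le_measureReal_degreeEvent hW1 hα0 hb0 hN hα hβ hall
      (fun i => (Finset.mem_Icc.1 (hℓ.1 i)).2) hℓ.2 d
    have hc : 0 ≤ ∏ i, (n : ℝ)⁻¹ * θ ^ d i := Finset.prod_nonneg fun i _ => by positivity
    have h2 := mul_le_mul_of_nonneg_left h hc
    simp only [lowerError, lateMass, hall, if_true, degreeMass]
    simp only [← mul_assoc ((n : ℝ)⁻¹)]
    rw [Finset.prod_mul_distrib
        (g := fun i => poissonTail (d i) (α * Real.log (n / ℓ i))),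
      Finset.prod_mul_distrib
        (g := fun i => poissonTail (d i - 2) (b * Real.log (n / ((ℓ i - 1 : ℕ) : ℝ))))]
    linarith
  · have h0 : ∏ i, lateMass θ α N n (d i) (ℓ i) = 0 := by
      push Not at hall
      obtain ⟨i, hi⟩ := hall
      refine Finset.prod_eq_zero (Finset.mem_univ i) ?_
      rw [lateMass, if_neg (not_lt.2 hi), mul_zero]
    rw [h0, mul_zero]
    refine add_nonneg (mul_nonneg (Finset.prod_nonneg fun i _ => by positivity) measureReal_nonneg)
      (lowerError_nonneg hθ0 measureReal_nonneg hb0.le hα0.le hN d hℓ.1)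

theorem sum_lowerError_le (hμ : 0 < μ) (hθ : θ = 1 + μ) {g b α : ℝ} (hb : μ⁻¹ ≤ b)
    {N n : ℕ} (hN : 1 ≤ N) (hn : 1 ≤ n) (d : ι → ℕ) :
    ∑ ℓ ∈ Fintype.piFinset (fun _ : ι => Finset.Icc 1 n), lowerError θ g b α N n d ℓ
      ≤ g * ∏ i, ∑ x ∈ Finset.Icc 1 n, lateMass θ α N n (d i) x
        + 3 ^ Fintype.card ι * ((Fintype.card ι * b) ^ 2 * (2 / N))
          * ∏ i, θ ^ 2 * (b * μ) ^ d i := by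
  have hθ0 : 0 < θ := by linarith
  have hb0 : 0 < b := lt_of_lt_of_le (by positivity) hb
  simp only [lowerError]
  rw [Finset.sum_add_distrib, ← Finset.mul_sum, ← Finset.mul_sum,
    ← Finset.prod_univ_sum (fun _ => Finset.Icc 1 n) (fun i x => lateMass θ α N n (d i) x),
    ← Finset.prod_univ_sum (fun _ => Finset.Icc 1 n) (fun i x => if N < x then (n : ℝ)⁻¹
        * (θ ^ d i * poissonTail (d i - 2) (b * Real.log (n / ((x - 1 : ℕ) : ℝ)))) else 0)]
  refine add_le_add le_rfl (mul_le_mul_of_nonneg_left ?_ (by positivity))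
  have hf : (Finset.Icc 1 n).filter (fun x => N < x) = Finset.Ioc N n := by
    ext x; simp only [Finset.mem_filter, Finset.mem_Icc, Finset.mem_Ioc]; omega
  refine Finset.prod_le_prod (fun i _ => Finset.sum_nonneg fun x hx => ?_) fun i _ => ?_
  · split_ifs with h
    · have hx' := Finset.mem_Icc.1 hx
      exact mul_nonneg (by positivity) (mul_nonneg (by positivity) (poissonTail_nonneg _
        (mul_nonneg hb0.le (log_div_nonneg_of_mem (Finset.mem_Icc.2 (by omega))))))
    · exact le_rfl
  · rw [← Finset.sum_filter, hf]
    exact sum_lower_error_le hμ hθ hb hN hn (d i)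

end mass

/-! ### Limit of the tuple masses -/

section limits

variable {μ θ wstar c z : ℝ} {N : ℕ → ℕ} {r α β : ℕ → ℝ}

theorem IsTuning.tendsto_pow_β (ht : IsTuning μ θ wstar c z N r α β) (hμ : 0 < μ) {d : ℕ → ℕ}
    (hdc : ∀ᶠ n : ℕ in atTop, (d n : ℝ) ≤ c * Real.log n) :
    Tendsto (fun n => (β n * μ) ^ d n) atTop (𝓝 1) := by
  have h1 := (Real.continuous_exp.tendsto 0).comp ht.tendsto_β
  rw [Real.exp_zero] at h1
  refine tendsto_of_tendsto_of_tendsto_of_le_of_le' tendsto_const_nhds h1 ?_ (ht.pow_β_le hμ hdc)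
  filter_upwards [ht.le_β] with n hβ
  refine one_le_pow₀ ?_
  have := mul_le_mul_of_nonneg_right hβ hμ.le
  rwa [inv_mul_cancel₀ hμ.ne'] at this

theorem IsTuning.tendsto_early_pow (ht : IsTuning μ θ wstar c z N r α β) (hμ : 0 < μ)
    (hθ : θ = 1 + μ) {d : ℕ → ℕ} (hdc : ∀ᶠ n : ℕ in atTop, (d n : ℝ) ≤ c * Real.log n) :
    Tendsto (fun n => (θ / z) ^ d n * ((N n : ℝ) / n * Real.exp ((z - 1)
      * ((1 + Real.log (N n)) / wstar + β n * (1 + Real.log n))))) atTop (𝓝 0) := by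
  have hz0 : 0 < z := by linarith [ht.one_le_z]
  have hθ0 : 0 < θ := by linarith
  refine squeeze_zero' (.of_forall fun n => by positivity) ?_ ht.tendsto_early
  filter_upwards [hdc] with n hn
  exact mul_le_mul_of_nonneg_right (ht.pow_le_exp hn) (by positivity)

/-- The factors θ^d grow at most polynomially in n because d ≤ c log n, whereas irregular weights
have superpolynomially small probability. -/
theorem IsTuning.tendsto_prod_pow_mul (ht : IsTuning μ θ wstar c z N r α β) (hμ : 0 < μ)
    (hθ : θ = 1 + μ) {ι : Type*} [Fintype ι] {d : ℕ → ι → ℕ}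
    (hdc : ∀ᶠ n : ℕ in atTop, ∀ i, (d n i : ℝ) ≤ c * Real.log n) {g : ℕ → ℝ} (hg0 : ∀ n, 0 ≤ g n)
    (hg : ∀ᶠ n in atTop, g n ≤ n * (2 * Real.exp (-2 * r n ^ 2 * N n))) :
    Tendsto (fun n => (∏ i, θ ^ d n i) * g n) atTop (𝓝 0) := by
  have hθ0 : 0 < θ := by linarith
  refine squeeze_zero' (.of_forall fun n => mul_nonneg (Finset.prod_nonneg fun i _ => by positivity)
    (hg0 n)) ?_ (ht.tendsto_regular (Fintype.card ι * (Real.log θ * c)))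
  filter_upwards [hdc, hg] with n hn hgn
  rw [mul_comm]
  refine mul_le_mul hgn ?_ (Finset.prod_nonneg fun i _ => by positivity) (by positivity)
  have h1 : ∀ i, θ ^ d n i ≤ Real.exp (Real.log θ * (c * Real.log n)) := fun i => by
    rw [← Real.exp_log (show 0 < θ ^ d n i by positivity), Real.log_pow, mul_comm]
    exact Real.exp_le_exp.2 (mul_le_mul_of_nonneg_left (hn i) (Real.log_nonneg (by linarith)))
  refine (Finset.prod_le_prod (fun i _ => by positivity) fun i _ => h1 i).trans (le_of_eq ?_)
  rw [Finset.prod_const, Finset.card_univ, ← Real.exp_nat_mul]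
  congr 1
  ring

theorem IsTuning.tendsto_sum_not_injective (ht : IsTuning μ θ wstar c z N r α β) (hμ : 0 < μ)
    (hθ : θ = 1 + μ) {ι : Type*} [Fintype ι] [DecidableEq ι] {d : ℕ → ι → ℕ}
    (hd : ∀ i, Tendsto (fun n => d n i) atTop atTop)
    (hdc : ∀ᶠ n : ℕ in atTop, ∀ i, (d n i : ℝ) ≤ c * Real.log n) :
    Tendsto (fun n => ∑ ℓ ∈ (Fintype.piFinset fun _ : ι => Finset.Icc 1 n) \ injLabels ι n,
      ∏ i, lateMass θ (α n) (N n) n (d n i) (ℓ i)) atTop (𝓝 0) := by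
  have hθ0 : 0 < θ := by linarith
  have h1 : ∀ᶠ n in atTop, ∀ i : ι,
      ∑ x ∈ Finset.Icc 1 n, lateMass θ (α n) (N n) n (d n i) x ≤ 2 := by
    rw [eventually_all]
    intro i
    have h := ht.tendsto_sum_lateMass_real hμ hθ (hd i) (hdc.mono fun n hn => hn i)
    filter_upwards [h.eventually_lt_const one_lt_two] with n hn using hn.le
  have h2 : Tendsto (fun n => (Fintype.card ι : ℝ) ^ 2 * (2 * (N n : ℝ)⁻¹ * 2 ^ Fintype.card ι))
      atTop (𝓝 0) := by
    simpa using ((ht.tendsto_inv.const_mul 2).mul_const (2 ^ Fintype.card ι)).const_mul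
      ((Fintype.card ι : ℝ) ^ 2)
  refine squeeze_zero' ?_ ?_ h2
  · filter_upwards [ht.α_pos] with n hα
    exact Finset.sum_nonneg fun ℓ hℓ => Finset.prod_nonneg fun i _ => lateMass_nonneg hθ0.le hα.le
      (Fintype.mem_piFinset.1 (Finset.mem_sdiff.1 hℓ).1 i)
  · filter_upwards [h1, ht.α_pos, ht.α_le, ht.one_le_N] with n hn hα hα' hN
    rw [injLabels, ← Finset.filter_not]
    exact sum_not_injective_prod_le (Finset.Icc 1 n)
      (fun i x hx => lateMass_nonneg hθ0.le hα.le hx) one_le_two (by positivity) hn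
      fun i x hx => lateMass_le hμ hθ hα.le hα' hN hx

variable {Ω : Type*} [MeasurableSpace Ω] {P : Measure Ω} [IsProbabilityMeasure P]
  {W : ℕ → Ω → ℝ} {par : ℕ → Ω → ℕ} {ι : Type*} [Fintype ι] [DecidableEq ι]

/-- The masses `degreeMass` have, after rescaling the labels, an asymptotically normal
characteristic function with total mass `P (W 1 = 1) ^ card ι`. -/
theorem IsTuning.tendsto_sum_degreeMass (hT : IsWeightedRecursiveTree P W par) (hws : 0 < wstar)
    (hW : ∀ᵐ ω ∂P, ∀ i, 1 ≤ i → wstar ≤ W i ω ∧ W i ω ≤ 1) (hμW : μ = ∫ ω, W 1 ω ∂P)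
    (hμ : 0 < μ) (hθ : θ = 1 + μ) (ht : IsTuning μ θ wstar c z N r α β) {d : ℕ → ι → ℕ}
    (hd : ∀ i, Tendsto (fun n => d n i) atTop atTop)
    (hdc : ∀ᶠ n : ℕ in atTop, ∀ i, (d n i : ℝ) ≤ c * Real.log n) (u : ι → ℝ) :
    Tendsto (fun n => ∑ ℓ ∈ injLabels ι n, (degreeMass P par θ n (d n) ℓ : ℂ)
        * ∏ i, Complex.exp (Complex.I * ((u i * labelScale θ n (d n i) (ℓ i) : ℝ) : ℂ)))
      atTop (𝓝 ((P.real {ω | W 1 ω = 1} : ℂ) ^ Fintype.card ι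
        * ∏ i, Complex.exp (-((u i : ℂ) ^ 2 / 2)))) := by
  have hθ0 : 0 < θ := by linarith
  set p := P.real {ω | W 1 ω = 1} with hp
  have hp0 : 0 ≤ p := measureReal_nonneg
  set K := Fintype.card ι with hK
  have hdci : ∀ i, ∀ᶠ n : ℕ in atTop, (d n i : ℝ) ≤ c * Real.log n := fun i =>
    hdc.mono fun n hn => hn i
  have hX01 : ∀ᵐ ω ∂P, 0 < W 1 ω ∧ W 1 ω ≤ 1 := by
    filter_upwards [hW] with ω h using ⟨hws.trans_le (h 1 le_rfl).1, (h 1 le_rfl).2⟩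
  set g : ℕ → ℝ := fun n => P.real (regularEvent W μ (r n) (N n) n)ᶜ with hg
  have hg0 : ∀ n, 0 ≤ g n := fun n => measureReal_nonneg
  have hgle : ∀ᶠ n in atTop, g n ≤ n * (2 * Real.exp (-2 * r n ^ 2 * N n)) := by
    filter_upwards [ht.r_nonneg] with n hr
    simp only [hg, hμW]
    refine hT.measureReal_compl_regularEvent_le ?_ _ _ hr
    filter_upwards [hW] with ω h i hi using ⟨hws.le.trans (h i hi).1, (h i hi).2⟩
  have hgt : Tendsto g atTop (𝓝 0) := by
    have h := ht.tendsto_regular 0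
    simp only [zero_mul, Real.exp_zero, mul_one] at h
    exact squeeze_zero' (.of_forall hg0) hgle h
  have hmass : Tendsto (fun n => ∏ i, ∑ x ∈ Finset.Icc 1 n,
      lateMass θ (α n) (N n) n (d n i) x) atTop (𝓝 1) := by
    have h := tendsto_finsetProd (Finset.univ : Finset ι) fun i _ =>
      ht.tendsto_sum_lateMass_real hμ hθ (hd i) (hdci i)
    simpa using h
  -- The upper bound for the total mass: the early part vanishes, the rate correction tends to 1,
  -- and every coordinate contributes the atom p.
  have hup : Tendsto (fun n => ∏ i, ((θ / z) ^ d n i * ((N n : ℝ) / n * Real.exp ((z - 1)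
          * ((1 + Real.log (N n)) / wstar + β n * (1 + Real.log n))))
          + (β n * μ) ^ d n i * ∫ ω, (θ * W 1 ω / (W 1 ω + μ)) ^ d n i ∂P)
        + (∏ i, θ ^ d n i) * g n) atTop (𝓝 (p ^ K)) := by
    have h := (tendsto_finsetProd (Finset.univ : Finset ι) fun i _ =>
      (ht.tendsto_early_pow hμ hθ (hdci i)).add ((ht.tendsto_pow_β hμ (hdci i)).mul
        (tendsto_integral_pow_weight (hT.measurable_weight 1 le_rfl) hμ hθ hX01 (hd i)))).add
      (ht.tendsto_prod_pow_mul hμ hθ hdc hg0 hgle)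
    simpa [hp, hK] using h
  have herr : Tendsto (fun n => g n * ∏ i, ∑ x ∈ Finset.Icc 1 n,
        lateMass θ (α n) (N n) n (d n i) x
      + 3 ^ K * ((K * (2 * μ⁻¹)) ^ 2 * (2 / N n)) * ∏ i : ι, θ ^ 2 * (β n * μ) ^ d n i)
      atTop (𝓝 0) := by
    have h1 := tendsto_finsetProd (Finset.univ : Finset ι) fun i _ =>
      (ht.tendsto_pow_β hμ (hdci i)).const_mul (θ ^ 2)
    have h2 := ((ht.tendsto_inv.const_mul 2).const_mul ((K * (2 * μ⁻¹)) ^ 2)).const_mul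
      ((3 : ℝ) ^ K)
    have h3 := (hgt.mul hmass).add (h2.mul h1)
    simpa [div_eq_mul_inv] using h3
  have hoff := ht.tendsto_sum_not_injective hμ hθ hd hdc
  set a : ℕ → (ι → ℕ) → ℝ := fun n ℓ => p ^ K * ∏ i, lateMass θ (α n) (N n) n (d n i) (ℓ i)
    with ha
  set f : ℕ → (ι → ℕ) → ℂ := fun n ℓ =>
    ∏ i, Complex.exp (Complex.I * ((u i * labelScale θ n (d n i) (ℓ i) : ℝ) : ℂ)) with hf
  have hlim : Tendsto (fun n => ∑ ℓ ∈ Fintype.piFinset (fun _ : ι => Finset.Icc 1 n),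
      (a n ℓ : ℂ) * f n ℓ) atTop (𝓝 ((p : ℂ) ^ K * ∏ i, Complex.exp (-((u i : ℂ) ^ 2 / 2)))) := by
    have h := (tendsto_finsetProd (Finset.univ : Finset ι) fun i _ =>
      ht.tendsto_sum_lateMass hμ hθ (hd i) (hdci i) (u i)).const_mul ((p : ℂ) ^ K)
    refine h.congr fun n => ?_
    rw [Finset.prod_univ_sum, Finset.mul_sum]
    refine Finset.sum_congr rfl fun ℓ _ => ?_
    simp only [ha, hf, Finset.prod_mul_distrib]
    push_cast
    ring
  rw [tendsto_iff_norm_sub_tendsto_zero] at hlim ⊢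
  have hbound : Tendsto (fun n => ((∏ i, ((θ / z) ^ d n i * ((N n : ℝ) / n * Real.exp ((z - 1)
          * ((1 + Real.log (N n)) / wstar + β n * (1 + Real.log n))))
          + (β n * μ) ^ d n i * ∫ ω, (θ * W 1 ω / (W 1 ω + μ)) ^ d n i ∂P)
        + (∏ i, θ ^ d n i) * g n)
        - p ^ K * ∏ i, ∑ x ∈ Finset.Icc 1 n, lateMass θ (α n) (N n) n (d n i) x)
      + 2 * (g n * ∏ i, ∑ x ∈ Finset.Icc 1 n, lateMass θ (α n) (N n) n (d n i) x
      + 3 ^ K * ((K * (2 * μ⁻¹)) ^ 2 * (2 / N n)) * ∏ i : ι, θ ^ 2 * (β n * μ) ^ d n i)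
      + 2 * (p ^ K * ∑ ℓ ∈ (Fintype.piFinset fun _ : ι => Finset.Icc 1 n) \ injLabels ι n,
        ∏ i, lateMass θ (α n) (N n) n (d n i) (ℓ i))) atTop (𝓝 0) := by
    have h := ((hup.sub (hmass.const_mul (p ^ K))).add (herr.const_mul 2)).add
      ((hoff.const_mul (p ^ K)).const_mul 2)
    simpa using h
  have htot := hbound.add hlim
  rw [add_zero] at htot
  refine squeeze_zero' (.of_forall fun _ => norm_nonneg _) ?_ htot
  filter_upwards [ht.one_le_N, ht.N_le, ht.α_pos, ht.α_le, ht.le_β, ht.β_le, ht.add_le, ht.le_sub]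
    with n hN hNn hα0 hα hβ hβ' hadd hsub
  have hβ0 : 0 < β n := lt_of_lt_of_le (by positivity) hβ
  refine (norm_sub_le_norm_sub_add_norm_sub _ _ _).trans (add_le_add ?_ le_rfl)
  have hnorm : ∀ ℓ, ‖f n ℓ‖ ≤ 1 := fun ℓ => by
    simp only [hf, norm_prod, mul_comm Complex.I, Complex.norm_exp_ofReal_mul_I, Finset.prod_const_one,
      le_refl]
  -- The comparison measure is the product of late masses times p^K on all tuples; the true one
  -- lives on injective tuples. The three resulting error terms are those of `hbound`.
  have hmain := norm_sum_mul_sub_le (S := injLabels ι n)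
    (T := Fintype.piFinset fun _ : ι => Finset.Icc 1 n) (Finset.filter_subset _ _)
    (q := degreeMass P par θ n (d n)) (a := a n)
    (e := lowerError θ (g n) (β n) (α n) (N n) n (d n)) (f := f n)
    (fun ℓ hℓ => mul_nonneg (by positivity) (Finset.prod_nonneg fun i _ =>
      lateMass_nonneg hθ0.le hα0.le (Fintype.mem_piFinset.1 hℓ i)))
    (fun ℓ hℓ => lowerError_nonneg hθ0.le (hg0 n) hβ0.le hα0.le hN _ (Fintype.mem_piFinset.1 hℓ))
    (fun ℓ hℓ => prod_lateMass_le hT (hW.mono fun ω h i hi => (h i hi).2) hθ0.le hβ0 hα0 hN hadd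
      hsub _ hℓ) hnorm
  refine hmain.trans ?_
  have h1 := sum_degreeMass_le hT hws hW hμ hθ hβ hN hNn hsub ht.one_le_z (d n)
  have h2 := sum_lowerError_le (g := g n) (α := α n) hμ hθ hβ hN (hN.trans hNn) (d n)
  have h3 : (3 : ℝ) ^ K * ((K * β n) ^ 2 * (2 / N n)) * ∏ i : ι, θ ^ 2 * (β n * μ) ^ d n i
      ≤ 3 ^ K * ((K * (2 * μ⁻¹)) ^ 2 * (2 / N n)) * ∏ i : ι, θ ^ 2 * (β n * μ) ^ d n i := by
    gcongr
  have h4 : ∑ ℓ ∈ Fintype.piFinset (fun _ : ι => Finset.Icc 1 n), a n ℓ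
      = p ^ K * ∏ i, ∑ x ∈ Finset.Icc 1 n, lateMass θ (α n) (N n) n (d n i) x := by
    rw [Finset.prod_univ_sum, Finset.mul_sum]
  have h5 : ∑ ℓ ∈ (Fintype.piFinset fun _ : ι => Finset.Icc 1 n) \ injLabels ι n, a n ℓ
      = p ^ K * ∑ ℓ ∈ (Fintype.piFinset fun _ : ι => Finset.Icc 1 n) \ injLabels ι n,
        ∏ i, lateMass θ (α n) (N n) n (d n i) (ℓ i) := by
    rw [Finset.mul_sum]
  rw [h4, h5]
  refine add_le_add (add_le_add (sub_le_sub h1 le_rfl) ?_) le_rfl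
  exact mul_le_mul_of_nonneg_left (h2.trans (add_le_add le_rfl h3)) two_pos.le

end limits

/-! ### From characteristic functions to convergence in law -/

/-- Lévy's continuity theorem, applied after transport to `EuclideanSpace`, where the characteristic
function is taken with respect to the inner product; the continuous inverse map brings the
convergence back. -/
theorem tendsto_stdNormalVector_of_charFun {k : ℕ} {Q : ℕ → FiniteMeasure (Fin k → ℝ)}
    (hQ : ∀ᶠ n in atTop, IsProbabilityMeasure (Q n : Measure (Fin k → ℝ)))
    (h : ∀ u : Fin k → ℝ, Tendsto (fun n => ∫ x, ∏ i,
        Complex.exp (Complex.I * ((u i * x i : ℝ) : ℂ)) ∂(Q n : Measure (Fin k → ℝ)))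
      atTop (𝓝 (∏ i, Complex.exp (-((u i : ℂ) ^ 2 / 2))))) :
    Tendsto Q atTop (𝓝 (stdNormalVector k)) := by
  -- A conditional law may be zero for small n, so the sequence is shifted to consist of probability
  -- measures.
  obtain ⟨M, hM⟩ := eventually_atTop.1 hQ
  rw [← tendsto_add_atTop_iff_nat M]
  have hlp : Measurable (WithLp.toLp 2 : (Fin k → ℝ) → EuclideanSpace ℝ (Fin k)) := by fun_prop
  let R : ℕ → ProbabilityMeasure (Fin k → ℝ) := fun n => ⟨Q (n + M), hM _ (Nat.le_add_left _ _)⟩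
  let R₀ : ProbabilityMeasure (Fin k → ℝ) := ⟨Measure.pi fun _ => gaussianReal 0 1, inferInstance⟩
  have hE : Tendsto (fun n => (R n).map hlp.aemeasurable) atTop (𝓝 (R₀.map hlp.aemeasurable)) := by
    refine ProbabilityMeasure.tendsto_of_tendsto_charFun fun t => ?_
    have h0 : charFun ((R₀.map hlp.aemeasurable : ProbabilityMeasure _) :
        Measure (EuclideanSpace ℝ (Fin k))) t = ∏ i, Complex.exp (-((t i : ℂ) ^ 2 / 2)) := by
      rw [ProbabilityMeasure.toMeasure_map]
      refine (charFun_pi t).trans (Finset.prod_congr rfl fun i _ => ?_)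
      rw [charFun_gaussianReal]
      congr 1
      simp
    rw [h0]
    refine (((tendsto_add_atTop_iff_nat M).2 (h fun i => t i))).congr fun n => ?_
    rw [ProbabilityMeasure.toMeasure_map, charFun_apply, integral_map hlp.aemeasurable
      (Continuous.aestronglyMeasurable (by fun_prop))]
    refine integral_congr_ae (.of_forall fun x => ?_)
    simp only
    rw [← Complex.exp_sum, ← Finset.mul_sum, mul_comm, PiLp.inner_apply]
    push_cast
    simp [mul_comm]
  have hof : Continuous (WithLp.ofLp : EuclideanSpace ℝ (Fin k) → (Fin k → ℝ)) := by fun_prop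
  have hF := ProbabilityMeasure.tendsto_map_of_tendsto_of_continuous _ _ hE hof
  have hmm : ∀ S : ProbabilityMeasure (Fin k → ℝ),
      (S.map hlp.aemeasurable).map hof.measurable.aemeasurable = S := by
    intro S
    apply Subtype.ext
    change ((S.map hlp.aemeasurable).map hof.measurable.aemeasurable : Measure (Fin k → ℝ))
      = (S : Measure (Fin k → ℝ))
    rw [ProbabilityMeasure.toMeasure_map, ProbabilityMeasure.toMeasure_map,
      Measure.map_map hof.measurable hlp]
    exact Measure.map_id
  simp only [hmm] at hF
  exact (ProbabilityMeasure.tendsto_nhds_iff_toFiniteMeasure_tendsto_nhds atTop).1 hF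

/-! ### Uniformly sampled vertices and conditioning -/

theorem coe_injLabels (k n : ℕ) : (injLabels (Fin k) n : Set (Fin k → ℕ))
    = {j : Fin k → ℕ | Function.Injective j ∧ ∀ i, j i ∈ Set.Icc 1 n} := by
  ext j
  simp [injLabels, and_comm]

theorem injLabels_nonempty {k n : ℕ} (hkn : k ≤ n) : (injLabels (Fin k) n).Nonempty := by
  refine ⟨fun i => i + 1, ?_⟩
  rw [injLabels, Finset.mem_filter, Fintype.mem_piFinset]
  refine ⟨fun i => Finset.mem_Icc.2 (by omega), fun i j hij => Fin.ext ?_⟩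
  simpa using hij

theorem IsUniformSample.measure_eq {Ω : Type*} {m : MeasurableSpace Ω} [MeasurableSpace Ω]
    {P : Measure Ω} {n k : ℕ} {v : Fin k → Ω → ℕ} (hv : IsUniformSample m P n k v)
    {ℓ : Fin k → ℕ} (hℓ : ℓ ∈ injLabels (Fin k) n) :
    P {ω | (fun i => v i ω) = ℓ} = 1 / (injLabels (Fin k) n).card := by
  have hm : Measurable fun ω i => v i ω := measurable_pi_lambda _ hv.measurable
  have h := congrArg (fun ν => ν {ℓ}) hv.map_eq
  simp only [Measure.map_apply hm (measurableSet_singleton ℓ)] at h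
  rw [← coe_injLabels, ← Finset.coe_singleton, uniformOn_apply_finset,
    Finset.inter_singleton_of_mem hℓ, Finset.card_singleton, Nat.cast_one,
    Finset.coe_singleton] at h
  exact h

theorem IsUniformSample.ae_mem {Ω : Type*} {m : MeasurableSpace Ω} [MeasurableSpace Ω]
    {P : Measure Ω} {n k : ℕ} {v : Fin k → Ω → ℕ} (hv : IsUniformSample m P n k v) :
    ∀ᵐ ω ∂P, (fun i => v i ω) ∈ injLabels (Fin k) n := by
  have hm : Measurable fun ω i => v i ω := measurable_pi_lambda _ hv.measurable
  have h : ∀ᵐ j ∂(P.map fun ω i => v i ω), j ∈ (injLabels (Fin k) n : Set (Fin k → ℕ)) := by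
    rw [hv.map_eq, coe_injLabels]
    exact ae_cond_mem (Set.Countable.measurableSet (Set.to_countable _))
  exact ae_of_ae_map hm.aemeasurable h

theorem highDegreeEvent_eq_iUnion {Ω : Type*} {k : ℕ} (par : ℕ → Ω → ℕ) (n : ℕ) (v : Fin k → Ω → ℕ) (d : Fin k → ℤ) :
    highDegreeEvent par n v d
      = ⋃ ℓ, {ω | (fun i => v i ω) = ℓ} ∩ degreeEvent par n ℓ fun i => (d i).toNat := by
  ext ω
  simp [highDegreeEvent, degreeEvent, Int.toNat_le]

section sample

variable {Ω : Type*} [MeasurableSpace Ω] {P : Measure Ω} [IsProbabilityMeasure P]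
  {W : ℕ → Ω → ℝ} {par : ℕ → Ω → ℕ} {n k : ℕ} {v : Fin k → Ω → ℕ}

/-- Split according to the sampled tuple: each injective tuple is equally likely, and the sample is
independent of the tree. -/
theorem setIntegral_highDegreeEvent (hT : IsWeightedRecursiveTree P W par)
    (hv : IsUniformSample (wrtSigma W par) P n k v) (d : Fin k → ℤ) (g : (Fin k → ℕ) → ℂ) :
    ∫ ω in highDegreeEvent par n v d, g (fun i => v i ω) ∂P
      = ((injLabels (Fin k) n).card : ℂ)⁻¹ * ∑ ℓ ∈ injLabels (Fin k) n,
        (P.real (degreeEvent par n ℓ fun i => (d i).toNat) : ℂ) * g ℓ := by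
  have hm : Measurable fun ω i => v i ω := measurable_pi_lambda _ hv.measurable
  set A : (Fin k → ℕ) → Set Ω := fun ℓ =>
    {ω | (fun i => v i ω) = ℓ} ∩ degreeEvent par n ℓ fun i => (d i).toNat with hA
  have hAm : ∀ ℓ, MeasurableSet (A ℓ) := fun ℓ => (hm (measurableSet_singleton ℓ)).inter
    (measurableSet_degreeEvent (fun j hj => hT.measurable_par j hj.1) ℓ _)
  have hE : highDegreeEvent par n v d =ᵐ[P] ⋃ ℓ ∈ injLabels (Fin k) n, A ℓ := by
    rw [highDegreeEvent_eq_iUnion]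
    filter_upwards [hv.ae_mem] with ω hω
    refine propext ⟨fun h => ?_, fun h => ?_⟩
    · obtain ⟨ℓ, hℓ⟩ := Set.mem_iUnion.1 h
      exact Set.mem_iUnion₂.2 ⟨ℓ, hℓ.1 ▸ hω, hℓ⟩
    · obtain ⟨ℓ, _, hℓ⟩ := Set.mem_iUnion₂.1 h
      exact Set.mem_iUnion.2 ⟨ℓ, hℓ⟩
  have hcongr : ∀ ℓ, Set.EqOn (fun ω => g fun i => v i ω) (fun _ => g ℓ) (A ℓ) := fun ℓ ω hω => by
    simp only
    rw [show (fun i => v i ω) = ℓ from hω.1]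
  rw [setIntegral_congr_set hE, integral_biUnion_finset _ (fun ℓ _ => hAm ℓ), Finset.mul_sum]
  · refine Finset.sum_congr rfl fun ℓ hℓ => ?_
    rw [setIntegral_congr_fun (hAm ℓ) (hcongr ℓ), setIntegral_const, Complex.real_smul, ← mul_assoc]
    congr 1
    have hind : P (A ℓ) = P {ω | (fun i => v i ω) = ℓ}
        * P (degreeEvent par n ℓ fun i => (d i).toNat) := by
      refine (Indep_iff _ _ _).1 hv.indep _ _ ?_ ?_
      · have : {ω | (fun i => v i ω) = ℓ} = ⋂ i, v i ⁻¹' {ℓ i} := by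
          ext ω; simp [funext_iff]
        rw [this]
        refine MeasurableSet.iInter fun i => ?_
        exact (le_iSup (fun i => MeasurableSpace.comap (v i) inferInstance) i) _
          ⟨{ℓ i}, measurableSet_singleton _, rfl⟩
      · refine measurableSet_degreeEvent (fun j hj => ?_) ℓ _
        refine measurable_iff_comap_le.2 (le_sup_of_le_right ?_)
        exact le_iSup₂_of_le (f := fun j (_ : j ∈ Set.Ici 2) =>
          MeasurableSpace.comap (par j) inferInstance) j hj.1 le_rfl
    rw [measureReal_def, measureReal_def, hind, hv.measure_eq hℓ, ENNReal.toReal_mul]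
    simp
  · intro ℓ _ ℓ' _ hne
    refine Set.disjoint_left.2 fun ω h h' => hne ?_
    exact h.1.symm.trans h'.1
  · intro ℓ _
    exact (integrableOn_const (C := g ℓ)).congr_fun (hcongr ℓ).symm (hAm ℓ)

/-- The normalising constant does not depend on the tuple. It therefore cancels in conditional
expectations, and n^{-k} can be used in place of the exact sampling probability. -/
theorem sum_degreeMass_mul_eq (hT : IsWeightedRecursiveTree P W par) (hkn : k ≤ n)
    (hv : IsUniformSample (wrtSigma W par) P n k v) (θ : ℝ) (d : Fin k → ℤ)
    (g : (Fin k → ℕ) → ℂ) :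
    ∑ ℓ ∈ injLabels (Fin k) n, (degreeMass P par θ n (fun i => (d i).toNat) ℓ : ℂ) * g ℓ
      = (((∏ i, (n : ℝ)⁻¹ * θ ^ (d i).toNat : ℝ) : ℂ) * (injLabels (Fin k) n).card)
        * ∫ ω in highDegreeEvent par n v d, g (fun i => v i ω) ∂P := by
  have hcard : ((injLabels (Fin k) n).card : ℂ) ≠ 0 := by
    exact_mod_cast (Finset.card_pos.2 (injLabels_nonempty hkn)).ne'
  rw [setIntegral_highDegreeEvent hT hv, mul_assoc, mul_inv_cancel_left₀ hcard, Finset.mul_sum]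
  refine Finset.sum_congr rfl fun ℓ _ => ?_
  rw [degreeMass, Complex.ofReal_mul, mul_assoc]

theorem integral_cond_highDegreeEvent (hT : IsWeightedRecursiveTree P W par) (hkn : k ≤ n)
    (hv : IsUniformSample (wrtSigma W par) P n k v) (θ : ℝ) (d : Fin k → ℤ)
    (hne : ∑ ℓ ∈ injLabels (Fin k) n, (degreeMass P par θ n (fun i => (d i).toNat) ℓ : ℂ) * 1 ≠ 0)
    (g : (Fin k → ℕ) → ℂ) :
    ∫ ω, g (fun i => v i ω) ∂P[|highDegreeEvent par n v d]
      = (∑ ℓ ∈ injLabels (Fin k) n, (degreeMass P par θ n (fun i => (d i).toNat) ℓ : ℂ) * g ℓ)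
        / ∑ ℓ ∈ injLabels (Fin k) n,
          (degreeMass P par θ n (fun i => (d i).toNat) ℓ : ℂ) * 1 := by
  rw [sum_degreeMass_mul_eq hT hkn hv θ d fun _ => 1] at hne ⊢
  rw [sum_degreeMass_mul_eq hT hkn hv θ d g, mul_div_mul_left _ _ (left_ne_zero_of_mul hne),
    ProbabilityTheory.cond, integral_smul_measure, setIntegral_const, Complex.real_smul,
    Complex.real_smul, mul_one, ENNReal.toReal_inv, Complex.ofReal_inv, ← measureReal_def, div_eq_inv_mul]

theorem measure_highDegreeEvent_pos (hT : IsWeightedRecursiveTree P W par) (hkn : k ≤ n)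
    (hv : IsUniformSample (wrtSigma W par) P n k v) (θ : ℝ) (d : Fin k → ℤ)
    (hne : ∑ ℓ ∈ injLabels (Fin k) n,
      (degreeMass P par θ n (fun i => (d i).toNat) ℓ : ℂ) * 1 ≠ 0) :
    0 < P (highDegreeEvent par n v d) := by
  rw [sum_degreeMass_mul_eq hT hkn hv θ d fun _ => 1] at hne
  refine pos_iff_ne_zero.2 fun h => right_ne_zero_of_mul hne ?_
  rw [Measure.restrict_eq_zero.2 h, integral_zero_measure]

end sample

/-! ### Conclusion -/

theorem mainTheorem3 {Ω : Type*} [MeasurableSpace Ω] (P : Measure Ω) [IsProbabilityMeasure P]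
    (W : ℕ → Ω → ℝ) (par : ℕ → Ω → ℕ) (hT : IsWeightedRecursiveTree P W par)
    (hatom : IsAtomWeight P (W 1))
    (wstar : ℝ) (hwstar : wstar ∈ Set.Ioo (0 : ℝ) 1) (hlow : ∀ᵐ ω ∂P, wstar ≤ W 1 ω)
    (θ : ℝ) (hθ : θ = 1 + ∫ ω, W 1 ω ∂P)
    (k : ℕ) (v : ℕ → Fin k → Ω → ℕ)
    (hv : ∀ n, k ≤ n → IsUniformSample (wrtSigma W par) P n k (v n))
    (c : ℝ) (hc : c ∈ Set.Ioo 0 (θ / (θ - 1)))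
    (d : ℕ → Fin k → ℤ) (hd : ∀ i, Tendsto (fun n => d n i) atTop atTop)
    (hdc : ∀ᶠ n : ℕ in atTop, ∀ i, (d n i : ℝ) ≤ c * Real.log n) :
    (∀ᶠ n : ℕ in atTop, 0 < P (highDegreeEvent par n (v n) (d n))) ∧
      Tendsto
        (fun n : ℕ => condLaw P (highDegreeEvent par n (v n) (d n)) (rescaledLabels θ n (v n) (d n)))
        atTop (𝓝 (stdNormalVector k)) := by
  have hW := hT.ae_weight_mem hatom hlow
  set μ := ∫ ω, W 1 ω ∂P with hμW
  have hint : Integrable (W 1) P := by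
    refine Integrable.of_bound (C := 1) (hT.measurable_weight 1 le_rfl).aestronglyMeasurable ?_
    filter_upwards [hW] with ω h
    rw [Real.norm_eq_abs, abs_le]
    constructor <;> linarith [(h 1 le_rfl).1, (h 1 le_rfl).2, hwstar.1]
  have hμ : 0 < μ := by
    have h := integral_mono_ae (integrable_const wstar) hint hlow
    rw [integral_const, probReal_univ, one_smul] at h
    exact hwstar.1.trans_le h
  obtain ⟨z, N, r, α, β, ht⟩ := exists_isTuning hμ hθ hwstar.1 hc
  have hd' : ∀ i, Tendsto (fun n => (d n i).toNat) atTop atTop := fun i =>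
    tendsto_atTop.2 fun b => ((hd i).eventually_ge_atTop (b : ℤ)).mono fun n hn => by omega
  have hpos : ∀ᶠ n in atTop, ∀ i, 0 ≤ d n i :=
    eventually_all.2 fun i => (hd i).eventually_ge_atTop 0
  have hcast : ∀ {x : ℤ}, 0 ≤ x → ((x.toNat : ℕ) : ℝ) = x := fun {x} hx => by
    exact_mod_cast congrArg (Int.cast (R := ℝ)) (Int.toNat_of_nonneg hx)
  have hdc' : ∀ᶠ n : ℕ in atTop, ∀ i, ((d n i).toNat : ℝ) ≤ c * Real.log n := by
    filter_upwards [hdc, hpos] with n hn h0 i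
    rw [hcast (h0 i)]
    exact hn i
  have hlim := fun u : Fin k → ℝ => ht.tendsto_sum_degreeMass hT hwstar.1 hW hμW hμ hθ hd' hdc' u
  have hp : 0 < P.real {ω | W 1 ω = 1} := ENNReal.toReal_pos hatom.atom.ne' (measure_ne_top _ _)
  have hpk : (P.real {ω | W 1 ω = 1} : ℂ) ^ Fintype.card (Fin k) ≠ 0 :=
    pow_ne_zero _ (by exact_mod_cast hp.ne')
  -- The case u = 0 is the total mass. Its limit is positive because of the atom, which makes the
  -- conditioning event eventually have positive probability.
  have hlim1 : Tendsto (fun n => ∑ ℓ ∈ injLabels (Fin k) n,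
      (degreeMass P par θ n (fun i => (d n i).toNat) ℓ : ℂ) * 1) atTop
      (𝓝 ((P.real {ω | W 1 ω = 1} : ℂ) ^ Fintype.card (Fin k))) := by
    simpa using hlim 0
  have hne := hlim1.eventually_ne hpk
  have hE : ∀ᶠ n : ℕ in atTop, 0 < P (highDegreeEvent par n (v n) (d n)) := by
    filter_upwards [hne, eventually_ge_atTop k] with n hn hkn
    exact measure_highDegreeEvent_pos hT hkn (hv n hkn) θ (d n) hn
  have hscale : ∀ᶠ n in atTop, k ≤ n ∧ rescaledLabels θ n (v n) (d n)
      = (fun ℓ i => labelScale θ n (d n i).toNat (ℓ i)) ∘ fun ω i => v n i ω := by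
    filter_upwards [hpos, eventually_ge_atTop k] with n h0 hkn
    refine ⟨hkn, funext fun ω => funext fun i => ?_⟩
    simp only [rescaledLabels, labelScale, Function.comp, hcast (h0 i)]
  have hmeas : ∀ᶠ n in atTop, Measurable (rescaledLabels θ n (v n) (d n)) := by
    filter_upwards [hscale] with n hn
    rw [hn.2]
    exact (measurable_of_countable _).comp (measurable_pi_lambda _ (hv n hn.1).measurable)
  refine ⟨hE, tendsto_stdNormalVector_of_charFun ?_ fun u => ?_⟩
  · filter_upwards [hE, hmeas] with n hn hm
    have := cond_isProbabilityMeasure (μ := P) hn.ne'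
    exact Measure.isProbabilityMeasure_map hm.aemeasurable
  -- The conditional characteristic function is the ratio of the sum at u to the sum at 0, and the
  -- power of p cancels in the limit.
  · have h := (hlim u).div hlim1 hpk
    rw [mul_div_cancel_left₀ _ hpk] at h
    refine h.congr' ?_
    filter_upwards [hne, hscale, hmeas] with n hn hs hm
    have hI := integral_cond_highDegreeEvent hT hs.1 (hv n hs.1) θ (d n) hn fun ℓ =>
      ∏ i, Complex.exp (Complex.I * ((u i * labelScale θ n (d n i).toNat (ℓ i) : ℝ) : ℂ))
    refine hI.symm.trans ?_
    change _ = ∫ x, _ ∂((P[|highDegreeEvent par n (v n) (d n)]).map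
      (rescaledLabels θ n (v n) (d n)))
    rw [integral_map hm.aemeasurable (Continuous.aestronglyMeasurable (by fun_prop)), hs.2]
    rfl
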